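/- Let $n\ge 2$, $p\in(-n,0)$, $1\le q<n+1$, and let $f$ be a measurable function on $\mathbb S^{n-1}$ with $\frac1\Lambda<f<\Lambda$ almost everywhere, for some constant $\Lambda>0$. Let $\epsilon\in(0,1/4)$, $p'\in(-n,-n+1]$, and let $\phi_\epsilon$ be a positive, strictly convex, decreasing, differentiable function on $(0,\infty)$ such that $\phi_\epsilon(z)=-\frac1p z^p$ for $z\ge1$, $\phi_\epsilon(z)\ge\frac1{n-1}z^{-n+1}$ for $0<z<\epsilon$, and $\phi_\epsilon(z)\le A z^{p'}$ for $0<z<\frac14$, with some constant $A$. Integrals over $\mathbb S^{n-1}$ are with respect to spherical Lebesgue measure, and $\omega_n$ is the volume of the unit ball of $\mathbb R^n$. Let $\mathcal S^+$ be the set of support functions (on $\mathbb S^{n-1}$) of convex bodies in $\mathbb R^n$ that contain the origin in their interior. For $h\in\mathcal S^+$ let $[h]=\{x: x\cdot u\le h(u)\ \forall u\in\mathbb S^{n-1}\}$ be the body with support function $h$. For a convex body $K$ put $$I_q(K)=\frac1{n\omega_n}\int_{\mathbb S^{n-1}}\int_{u^\perp}|K\cap(x+\mathbb Ru)|^q\,dx\,du,\qquad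 \widetilde V_{q-1}(K,z)=\frac1n\int_{\{u\in\mathbb S^{n-1}:\,\rho_{K,z}(u)>0\}}\rho_{K,z}(u)^{q-1}\,du\quad(z\in K),$$ where $\rho_{K,z}(u)=\max\{\lambda\ge0: z+\lambda u\in K\}$. Let $\Phi(h,\xi)=\int_{\mathbb S^{n-1}}f(x)\,\phi_\epsilon(h(x)-\xi\cdot x)\,dx\in[0,\infty]$ for $\xi\in[h]$, with $\phi_\epsilon(0)=+\infty$. Suppose that $h_\epsilon\in\mathcal S^+$ with $I_q([h_\epsilon])=1$ is a maximizer of $$\sup\Big\{\inf_{\xi\in[h]}\Phi(h,\xi)\;:\;h\in\mathcal S^+,\ I_q([h])=1\Big\},$$ and that $\inf_{\xi\in[h_\epsilon]}\Phi(h_\epsilon,\xi)$ is attained at $\xi=o$. Then $$C_\epsilon:=-\frac{2q}{(n+q-1)\,\omega_n}\int_{\mathbb S^{n-1}}f\,\phi_\epsilon'(h_\epsilon)\,h_\epsilon>0,$$ and $h_\epsilon$ is a generalized solution on $\mathbb S^{n-1}$ of $$\det(\nabla^2h_\epsilon+h_\epsilon I)=-\frac{f\,\phi_\epsilon'(h_\epsilon)}{C_\epsilon\,\widetilde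 V_{q-1}([h_\epsilon],\bar\nabla h_\epsilon)},$$ where $\bar\nabla h_\epsilon$ is the Euclidean gradient of the $1$-homogeneous extension of $h_\epsilon$ (it exists almost everywhere on the sphere). That is, the right-hand side $R$ is nonnegative almost everywhere and integrable, and for every Borel set $\eta\subset\mathbb S^{n-1}$ the set of boundary points of $[h_\epsilon]$ that have an outer unit normal in $\eta$ has $(n-1)$-dimensional Hausdorff measure $\int_\eta R$. -/

import Mathlib

open MeasureTheory Set
open scoped ENNReal RealInnerProductSpace

noncomputable section

namespace ChordMinkowski

/-- Euclidean space `ℝⁿ`. -/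
abbrev E (n : ℕ) : Type := EuclideanSpace ℝ (Fin n)

/-- The unit sphere `𝕊ⁿ⁻¹` of `ℝⁿ`. -/
abbrev S (n : ℕ) : Type := Metric.sphere (0 : E n) 1

/-- Spherical Lebesgue measure on `𝕊ⁿ⁻¹`, of total mass `n ωₙ`. -/
def sph (n : ℕ) : Measure (S n) := (volume : Measure (E n)).toSphere

/-- `ωₙ`, the volume of the unit ball of `ℝⁿ`. -/
def omega (n : ℕ) : ℝ := (volume : Measure (E n)).real (Metric.ball 0 1)

variable {n : ℕ}

/-- The support function `h_K(v) = max {v · x : x ∈ K}`. -/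
def supportFn (K : Set (E n)) (v : E n) : ℝ := sSup ((fun x => ⟪x, v⟫) '' K)

/-- The Wulff shape `[h]` of a function on the sphere. If `h` is the support function of a convex
body then `[h]` is that body. -/
def wulffShape (h : S n → ℝ) : Set (E n) := {x | ∀ u : S n, ⟪x, (u : E n)⟫ ≤ h u}

/-- `𝒮⁺`: the positive support functions, that is, the support functions (restricted to the
sphere) of the convex bodies which contain the origin in their interior. -/
def SPlus (n : ℕ) : Set (S n → ℝ) :=
  {h | ∃ K : Set (E n), IsCompact K ∧ Convex ℝ K ∧ (0 : E n) ∈ interior K ∧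
    ∀ u : S n, h u = supportFn K u}

/-- The parallel X-ray `X_K(x, u)`: the length of `K ∩ (x + ℝ u)`, for a unit vector `u`. -/
def xray (K : Set (E n)) (x : E n) (u : S n) : ℝ≥0∞ :=
  volume {t : ℝ | x + t • (u : E n) ∈ K}

/-- The chord integral
`I_q(K) = (n ωₙ)⁻¹ ∫_{𝕊ⁿ⁻¹} ∫_{u^⊥} X_K(x, u)^q dx du`, that is, the integral of `|K ∩ ℓ| ^ q` over
all lines `ℓ` with respect to the normalized invariant measure on lines. -/
def chordIntegral (q : ℝ) (K : Set (E n)) : ℝ≥0∞ :=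
  (ENNReal.ofReal (n * omega n))⁻¹ *
    ∫⁻ u : S n, (∫⁻ x : (ℝ ∙ (u : E n))ᗮ, xray K (x : E n) u ^ q) ∂(sph n)

/-- The radial function `ρ_{K,z}(u)` of `K` with respect to a point `z ∈ K`. It is `0` if the ray
from `z` in direction `u` meets `K` in `z` only. -/
def radial (K : Set (E n)) (z : E n) (u : S n) : ℝ :=
  sSup {t : ℝ | 0 ≤ t ∧ z + t • (u : E n) ∈ K}

/-- The dual quermassintegral `Ṽ_q(K, z) = n⁻¹ ∫_{ρ_{K,z} > 0} ρ_{K,z}(u)^q du`, `z ∈ K`. -/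
def dualQuermass (q : ℝ) (K : Set (E n)) (z : E n) : ℝ :=
  (1 / (n : ℝ)) * ∫ u in {u : S n | 0 < radial K z u}, radial K z u ^ q ∂(sph n)

/-- The extension of `h : 𝕊ⁿ⁻¹ → ℝ` to `ℝⁿ` which is homogeneous of degree one. -/
def homExt (h : S n → ℝ) (x : E n) : ℝ :=
  if hx : x = 0 then 0
  else ‖x‖ * h ⟨‖x‖⁻¹ • x, by
    rw [mem_sphere_zero_iff_norm, norm_smul, norm_inv, norm_norm,
      inv_mul_cancel₀ (norm_ne_zero_iff.mpr hx)]⟩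

/-- The Euclidean gradient `∇̄h` of the homogeneous extension of `h`, at a point of the sphere. For
a support function it exists at almost every point of the sphere. -/
def euclGrad (h : S n → ℝ) (v : S n) : E n := gradient (homExt h) (v : E n)

/-- `ν_K⁻¹(η)`: the boundary points of `K` that have an outer unit normal in `η`. -/
def invGauss (K : Set (E n)) (η : Set (S n)) : Set (E n) :=
  {x ∈ frontier K | ∃ v ∈ η, ⟪x, (v : E n)⟫ = supportFn K v}

/-- The surface area measure `S_{n-1}(K, η) = ℋⁿ⁻¹(ν_K⁻¹(η))`. -/
def surfaceArea (K : Set (E n)) (η : Set (S n)) : ℝ≥0∞ :=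
  Measure.euclideanHausdorffMeasure (n - 1) (invGauss K η)

/-- `h` is a generalized (Aleksandrov) solution of `det(∇²h + h I) = R` on `𝕊ⁿ⁻¹`: `R` is
nonnegative and integrable, and it is the density of the surface area measure of the convex body
with support function `h` with respect to spherical Lebesgue measure. -/
def IsGeneralizedSolution (h R : S n → ℝ) : Prop :=
  h ∈ SPlus n ∧ (∀ᵐ v ∂(sph n), 0 ≤ R v) ∧ Integrable R (sph n) ∧
    ∀ η : Set (S n), MeasurableSet η →
      surfaceArea (wulffShape h) η = ∫⁻ v in η, ENNReal.ofReal (R v) ∂(sph n)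

/-- The conditions on the approximating function `φ = φ_ε` on `(0, ∞)`. -/
structure IsApproxFn (n : ℕ) (p p' ε : ℝ) (φ : ℝ → ℝ) : Prop where
  pos : ∀ z, 0 < z → 0 < φ z
  strictConvex : StrictConvexOn ℝ (Ioi 0) φ
  anti : AntitoneOn φ (Ioi 0)
  diff : DifferentiableOn ℝ φ (Ioi 0)
  eq_of_one_le : ∀ z, 1 ≤ z → φ z = -(1 / p) * z ^ p
  lower : ∀ z, 0 < z → z < ε → (1 / ((n : ℝ) - 1)) * z ^ (-(n : ℝ) + 1) ≤ φ z
  upper : ∃ A : ℝ, ∀ z, 0 < z → z < 1 / 4 → φ z ≤ A * z ^ p'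

/-- `φ` on `(0, ∞)`, extended by `+∞`. -/
def extFn (φ : ℝ → ℝ) (z : ℝ) : ℝ≥0∞ :=
  open Classical in if 0 < z then ENNReal.ofReal (φ z) else ⊤

/-- `Φ(h - ξ · x) = ∫_{𝕊ⁿ⁻¹} f(x) φ(h(x) - ξ · x) dx`, with value in `[0, ∞]`. -/
def Phi (f : S n → ℝ) (φ : ℝ → ℝ) (h : S n → ℝ) (ξ : E n) : ℝ≥0∞ :=
  ∫⁻ v : S n, ENNReal.ofReal (f v) * extFn φ (h v - ⟪ξ, (v : E n)⟫) ∂(sph n)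

/-- `h` solves the maximization problem
`sup {inf_{ξ ∈ K_h} Φ(h - ξ · x) : h ∈ 𝒮⁺, I_q(K_h) = 1}`, where `K_h = [h]`. -/
def IsMaximizer (q : ℝ) (f : S n → ℝ) (φ : ℝ → ℝ) (h : S n → ℝ) : Prop :=
  h ∈ SPlus n ∧ chordIntegral q (wulffShape h) = 1 ∧
    (⨅ ξ ∈ wulffShape h, Phi f φ h ξ) =
      ⨆ g ∈ {g ∈ SPlus n | chordIntegral q (wulffShape g) = 1}, ⨅ ξ ∈ wulffShape g, Phi f φ g ξ

/-- `C_ε = -(2q / ((n + q - 1) ωₙ)) ∫_{𝕊ⁿ⁻¹} f φ'(h) h`. -/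
def normConst (q : ℝ) (f : S n → ℝ) (φ : ℝ → ℝ) (h : S n → ℝ) : ℝ :=
  -(2 * q / (((n : ℝ) + q - 1) * omega n)) * ∫ v : S n, f v * deriv φ (h v) * h v ∂(sph n)

end ChordMinkowski

end

noncomputable section

/-! ### Convex bodies: support function, gauge and outer normals -/

namespace ChordMinkowski

open Metric Filter Topology

variable {n : ℕ}

/-! Let D(z) be the integral over all directions u of |K ∩ (z + ℝu)|^(q-1). Chord length is constant
along a line, so n ω_n I_q(K) is the integral of D over K (`chordIntegral_eq`). The tangent-line
inequality b^q ≥ a^q + q a^(q-1) (b - a), applied on every line, shows that I_q lies above its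
linearization at K (`mul_setLIntegral_chordPotential_le`). Hence I_q itself need not be
differentiated along general perturbations: it suffices to vary the domain in the integral of the
fixed continuous weight D. That variation is an integral over radial directions
(`tendsto_setIntegral_perturb`); call it V(g). Testing the inequality on dilates of K gives q V(h) =
(n+q-1) n ω_n I_q(K).

If V(g) > 0, the Wulff shape of h + tg has larger chord integral than K, and shrinking it to the
correct value yields a competitor. Maximality gives near-minimal points ξ_t for it, with error t².
They tend to o, by Fatou's lemma and strict convexity (`tendsto_zero_of_Phi_le`). Convexity of φ and
minimality of o then give ∫ f φ'(h) g ≤ 0 (`integral_deriv_mul_nonpos`). A linear functional that is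
nonpositive wherever V is positive is a multiple of V, so with μ = -f φ'(h) > 0 one obtains ∫ μ g =
κ V(g) for every continuous g, and g = h determines κ = C_ε/(2n).

As an identity of measures, μ du is the image under the radial Gauss map of the measure with density
κ D times the surface density of ∂K (`withDensity_eq_map_gaussMap`). Both densities are positive, so
the Gauss map carries null sets to null sets in both directions; thus almost every normal v has the
single contact point ∇h(v), which is a regular boundary point. Dividing by κ D(∇h(v)) gives the
density of the surface area measure.

Two geometric facts link this to the statement. The Hausdorff measure of a piece of ∂K is the
integral of ρ^n / h(ν) over its directions (`hausdorff_image_boundaryPt`), proved by flattening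
pieces with nearly constant normal onto a hyperplane and comparing cone volumes. At a boundary point
with a unique normal, the lines are split into opposite rays, only one of which enters K, so D = 2n
Ṽ_{q-1} (`chordDensity_eq_dualQuermass`). -/

/-- A convex body with the origin in its interior. -/
structure IsBody (K : Set (E n)) : Prop where
  isCompact : IsCompact K
  convex : Convex ℝ K
  zero_mem : (0 : E n) ∈ interior K

lemma norm_coe_S (u : S n) : ‖(u : E n)‖ = 1 := by
  simp

lemma nonempty_S (hn : 2 ≤ n) : Nonempty (S n) := by
  have : Nontrivial (E n) := by
    have : Nonempty (Fin n) := ⟨⟨0, by omega⟩⟩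
    infer_instance
  exact (NormedSpace.sphere_nonempty.2 zero_le_one).to_subtype

/-- The direction of a nonzero vector, as a point of the unit sphere. -/
def direction (x : E n) (hx : x ≠ 0) : S n := ⟨‖x‖⁻¹ • x, by
  rw [mem_sphere_zero_iff_norm, norm_smul, norm_inv, norm_norm,
      inv_mul_cancel₀ (norm_ne_zero_iff.mpr hx)]⟩

namespace IsBody

variable {K : Set (E n)}

lemma exists_closedBall (hK : IsBody K) : ∃ r > 0, closedBall (0 : E n) r ⊆ K :=
  nhds_basis_closedBall.mem_iff.1 (mem_interior_iff_mem_nhds.1 hK.zero_mem)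

lemma exists_subset_closedBall (hK : IsBody K) : ∃ R > 0, K ⊆ closedBall (0 : E n) R := by
  obtain ⟨R, hR⟩ := hK.isCompact.isBounded.subset_closedBall 0
  exact ⟨max R 1, by positivity, hR.trans (closedBall_subset_closedBall (le_max_left _ _))⟩

lemma zero_mem' (hK : IsBody K) : (0 : E n) ∈ K := interior_subset hK.zero_mem

lemma nonempty (hK : IsBody K) : K.Nonempty := ⟨0, hK.zero_mem'⟩

lemma mem_nhds (hK : IsBody K) : K ∈ 𝓝 (0 : E n) := mem_interior_iff_mem_nhds.1 hK.zero_mem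

lemma bddAbove (hK : IsBody K) (v : E n) : BddAbove ((fun x => ⟪x, v⟫) '' K) :=
  (hK.isCompact.image (by fun_prop)).bddAbove

lemma inner_le_supportFn (hK : IsBody K) {x : E n} (hx : x ∈ K) (v : E n) :
    ⟪x, v⟫ ≤ supportFn K v :=
  le_csSup (hK.bddAbove v) ⟨x, hx, rfl⟩

lemma supportFn_le (hK : IsBody K) {v : E n} {c : ℝ} (h : ∀ x ∈ K, ⟪x, v⟫ ≤ c) :
    supportFn K v ≤ c :=
  csSup_le (hK.nonempty.image _) (by rintro _ ⟨x, hx, rfl⟩; exact h x hx)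

lemma exists_eq_supportFn (hK : IsBody K) (v : E n) : ∃ x ∈ K, ⟪x, v⟫ = supportFn K v := by
  obtain ⟨x, hx, h⟩ := (hK.isCompact.image (f := fun x => ⟪x, v⟫) (by fun_prop)).sSup_mem
    (hK.nonempty.image _)
  exact ⟨x, hx, h⟩

lemma supportFn_smul (hK : IsBody K) {c : ℝ} (hc : 0 ≤ c) (v : E n) :
    supportFn K (c • v) = c * supportFn K v := by
  refine le_antisymm (hK.supportFn_le fun x hx => ?_) ?_
  · rw [inner_smul_right]
    exact mul_le_mul_of_nonneg_left (hK.inner_le_supportFn hx v) hc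
  · obtain ⟨x, hx, h⟩ := hK.exists_eq_supportFn v
    rw [← h, ← inner_smul_right]
    exact hK.inner_le_supportFn hx _

lemma mul_norm_le_supportFn (hK : IsBody K) {r : ℝ} (hr : 0 ≤ r) (hrK : closedBall (0 : E n) r ⊆ K)
    (v : E n) : r * ‖v‖ ≤ supportFn K v := by
  rcases eq_or_ne v 0 with rfl | hv
  · simpa using hK.inner_le_supportFn hK.zero_mem' 0
  have h := hK.inner_le_supportFn (x := r • ‖v‖⁻¹ • v) (hrK ?_) v
  · rw [inner_smul_left, inner_smul_left, real_inner_self_eq_norm_sq] at h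
    have : ‖v‖ ≠ 0 := norm_ne_zero_iff.2 hv
    simp only [conj_trivial] at h
    convert h using 1
    field_simp
  · simp [norm_smul, abs_of_nonneg hr, norm_ne_zero_iff.2 hv]

lemma supportFn_pos (hK : IsBody K) (u : S n) : 0 < supportFn K u := by
  obtain ⟨r, hr, hrK⟩ := hK.exists_closedBall
  have := hK.mul_norm_le_supportFn hr.le hrK u
  rw [norm_coe_S, mul_one] at this
  linarith

lemma supportFn_le_mul_norm (hK : IsBody K) {R : ℝ} (hRK : K ⊆ closedBall (0 : E n) R) (v : E n) :
    supportFn K v ≤ R * ‖v‖ := by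
  refine hK.supportFn_le fun x hx => (real_inner_le_norm _ _).trans ?_
  have := hRK hx
  rw [mem_closedBall_zero_iff] at this
  gcongr

lemma abs_supportFn_sub_le (hK : IsBody K) {R : ℝ} (hRK : K ⊆ closedBall (0 : E n) R)
    (v w : E n) : |supportFn K v - supportFn K w| ≤ R * ‖v - w‖ := by
  have key : ∀ v w : E n, supportFn K v - supportFn K w ≤ R * ‖v - w‖ := fun v w => by
    obtain ⟨x, hx, h⟩ := hK.exists_eq_supportFn v
    have h1 := hK.inner_le_supportFn hx w
    have h2 : ⟪x, v - w⟫ ≤ ‖x‖ * ‖v - w‖ := real_inner_le_norm _ _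
    rw [inner_sub_right] at h2
    have h3 := hRK hx
    rw [mem_closedBall_zero_iff] at h3
    have h4 : ‖x‖ * ‖v - w‖ ≤ R * ‖v - w‖ := by gcongr
    linarith
  rw [abs_le]
  constructor
  · have := key w v
    rw [norm_sub_rev] at this
    linarith
  · exact key v w

lemma exists_lipschitz_supportFn (hK : IsBody K) : ∃ C, LipschitzWith C (supportFn K) := by
  obtain ⟨R, hR, hRK⟩ := hK.exists_subset_closedBall
  refine ⟨⟨R, hR.le⟩, LipschitzWith.of_dist_le_mul fun v w => ?_⟩
  rw [Real.dist_eq, dist_eq_norm]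
  exact hK.abs_supportFn_sub_le hRK v w

lemma continuous_supportFn (hK : IsBody K) : Continuous (supportFn K) :=
  hK.exists_lipschitz_supportFn.choose_spec.continuous

lemma homExt_supportFn (hK : IsBody K) : homExt (fun u : S n => supportFn K u) = supportFn K := by
  ext x
  unfold homExt
  split_ifs with hx
  · subst hx
    have := hK.supportFn_smul le_rfl (0 : E n)
    simpa using this.symm
  · simp only
    rw [hK.supportFn_smul (by positivity), mul_inv_cancel_left₀ (norm_ne_zero_iff.2 hx)]

lemma exists_lt_of_notMem (hK : IsBody K) {x : E n} (hx : x ∉ K) :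
    ∃ v : S n, supportFn K v < ⟪x, (v : E n)⟫ := by
  obtain ⟨f, s, h1, h2⟩ := geometric_hahn_banach_closed_point hK.convex hK.isCompact.isClosed hx
  set a := (InnerProductSpace.toDual ℝ (E n)).symm f with ha
  have hf : ∀ y, f y = ⟪y, a⟫ := fun y => by
    rw [real_inner_comm, ha, InnerProductSpace.toDual_symm_apply]
  have hs : 0 < s := by simpa using h1 0 hK.zero_mem'
  have ha0 : a ≠ 0 := by
    intro h0
    have := h2
    rw [hf, h0, inner_zero_right] at this
    linarith
  refine ⟨direction a ha0, ?_⟩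
  have hpos : 0 < ‖a‖⁻¹ := inv_pos.2 (norm_pos_iff.2 ha0)
  simp only [direction]
  rw [hK.supportFn_smul hpos.le, inner_smul_right]
  have : supportFn K a ≤ s := hK.supportFn_le fun y hy => by
    rw [← hf]; exact (h1 y hy).le
  have h3 := h2
  rw [hf] at h3
  have : supportFn K a < ⟪x, a⟫ := by linarith
  gcongr

lemma wulffShape_supportFn (hK : IsBody K) : wulffShape (fun u : S n => supportFn K u) = K := by
  ext x
  refine ⟨fun hx => ?_, fun hx u => hK.inner_le_supportFn hx u⟩
  by_contra h
  obtain ⟨v, hv⟩ := hK.exists_lt_of_notMem h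
  exact absurd (hx v) (not_le.2 hv)

lemma mem_iff_forall_inner_le (hK : IsBody K) {x : E n} :
    x ∈ K ↔ ∀ u : S n, ⟪x, (u : E n)⟫ ≤ supportFn K u := by
  conv_lhs => rw [← hK.wulffShape_supportFn]
  rfl

lemma supportFn_mem_SPlus (hK : IsBody K) : (fun u : S n => supportFn K u) ∈ SPlus n :=
  ⟨K, hK.isCompact, hK.convex, hK.zero_mem, fun _ => rfl⟩

lemma mem_iff_gauge_le_one (hK : IsBody K) {x : E n} : x ∈ K ↔ gauge K x ≤ 1 := by
  rw [gauge_le_one_iff_mem_closure hK.convex hK.mem_nhds, hK.isCompact.isClosed.closure_eq]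

lemma absorbent (hK : IsBody K) : Absorbent ℝ K := absorbent_nhds_zero hK.mem_nhds

lemma gauge_pos (hK : IsBody K) {x : E n} (hx : x ≠ 0) : 0 < gauge K x := by
  rw [_root_.gauge_pos hK.absorbent (NormedSpace.isVonNBounded_of_isBounded ℝ hK.isCompact.isBounded)]
  exact hx

lemma gauge_pos_S (hK : IsBody K) (u : S n) : 0 < gauge K (u : E n) :=
  hK.gauge_pos (by intro h; have := norm_coe_S u; simp [h] at this)

lemma gauge_smul_nonneg {c : ℝ} (hc : 0 ≤ c) (x : E n) : gauge K (c • x) = c * gauge K x := by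
  rw [gauge_smul_of_nonneg hc, smul_eq_mul]

lemma continuous_gauge (hK : IsBody K) : Continuous (gauge K) :=
  _root_.continuous_gauge hK.convex hK.mem_nhds

/-- Polarity of gauge and support function. Equality at x with normal v says that the linear
function with vector v / h(v) touches the gauge from below at x, which is how normals become
gradients of the gauge. -/
lemma inner_le_gauge_mul (hK : IsBody K) (x v : E n) : ⟪x, v⟫ ≤ gauge K x * supportFn K v := by
  rcases eq_or_ne x 0 with rfl | hx
  · simp
  have hg := hK.gauge_pos hx
  have hm : (gauge K x)⁻¹ • x ∈ K := by
    rw [hK.mem_iff_gauge_le_one, gauge_smul_nonneg (inv_nonneg.2 hg.le), inv_mul_cancel₀ hg.ne']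
  have := hK.inner_le_supportFn hm v
  rw [inner_smul_left, conj_trivial, inv_mul_le_iff₀ hg] at this
  exact this

/-- The inverse of the gauge is the radial function with respect to the origin. -/
lemma smul_mem_iff (hK : IsBody K) {r : ℝ} (hr : 0 ≤ r) (u : S n) :
    r • (u : E n) ∈ K ↔ r ≤ (gauge K (u : E n))⁻¹ := by
  rw [hK.mem_iff_gauge_le_one, gauge_smul_nonneg hr, ← one_div, le_div_iff₀ (hK.gauge_pos_S u)]

lemma exists_normal (hK : IsBody K) {z : E n} (hz : z ∈ frontier K) :
    ∃ v : S n, ⟪z, (v : E n)⟫ = supportFn K v := by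
  have hzi : z ∉ interior K := hz.2
  obtain ⟨f, hf⟩ := geometric_hahn_banach_open_point hK.convex.interior isOpen_interior hzi
  set a := (InnerProductSpace.toDual ℝ (E n)).symm f with ha
  have hfa : ∀ y, f y = ⟪y, a⟫ := fun y => by
    rw [real_inner_comm, ha, InnerProductSpace.toDual_symm_apply]
  have ha0 : a ≠ 0 := by
    intro h0
    have := hf 0 hK.zero_mem
    simp [hfa, h0] at this
  have hle : ∀ y ∈ K, f y ≤ f z := by
    have : closure (interior K) ⊆ {y | f y ≤ f z} :=
      closure_minimal (fun y hy => (hf y hy).le) (isClosed_le f.continuous continuous_const)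
    rw [hK.convex.closure_interior_eq_closure_of_nonempty_interior ⟨0, hK.zero_mem⟩] at this
    exact fun y hy => this (subset_closure hy)
  have hzK : z ∈ K := hK.isCompact.isClosed.frontier_subset hz
  have hpos : 0 < ‖a‖⁻¹ := inv_pos.2 (norm_pos_iff.2 ha0)
  refine ⟨direction a ha0, le_antisymm (hK.inner_le_supportFn hzK _) ?_⟩
  refine hK.supportFn_le fun y hy => ?_
  simp only [direction, inner_smul_right]
  have := hle y hy
  rw [hfa, hfa] at this
  gcongr

/-- An interior point has gauge less than 1, so by polarity it lies strictly inside every supporting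
half space. -/
lemma mem_frontier_of_inner_eq (hK : IsBody K) {z : E n} (hz : z ∈ K) {v : S n}
    (h : ⟪z, (v : E n)⟫ = supportFn K v) : z ∈ frontier K := by
  rw [frontier, hK.isCompact.isClosed.closure_eq]
  refine ⟨hz, fun hi => ?_⟩
  rw [← gauge_lt_one_iff_mem_interior hK.convex hK.mem_nhds] at hi
  have h1 := hK.inner_le_gauge_mul z v
  have h2 := hK.supportFn_pos v
  nlinarith

end IsBody

lemma isBody_wulffShape {g : S n → ℝ} {c C : ℝ} (hc : 0 < c) (hg : ∀ u, c ≤ g u)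
    (hC : ∀ u, g u ≤ C) (hC0 : 0 ≤ C) : IsBody (wulffShape g) := by
  refine ⟨isCompact_of_isClosed_isBounded ?_ ?_, ?_, ?_⟩
  · have : wulffShape g = ⋂ u : S n, {x | ⟪x, (u : E n)⟫ ≤ g u} := by
      ext; simp [wulffShape]
    rw [this]
    exact isClosed_iInter fun u => isClosed_le (by fun_prop) continuous_const
  · refine isBounded_closedBall (x := (0 : E n)) (r := C) |>.subset fun x hx => ?_
    rw [mem_closedBall_zero_iff]
    rcases eq_or_ne x 0 with rfl | h0
    · simpa using hC0
    have h1 := (hx (direction x h0)).trans (hC _)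
    simp only [direction, inner_smul_right, real_inner_self_eq_norm_sq] at h1
    have : ‖x‖ ≠ 0 := norm_ne_zero_iff.2 h0
    have h2 : ‖x‖⁻¹ * ‖x‖ ^ 2 = ‖x‖ := by field_simp
    linarith
  · intro x hx y hy a b ha hb hab u
    rw [inner_add_left, inner_smul_left, inner_smul_left]
    simp only [conj_trivial]
    calc a * ⟪x, (u : E n)⟫ + b * ⟪y, (u : E n)⟫ ≤ a * g u + b * g u := by
          gcongr
          · exact hx u
          · exact hy u
      _ = g u := by rw [← add_mul, hab, one_mul]
  · rw [mem_interior_iff_mem_nhds]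
    refine mem_of_superset (closedBall_mem_nhds (0 : E n) hc) fun x hx u => ?_
    rw [mem_closedBall_zero_iff] at hx
    have := real_inner_le_norm x u
    rw [norm_coe_S, mul_one] at this
    linarith [hg u]

end ChordMinkowski

/-! ### Polar coordinates, X-rays and the chord integral -/

namespace ChordMinkowski

open Metric Filter Topology
open scoped Pointwise

variable {n : ℕ}

instance : IsFiniteMeasure (sph n) := by unfold sph; infer_instance

lemma finrank_E : Module.finrank ℝ (E n) = n := by simp

lemma nontrivial_E (hn : 1 ≤ n) : Nontrivial (E n) := by
  have : Nonempty (Fin n) := ⟨⟨0, by omega⟩⟩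
  infer_instance

/-- Integration in polar coordinates. -/
lemma lintegral_polar (hn : 1 ≤ n) {G : E n → ℝ≥0∞} (hG : Measurable G) :
    ∫⁻ z, G z = ∫⁻ u : S n, (∫⁻ r in Ioi (0 : ℝ), ENNReal.ofReal (r ^ (n - 1)) * G (r • (u : E n)))
      ∂(sph n) := by
  have := nontrivial_E hn
  have hmp := (volume : Measure (E n)).measurePreserving_homeomorphUnitSphereProd
  rw [finrank_E] at hmp
  have h1 : ∫⁻ z, G z = ∫⁻ x : ({0}ᶜ : Set (E n)), G x ∂((volume : Measure (E n)).comap (↑)) := by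
    rw [lintegral_subtype_comap (measurableSet_singleton _).compl G, restrict_compl_singleton]
  have h2 : ∫⁻ x : ({0}ᶜ : Set (E n)), G x ∂((volume : Measure (E n)).comap (↑)) =
      ∫⁻ y : S n × Ioi (0 : ℝ), G (y.2.1 • (y.1 : E n))
        ∂((volume : Measure (E n)).toSphere.prod (Measure.volumeIoiPow (n - 1))) := by
    rw [← hmp.lintegral_comp_emb (Homeomorph.measurableEmbedding _)]
    refine lintegral_congr fun x => ?_
    congr 1
    have : ((homeomorphUnitSphereProd (E n)).symm ((homeomorphUnitSphereProd (E n)) x) : E n) = x := by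
      rw [Homeomorph.symm_apply_apply]
    rw [← this]
    rfl
  have hmeas : Measurable fun y : S n × Ioi (0 : ℝ) => G (y.2.1 • (y.1 : E n)) :=
    hG.comp (by fun_prop)
  rw [h1, h2, lintegral_prod _ hmeas.aemeasurable]
  refine lintegral_congr fun u => ?_
  have hu : Measurable fun r : Ioi (0 : ℝ) => G (r.1 • (u : E n)) := hG.comp (by fun_prop)
  rw [Measure.volumeIoiPow, lintegral_withDensity_eq_lintegral_mul _ (by fun_prop) hu]
  simp only [Pi.mul_apply]
  exact lintegral_subtype_comap measurableSet_Ioi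
    (fun r : ℝ => ENNReal.ofReal (r ^ (n - 1)) * G (r • (u : E n)))

lemma measurePreserving_neg_sph : MeasurePreserving (fun u : S n => -u) (sph n) (sph n) := by
  refine ⟨by fun_prop, ?_⟩
  ext s hs
  have hm : Measurable (fun u : S n => -u) := by fun_prop
  rw [Measure.map_apply hm hs, sph, Measure.toSphere_apply' _ (hm hs), Measure.toSphere_apply' _ hs]
  congr 1
  have : (Ioo (0 : ℝ) 1 • (Subtype.val '' ((fun u : S n => -u) ⁻¹' s)) : Set (E n)) =
      Neg.neg ⁻¹' (Ioo (0 : ℝ) 1 • (Subtype.val '' s) : Set (E n)) := by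
    ext x
    simp only [Set.mem_smul, mem_image, mem_preimage]
    constructor
    · rintro ⟨a, ha, _, ⟨u, hu, rfl⟩, rfl⟩
      exact ⟨a, ha, _, ⟨-u, hu, rfl⟩, by simp⟩
    · rintro ⟨a, ha, _, ⟨u, hu, rfl⟩, hx⟩
      refine ⟨a, ha, _, ⟨-u, by simpa using hu, rfl⟩, ?_⟩
      rw [← neg_neg x, ← hx]
      simp
  rw [this]
  exact Measure.measure_preimage_neg _ _

/-- Integration over the lines with a given direction. -/
lemma lintegral_lines (u : S n) {G : E n → ℝ≥0∞} (hG : Measurable G) :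
    ∫⁻ z, G z = ∫⁻ x : (ℝ ∙ (u : E n))ᗮ, ∫⁻ t : ℝ, G (x + t • (u : E n)) := by
  have hu0 : (u : E n) ≠ 0 := by intro h; have := norm_coe_S u; simp [h] at this
  set s : Submodule ℝ (E n) := ℝ ∙ (u : E n)
  have hmp := s.measurePreserving_measurableEquivProd (0 : E n)
  rw [InnerProductSpace.euclideanHausdorffMeasure_eq_volume] at hmp
  let f : ℝ ≃L[ℝ] s := ContinuousLinearEquiv.toSpanNonzeroSingleton ℝ (u : E n) hu0
  have hf : MeasurableEmbedding f := f.toHomeomorph.measurableEmbedding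
  have hvol : (volume : Measure s) = (volume : Measure ℝ).map f := by
    let v' : s := ⟨u, Submodule.mem_span_singleton_self _⟩
    have h1 : (volume : Measure s) = ‖v'‖ₑ • (volume : Measure ℝ).map f :=
      volume_eq_of_finrank_eq_one (finrank_span_singleton hu0) (v := v')
        (by simpa [v', Subtype.ext_iff] using hu0)
    have h2 : ‖v'‖ₑ = 1 := by
      have : ‖v'‖ = 1 := norm_coe_S u
      rw [← ofReal_norm, this, ENNReal.ofReal_one]
    rw [h1, h2, one_smul]
  rw [← hmp.symm.lintegral_comp_emb (MeasurableEquiv.measurableEmbedding _)]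
  have hGm : Measurable fun a : s × sᗮ => G ((s.measurableEquivProd (0 : E n)).symm a) :=
    hG.comp (MeasurableEquiv.measurable _)
  rw [Measure.volume_eq_prod, lintegral_prod_symm _ hGm.aemeasurable]
  refine lintegral_congr fun x => ?_
  rw [hvol, hf.lintegral_map]
  refine lintegral_congr fun t => ?_
  congr 1
  simp only [Submodule.measurableEquivProd_symm_apply, vadd_eq_add, add_zero]
  rw [add_comm]
  rfl

section Xray

variable {K L : Set (E n)} {q : ℝ}

lemma xray_add_smul (K : Set (E n)) (x : E n) (u : S n) (s : ℝ) :
    xray K (x + s • (u : E n)) u = xray K x u := by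
  have : {t : ℝ | x + s • (u : E n) + t • (u : E n) ∈ K} =
      (fun t => s + t) ⁻¹' {t : ℝ | x + t • (u : E n) ∈ K} := by
    ext t; simp [add_smul, add_assoc]
  rw [xray, this, measure_preimage_add]
  rfl

lemma xray_le (hRK : K ⊆ closedBall (0 : E n) R) (z : E n) (u : S n) :
    xray K z u ≤ ENNReal.ofReal (2 * R) := by
  rw [← Real.volume_closedBall (-⟪z, (u : E n)⟫) R]
  refine measure_mono fun t ht => ?_
  have h1 := hRK ht
  rw [mem_closedBall_zero_iff] at h1
  have h2 := abs_real_inner_le_norm (z + t • (u : E n)) u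
  rw [inner_add_left, inner_smul_left, real_inner_self_eq_norm_sq, norm_coe_S] at h2
  rw [mem_closedBall, Real.dist_eq]
  simp only [conj_trivial, one_pow, mul_one] at h2
  rw [show t - -⟪z, (u : E n)⟫ = ⟪z, (u : E n)⟫ + t by ring]
  linarith

lemma xray_ne_top (hK : Bornology.IsBounded K) (z : E n) (u : S n) : xray K z u ≠ ⊤ := by
  obtain ⟨R, hR⟩ := hK.subset_closedBall 0
  exact ((xray_le hR z u).trans_lt ENNReal.ofReal_lt_top).ne

lemma measurable_xray (hK : MeasurableSet K) : Measurable fun p : E n × S n => xray K p.1 p.2 := by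
  have : MeasurableSet {p : (E n × S n) × ℝ | p.1.1 + p.2 • (p.1.2 : E n) ∈ K} :=
    hK.preimage (f := fun p : (E n × S n) × ℝ => p.1.1 + p.2 • (p.1.2 : E n)) (by fun_prop)
  exact measurable_measure_prodMk_left this

/-- The integral over all lines through `z` of the `(q-1)`-st power of the chord length. -/
def chordPotential (q : ℝ) (K : Set (E n)) (z : E n) : ℝ≥0∞ :=
  ∫⁻ u : S n, xray K z u ^ (q - 1) ∂(sph n)

lemma measurable_chordPotential (hK : MeasurableSet K) : Measurable (chordPotential q K) :=
  Measurable.lintegral_prod_right' (f := fun p : E n × S n => xray K p.1 p.2 ^ (q - 1))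
    ((measurable_xray hK).pow_const _)

lemma chordPotential_le (hq : 1 ≤ q) (hRK : K ⊆ closedBall (0 : E n) R) (z : E n) :
    chordPotential q K z ≤ ENNReal.ofReal (2 * R) ^ (q - 1) * sph n univ := by
  rw [← lintegral_const]
  exact lintegral_mono fun u => ENNReal.rpow_le_rpow (xray_le hRK z u) (by linarith)

/-- On each line of direction u the chord length of K is a constant, so integrating it over the part
of the line in L multiplies it by the chord length of L. -/
lemma setLIntegral_xray (hK : MeasurableSet K) (hL : MeasurableSet L) (u : S n) :
    ∫⁻ z in L, xray K z u ^ (q - 1) =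
      ∫⁻ x : (ℝ ∙ (u : E n))ᗮ, xray K (x : E n) u ^ (q - 1) * xray L (x : E n) u := by
  have hm : Measurable fun z => xray K z u ^ (q - 1) :=
    ((measurable_xray hK).comp measurable_prodMk_right).pow_const _
  rw [← lintegral_indicator hL, lintegral_lines u (hm.indicator hL)]
  refine lintegral_congr fun x => ?_
  have hLm : MeasurableSet {t : ℝ | (x : E n) + t • (u : E n) ∈ L} :=
    hL.preimage (f := fun t : ℝ => (x : E n) + t • (u : E n)) (by fun_prop)
  have : ∀ t : ℝ, L.indicator (fun z => xray K z u ^ (q - 1)) (x + t • (u : E n)) =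
      {t : ℝ | (x : E n) + t • (u : E n) ∈ L}.indicator
        (fun _ => xray K (x : E n) u ^ (q - 1)) t := fun t => by
    simp only [indicator, xray_add_smul]
    rfl
  simp_rw [this]
  rw [lintegral_indicator hLm, setLIntegral_const]
  rfl

lemma setLIntegral_chordPotential (hK : MeasurableSet K) (hL : MeasurableSet L) :
    ∫⁻ z in L, chordPotential q K z =
      ∫⁻ u : S n, (∫⁻ x : (ℝ ∙ (u : E n))ᗮ, xray K (x : E n) u ^ (q - 1) * xray L (x : E n) u)
        ∂(sph n) := by
  simp_rw [← setLIntegral_xray hK hL, chordPotential]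
  exact lintegral_lintegral_swap ((measurable_xray hK).pow_const _).aemeasurable

lemma rpow_sub_one_mul_self (a : ℝ≥0∞) (hq : 1 ≤ q) : a ^ (q - 1) * a = a ^ q := by
  rcases eq_or_lt_of_le hq with rfl | hq
  · simp
  nth_rewrite 2 [← ENNReal.rpow_one a]
  rw [← ENNReal.rpow_add_of_nonneg _ _ (by linarith) zero_le_one, sub_add_cancel]

/-- With L = K the product of the powers q - 1 and 1 is the power q. The chord integral becomes a
weighted volume, whose domain and weight can be varied separately. -/
lemma chordIntegral_eq (hK : MeasurableSet K) (hq : 1 ≤ q) :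
    chordIntegral q K = (ENNReal.ofReal (n * omega n))⁻¹ * ∫⁻ z in K, chordPotential q K z := by
  rw [setLIntegral_chordPotential hK hK, chordIntegral]
  simp_rw [rpow_sub_one_mul_self _ hq]

/-- The convex function t ↦ t^q lies above its tangent at a; Bernoulli's inequality for b / a. The
case a = 0 is separate, and there q = 1 uses 0^0 = 1. -/
lemma mul_rpow_sub_one_mul_le {a b : ℝ} (ha : 0 ≤ a) (hb : 0 ≤ b) (hq : 1 ≤ q) :
    q * a ^ (q - 1) * b ≤ b ^ q + (q - 1) * a ^ q := by
  rcases eq_or_lt_of_le ha with rfl | ha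
  · rcases eq_or_lt_of_le hq with rfl | hq
    · simp
    · rw [Real.zero_rpow (by linarith), Real.zero_rpow (by linarith)]
      simp [Real.rpow_nonneg hb]
  have h := one_add_mul_self_le_rpow_one_add (s := b / a - 1) (by linarith [div_nonneg hb ha.le]) hq
  rw [add_sub_cancel, Real.div_rpow hb ha.le, le_div_iff₀ (Real.rpow_pos_of_pos ha _)] at h
  have h2 : a ^ q = a ^ (q - 1) * a := by
    rw [← Real.rpow_add_one ha.ne', sub_add_cancel]
  have h3 : q * (b / a) * a ^ q = q * a ^ (q - 1) * b := by
    rw [h2]; field_simp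
  nlinarith

lemma ennreal_mul_rpow_sub_one_mul_le {a b : ℝ≥0∞} (ha : a ≠ ⊤) (hb : b ≠ ⊤) (hq : 1 ≤ q) :
    ENNReal.ofReal q * (a ^ (q - 1) * b) ≤ b ^ q + ENNReal.ofReal (q - 1) * a ^ q := by
  have h := mul_rpow_sub_one_mul_le (q := q) (a := a.toReal) (b := b.toReal) (by positivity) (by positivity) hq
  have h_of := ENNReal.ofReal_le_ofReal h
  rw [ENNReal.ofReal_add (by positivity) (mul_nonneg (by linarith) (by positivity)),
    mul_assoc, ENNReal.ofReal_mul (by linarith), ENNReal.ofReal_mul (by positivity),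
    ENNReal.ofReal_mul (by linarith),
    ← ENNReal.ofReal_rpow_of_nonneg (by positivity) (by linarith),
    ← ENNReal.ofReal_rpow_of_nonneg (by positivity) (by linarith),
    ← ENNReal.ofReal_rpow_of_nonneg (by positivity) (by linarith),
    ENNReal.ofReal_toReal ha, ENNReal.ofReal_toReal hb] at h_of
  exact h_of

/-- The chord integral lies above its linearization at `K`. -/
lemma mul_setLIntegral_chordPotential_le (hK : MeasurableSet K) (hKb : Bornology.IsBounded K)
    (hL : MeasurableSet L) (hLb : Bornology.IsBounded L) (hq : 1 ≤ q) :
    ENNReal.ofReal q * ∫⁻ z in L, chordPotential q K z ≤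
      (∫⁻ z in L, chordPotential q L z) +
        ENNReal.ofReal (q - 1) * ∫⁻ z in K, chordPotential q K z := by
  have hm (K L : Set (E n)) (hK : MeasurableSet K) (hL : MeasurableSet L) :
      Measurable fun u : S n => ∫⁻ x : (ℝ ∙ (u : E n))ᗮ,
        xray K (x : E n) u ^ (q - 1) * xray L (x : E n) u := by
    simp_rw [← setLIntegral_xray hK hL]
    exact Measurable.lintegral_prod_left' (f := fun p : E n × S n => xray K p.1 p.2 ^ (q - 1))
      ((measurable_xray hK).pow_const _)
  have hx (K : Set (E n)) (hK : MeasurableSet K) (u : S n) :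
      Measurable fun x : (ℝ ∙ (u : E n))ᗮ => xray K (x : E n) u :=
    (measurable_xray hK).comp (measurable_subtype_coe.prodMk measurable_const)
  rw [setLIntegral_chordPotential hK hL, setLIntegral_chordPotential hL hL,
    setLIntegral_chordPotential hK hK, ← lintegral_const_mul _ (hm K L hK hL),
    ← lintegral_const_mul _ (hm K K hK hK), ← lintegral_add_left (hm L L hL hL)]
  refine lintegral_mono fun u => ?_
  simp only
  have hxm (K L : Set (E n)) (hK : MeasurableSet K) (hL : MeasurableSet L) :
      Measurable fun x : (ℝ ∙ (u : E n))ᗮ => xray K (x : E n) u ^ (q - 1) * xray L (x : E n) u :=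
    ((hx K hK u).pow_const _).mul (hx L hL u)
  rw [← lintegral_const_mul _ (hxm K L hK hL), ← lintegral_const_mul _ (hxm K K hK hK),
    ← lintegral_add_left (hxm L L hL hL)]
  refine lintegral_mono fun x => ?_
  simp only
  rw [rpow_sub_one_mul_self _ hq, rpow_sub_one_mul_self _ hq]
  exact ennreal_mul_rpow_sub_one_mul_le (xray_ne_top hKb _ _) (xray_ne_top hLb _ _) hq

lemma xray_smul {s : ℝ} (hs : 0 < s) (K : Set (E n)) (z : E n) (u : S n) :
    xray (s • K) (s • z) u = ENNReal.ofReal s * xray K z u := by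
  have : {t : ℝ | s • z + t • (u : E n) ∈ s • K} = s • {t : ℝ | z + t • (u : E n) ∈ K} := by
    ext t
    simp only [mem_ofPred_eq, Set.mem_smul_set_iff_inv_smul_mem₀ hs.ne', smul_add, smul_smul,
      inv_mul_cancel₀ hs.ne', one_smul, smul_eq_mul]
  rw [xray, this, Measure.addHaar_smul_of_nonneg _ hs.le]
  simp [xray]

/-- Volume contributes n to the degree of homogeneity and the chord lengths in the weight contribute
q - 1. -/
lemma setLIntegral_chordPotential_smul {s : ℝ} (hs : 0 < s) (hK : MeasurableSet K) (hq : 1 ≤ q) :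
    ∫⁻ z in s • K, chordPotential q (s • K) z =
      ENNReal.ofReal (s ^ ((n : ℝ) + q - 1)) * ∫⁻ z in K, chordPotential q K z := by
  have hsK : MeasurableSet (s • K) := hK.const_smul₀ s
  have h1 : ∀ z, chordPotential q (s • K) (s • z) = ENNReal.ofReal (s ^ (q - 1)) * chordPotential q K z := by
    intro z
    unfold chordPotential
    have hm : Measurable fun u : S n => xray K z u ^ (q - 1) :=
      ((measurable_xray hK).comp measurable_prodMk_left).pow_const _
    rw [← lintegral_const_mul _ hm]
    refine lintegral_congr fun u => ?_
    rw [xray_smul hs, ENNReal.mul_rpow_of_nonneg _ _ (by linarith),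
      ENNReal.ofReal_rpow_of_pos hs]
  have h2 : ∫⁻ z in s • K, chordPotential q (s • K) z =
      ENNReal.ofReal (s ^ n) * ∫⁻ z in K, chordPotential q (s • K) (s • z) := by
    have hmap := Measure.map_addHaar_smul (volume : Measure (E n)) hs.ne'
    have hme : MeasurableEmbedding (fun x : E n => s • x) := measurableEmbedding_const_smul₀ hs.ne'
    have h3 : ∫⁻ z in K, chordPotential q (s • K) (s • z) =
        ∫⁻ z in s • K, chordPotential q (s • K) z ∂(Measure.map (s • ·) volume) := by
      rw [hme.restrict_map, hme.lintegral_map]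
      congr 2
      rw [Set.preimage_smul₀ hs.ne', smul_smul, inv_mul_cancel₀ hs.ne', one_smul]
    rw [h3, hmap, Measure.restrict_smul, lintegral_smul_measure, smul_eq_mul, ← mul_assoc,
      finrank_E, ← ENNReal.ofReal_mul (by positivity), abs_of_pos (by positivity),
      mul_inv_cancel₀ (by positivity), ENNReal.ofReal_one, one_mul]
  rw [h2]
  simp_rw [h1]
  rw [lintegral_const_mul _ (measurable_chordPotential hK), ← mul_assoc,
    ← ENNReal.ofReal_mul (by positivity), ← Real.rpow_natCast, ← Real.rpow_add hs]
  congr 3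
  ring

/-- The boundary of a convex set is a null set. Polar coordinates centred at z give the claim on
almost every half line, and the antipodal map on the sphere covers the opposite half lines. -/
lemma ae_ae_notMem_frontier (hn : 1 ≤ n) (hK : Convex ℝ K) (z : E n) :
    ∀ᵐ u : S n ∂(sph n), ∀ᵐ t : ℝ, z + t • (u : E n) ∉ frontier K := by
  have hF : MeasurableSet (frontier K) := isClosed_frontier.measurableSet
  have hpos : ∀ᵐ u : S n ∂(sph n), ∀ᵐ t : ℝ, 0 < t → z + t • (u : E n) ∉ frontier K := by
    have h0 : ∫⁻ y, (frontier K).indicator (fun _ => (1 : ℝ≥0∞)) (z + y) = 0 := by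
      rw [lintegral_add_left_eq_self (fun y => (frontier K).indicator (fun _ => (1 : ℝ≥0∞)) y) z,
        lintegral_indicator hF, setLIntegral_const, hK.addHaar_frontier volume, mul_zero]
    have hm0 : Measurable fun y => (frontier K).indicator (fun _ => (1 : ℝ≥0∞)) (z + y) :=
      (measurable_const.indicator hF).comp (measurable_const_add z)
    rw [lintegral_polar hn hm0, lintegral_eq_zero_iff] at h0
    · filter_upwards [h0] with u hu
      rw [Pi.zero_apply, lintegral_eq_zero_iff] at hu
      · rw [EventuallyEq, ae_restrict_iff' measurableSet_Ioi] at hu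
        filter_upwards [hu] with t ht htp hmem
        have := ht htp
        simp only [Pi.zero_apply, mul_eq_zero, ENNReal.ofReal_eq_zero] at this
        rcases this with h | h
        · exact absurd h (not_le.2 (pow_pos htp _))
        · simp [hmem] at h
      · exact (by fun_prop : Measurable fun r : ℝ => ENNReal.ofReal (r ^ (n - 1))).mul
          (hm0.comp (by fun_prop))
    · refine Measurable.lintegral_prod_right' (f := fun p : S n × ℝ => ENNReal.ofReal (p.2 ^ (n - 1)) *
        (frontier K).indicator (fun _ => (1 : ℝ≥0∞)) (z + p.2 • (p.1 : E n))) ?_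
      exact (by fun_prop : Measurable fun p : S n × ℝ => ENNReal.ofReal (p.2 ^ (n - 1))).mul
          (hm0.comp (by fun_prop))
  have hneg := measurePreserving_neg_sph.quasiMeasurePreserving.ae hpos
  filter_upwards [hpos, hneg] with u h1 h2
  have h3 := (Measure.measurePreserving_neg (volume : Measure ℝ)).quasiMeasurePreserving.ae h2
  have h4 : ∀ᵐ t : ℝ, t ≠ 0 := by
    simp [ae_iff]
  filter_upwards [h1, h3, h4] with t h1 h3 h4
  rcases lt_or_gt_of_ne h4 with h | h
  · have := h3 (by linarith)
    simpa using this
  · exact h1 h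

/-- The length is the integral of an indicator that is locally constant in the base point wherever
the line avoids the boundary, so dominated convergence applies. -/
lemma tendsto_xray (hb : Bornology.IsBounded K) (hK : MeasurableSet K) {z : E n} {u : S n}
    (h : ∀ᵐ t : ℝ, z + t • (u : E n) ∉ frontier K) :
    Tendsto (fun y => xray K y u) (𝓝 z) (𝓝 (xray K z u)) := by
  obtain ⟨R, hR⟩ := hb.subset_closedBall 0
  have hset (y : E n) : MeasurableSet {t : ℝ | y + t • (u : E n) ∈ K} :=
    hK.preimage (f := fun t : ℝ => y + t • (u : E n)) (by fun_prop)
  have hx : ∀ y, xray K y u = ∫⁻ t : ℝ, {t : ℝ | y + t • (u : E n) ∈ K}.indicator 1 t := fun y => by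
    rw [lintegral_indicator_one (hset y), xray]
  simp_rw [hx]
  refine tendsto_lintegral_filter_of_dominated_convergence
    (fun t => (closedBall (0 : ℝ) (R + ‖z‖ + 1)).indicator 1 t)
    (Eventually.of_forall fun y => measurable_one.indicator (hset y)) ?_ ?_ ?_
  · filter_upwards [closedBall_mem_nhds z one_pos] with y hy
    refine Eventually.of_forall fun t => ?_
    refine indicator_le_indicator_of_subset (fun t ht => ?_) (by simp) t
    have h1 := hR ht
    rw [mem_closedBall_zero_iff] at h1 ⊢
    have h2 : ‖t • (u : E n)‖ ≤ ‖y + t • (u : E n)‖ + ‖y‖ := by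
      have := norm_sub_le (y + t • (u : E n)) y
      simpa using this
    rw [norm_smul, norm_coe_S, mul_one] at h2
    have h3 : ‖y‖ ≤ ‖z‖ + 1 := by
      rw [mem_closedBall, dist_eq_norm] at hy
      linarith [norm_le_norm_add_norm_sub z y, norm_sub_rev z y]
    linarith
  · rw [lintegral_indicator_one measurableSet_closedBall]
    exact measure_closedBall_lt_top.ne
  · filter_upwards [h] with t ht
    have hc : ContinuousAt (fun y : E n => y + t • (u : E n)) z := by fun_prop
    have : ∀ᶠ y in 𝓝 z, (y + t • (u : E n) ∈ K ↔ z + t • (u : E n) ∈ K) := by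
      by_cases hi : z + t • (u : E n) ∈ interior K
      · filter_upwards [hc.eventually (isOpen_interior.mem_nhds hi)] with y hy
        exact iff_of_true (interior_subset hy) (interior_subset hi)
      · have hcl : z + t • (u : E n) ∉ closure K := fun hcl => ht ⟨hcl, hi⟩
        filter_upwards [hc.eventually (isClosed_closure.isOpen_compl.mem_nhds hcl)] with y hy
        exact iff_of_false (fun h => hy (subset_closure h)) (fun h => hcl (subset_closure h))
    refine tendsto_const_nhds.congr' ?_
    filter_upwards [this] with y hy
    by_cases hz : z + t • (u : E n) ∈ K
    · simp [indicator, hz, hy.2 hz]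
    · simp [indicator, hz, mt hy.1 hz]

lemma continuous_chordPotential (hn : 1 ≤ n) (hK : Convex ℝ K) (hb : Bornology.IsBounded K)
    (hm : MeasurableSet K) (hq : 1 ≤ q) : Continuous (chordPotential q K) := by
  obtain ⟨R, hR⟩ := hb.subset_closedBall 0
  rw [continuous_iff_continuousAt]
  intro z
  refine tendsto_lintegral_filter_of_dominated_convergence
    (fun _ => ENNReal.ofReal (2 * R) ^ (q - 1))
    (Eventually.of_forall fun y => ((measurable_xray hm).comp measurable_prodMk_left).pow_const _)
    (Eventually.of_forall fun y => Eventually.of_forall fun u =>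
      ENNReal.rpow_le_rpow (xray_le hR y u) (by linarith)) ?_ ?_
  · rw [lintegral_const]
    exact ENNReal.mul_ne_top (ENNReal.rpow_ne_top_of_nonneg (by linarith) ENNReal.ofReal_ne_top)
      (measure_ne_top _ _)
  · filter_upwards [ae_ae_notMem_frontier hn hK z] with u hu
    exact (ENNReal.continuous_rpow_const.tendsto _).comp (tendsto_xray hb hm hu)

end Xray

end ChordMinkowski

/-! ### Radial function, gradients and the radial Gauss map -/

namespace ChordMinkowski

open Metric Filter Topology
open scoped Pointwise

variable {n : ℕ} {K L : Set (E n)}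

/-- The radial function of `K` with respect to the origin, as the inverse of the gauge. -/
def rho (K : Set (E n)) (u : S n) : ℝ := (gauge K (u : E n))⁻¹

lemma coe_S_ne_zero (u : S n) : (u : E n) ≠ 0 := by
  intro h; have := norm_coe_S u; simp [h] at this

namespace IsBody

lemma measurableSet (hK : IsBody K) : MeasurableSet K := hK.isCompact.isClosed.measurableSet

lemma isBounded (hK : IsBody K) : Bornology.IsBounded K := hK.isCompact.isBounded

lemma rho_pos (hK : IsBody K) (u : S n) : 0 < rho K u := inv_pos.2 (hK.gauge_pos_S u)

lemma smul_mem_iff_le_rho (hK : IsBody K) {r : ℝ} (hr : 0 ≤ r) (u : S n) :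
    r • (u : E n) ∈ K ↔ r ≤ rho K u := hK.smul_mem_iff hr u

lemma rho_smul_mem (hK : IsBody K) (u : S n) : rho K u • (u : E n) ∈ K :=
  (hK.smul_mem_iff_le_rho (hK.rho_pos u).le u).2 le_rfl

lemma rho_smul_mem_frontier (hK : IsBody K) (u : S n) : rho K u • (u : E n) ∈ frontier K := by
  rw [← gauge_eq_one_iff_mem_frontier hK.convex hK.mem_nhds, gauge_smul_nonneg (hK.rho_pos u).le,
    rho, inv_mul_cancel₀ (hK.gauge_pos_S u).ne']

lemma continuous_rho (hK : IsBody K) : Continuous (rho K) :=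
  (hK.continuous_gauge.comp continuous_subtype_val).inv₀ fun u => (hK.gauge_pos_S u).ne'

lemma rho_le (hK : IsBody K) {R : ℝ} (hRK : K ⊆ closedBall (0 : E n) R) (u : S n) :
    rho K u ≤ R := by
  have := hRK (hK.rho_smul_mem u)
  rwa [mem_closedBall_zero_iff, norm_smul, norm_coe_S, mul_one, Real.norm_eq_abs,
    abs_of_pos (hK.rho_pos u)] at this

end IsBody

lemma continuous_radial_integral {w : E n → ℝ} (hw : Continuous w) {s : S n → ℝ}
    (hs : Continuous s) :
    Continuous fun u : S n => ∫ r in (0 : ℝ)..s u, r ^ (n - 1) * w (r • (u : E n)) :=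
  intervalIntegral.continuous_parametric_intervalIntegral_of_continuous
    (f := fun (u : S n) (r : ℝ) => r ^ (n - 1) * w (r • (u : E n)))
    (by unfold Function.uncurry; fun_prop) hs

lemma setIntegral_polar (hn : 1 ≤ n) (hL : IsBody L) {w : E n → ℝ} (hw : Continuous w)
    (hw0 : ∀ z, 0 ≤ w z) :
    ∫ z in L, w z =
      ∫ u : S n, (∫ r in (0 : ℝ)..rho L u, r ^ (n - 1) * w (r • (u : E n))) ∂(sph n) := by
  have hnonneg : ∀ u : S n, 0 ≤ ∫ r in (0 : ℝ)..rho L u, r ^ (n - 1) * w (r • (u : E n)) :=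
    fun u => intervalIntegral.integral_nonneg (hL.rho_pos u).le fun r hr =>
      mul_nonneg (pow_nonneg hr.1 _) (hw0 _)
  rw [integral_eq_lintegral_of_nonneg_ae (Eventually.of_forall hw0) hw.aestronglyMeasurable,
    integral_eq_lintegral_of_nonneg_ae (Eventually.of_forall hnonneg)
      (continuous_radial_integral hw hL.continuous_rho).aestronglyMeasurable]
  congr 1
  have hwm : Measurable fun z => ENNReal.ofReal (w z) := hw.measurable.ennreal_ofReal
  rw [← lintegral_indicator hL.measurableSet, lintegral_polar hn (hwm.indicator hL.measurableSet)]
  refine lintegral_congr fun u => ?_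
  have hc : Continuous fun r : ℝ => r ^ (n - 1) * w (r • (u : E n)) := by fun_prop
  rw [intervalIntegral.integral_of_le (hL.rho_pos u).le,
    ofReal_integral_eq_lintegral_ofReal (hc.integrableOn_Ioc)
      ((ae_restrict_iff' measurableSet_Ioc).2 (Eventually.of_forall fun r hr =>
        mul_nonneg (pow_nonneg hr.1.le _) (hw0 _)))]
  rw [← lintegral_indicator measurableSet_Ioi, ← lintegral_indicator measurableSet_Ioc]
  refine lintegral_congr fun r => ?_
  by_cases hr : 0 < r
  · by_cases hr2 : r ≤ rho L u
    · have hm := (hL.smul_mem_iff_le_rho hr.le u).2 hr2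
      rw [indicator_of_mem (show r ∈ Ioi (0:ℝ) from hr), indicator_of_mem (show r ∈ Ioc _ _ from ⟨hr, hr2⟩),
        indicator_of_mem hm, ENNReal.ofReal_mul (pow_nonneg hr.le _)]
    · have hm := mt (hL.smul_mem_iff_le_rho hr.le u).1 hr2
      rw [indicator_of_mem (show r ∈ Ioi (0:ℝ) from hr), indicator_of_notMem hm, mul_zero,
        indicator_of_notMem (fun h => hr2 h.2)]
  · rw [indicator_of_notMem (show r ∉ Ioi (0:ℝ) from hr), indicator_of_notMem (fun h => hr h.1)]

/-- A linear function that touches F from below makes the difference minimal at the contact point.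
Used for the gauge and for the support function in place of subdifferential calculus. -/
lemma gradient_eq_of_inner_le {F : E n → ℝ} {x a : E n} (hF : DifferentiableAt ℝ F x)
    (hle : ∀ y, ⟪y, a⟫ ≤ F y) (heq : ⟪x, a⟫ = F x) : gradient F x = a := by
  have hmin : IsLocalMin (fun y => F y - ⟪y, a⟫) x :=
    Eventually.of_forall fun y => by simp only [heq, sub_self]; linarith [hle y]
  have hG : HasGradientAt (fun y => ⟪y, a⟫) a x := by
    rw [hasGradientAt_iff_hasFDerivAt]
    have : (fun y => ⟪y, a⟫) = fun y : E n => InnerProductSpace.toDual ℝ (E n) a y := by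
      ext y
      rw [InnerProductSpace.toDual_apply_apply, real_inner_comm]
    rw [this]
    exact (InnerProductSpace.toDual ℝ (E n) a).hasFDerivAt
  have h1 := hmin.hasFDerivAt_eq_zero (hF.hasGradientAt.hasFDerivAt.sub hG.hasFDerivAt)
  rw [sub_eq_zero] at h1
  exact (InnerProductSpace.toDual ℝ (E n)).injective h1

/-- A Lipschitz function which is homogeneous of degree one is differentiable almost everywhere on
the sphere. -/
lemma ae_differentiableAt_sph (hn : 1 ≤ n) {F : E n → ℝ} {C : NNReal} (hF : LipschitzWith C F)
    (hom : ∀ c : ℝ, 0 < c → ∀ x, F (c • x) = c * F x) :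
    ∀ᵐ u : S n ∂(sph n), DifferentiableAt ℝ F u := by
  set D := {x : E n | DifferentiableAt ℝ F x}
  have hD : MeasurableSet D := measurableSet_of_differentiableAt ℝ F
  have hae : volume Dᶜ = 0 := hF.ae_differentiableAt
  have hm : Measurable (Dᶜ.indicator fun _ : E n => (1 : ℝ≥0∞)) := measurable_const.indicator hD.compl
  have h0 : ∫⁻ y, Dᶜ.indicator (fun _ => (1 : ℝ≥0∞)) y = 0 := by
    rw [lintegral_indicator hD.compl, setLIntegral_const, hae, mul_zero]
  rw [lintegral_polar hn hm, lintegral_eq_zero_iff] at h0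
  · filter_upwards [h0] with u hu
    rw [Pi.zero_apply, lintegral_eq_zero_iff (by
      exact (by fun_prop : Measurable fun r : ℝ => ENNReal.ofReal (r ^ (n - 1))).mul
        (hm.comp (by fun_prop)))] at hu
    have : NeBot (ae (volume.restrict (Ioi (0 : ℝ)))) := by
      rw [ae_neBot, Ne, Measure.restrict_eq_zero]
      simp
    obtain ⟨r, hr, hr0⟩ := (hu.and (ae_restrict_mem measurableSet_Ioi)).exists
    have hr0 : 0 < r := hr0
    simp only [Pi.zero_apply, mul_eq_zero, ENNReal.ofReal_eq_zero, not_le.2 (pow_pos hr0 (n - 1)),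
      false_or, indicator_apply_eq_zero] at hr
    have hd : DifferentiableAt ℝ F (r • (u : E n)) := by
      by_contra hc
      exact one_ne_zero (hr hc)
    -- Homogeneity carries differentiability from a point r u of the ray, found by Rademacher's
    -- theorem and polar coordinates, to u itself.
    have : F = fun x => r⁻¹ * F (r • x) := by
      ext x
      rw [hom r hr0, inv_mul_cancel_left₀ hr0.ne']
    rw [this]
    exact (DifferentiableAt.comp (u : E n) (g := F) (f := fun x => r • x) hd
      (by fun_prop)).const_mul _
  · exact Measurable.lintegral_prod_right' (f := fun p : S n × ℝ => ENNReal.ofReal (p.2 ^ (n - 1)) *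
        Dᶜ.indicator (fun _ => (1 : ℝ≥0∞)) (p.2 • (p.1 : E n)))
      ((by fun_prop : Measurable fun p : S n × ℝ => ENNReal.ofReal (p.2 ^ (n - 1))).mul
          (hm.comp (by fun_prop)))

open Classical in
/-- The radial Gauss map: the outer unit normal of `K` at `rho K u • u`, if it is unique. -/
def gaussMap (K : Set (E n)) (u : S n) : S n :=
  -- The default value only makes the map total: where the gauge is differentiable its gradient is v
  -- / h(v) for a normal v, hence nonzero.
  if h : gradient (gauge K) (u : E n) = 0 then u else direction _ h

lemma measurable_gradient (F : E n → ℝ) : Measurable (gradient F) :=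
  (InnerProductSpace.toDual ℝ (E n)).symm.continuous.measurable.comp (measurable_fderiv ℝ F)

lemma measurable_gaussMap (K : Set (E n)) : Measurable (gaussMap K) := by
  rw [← (MeasurableEmbedding.subtype_coe (isClosed_sphere (x := (0 : E n)) (ε := 1)).measurableSet).measurable_comp_iff]
  have hg : Measurable fun u : S n => gradient (gauge K) (u : E n) :=
    (measurable_gradient _).comp measurable_subtype_coe
  have : (Subtype.val ∘ gaussMap K) = fun u : S n => open Classical in
      if gradient (gauge K) (u : E n) = 0 then (u : E n) else
        ‖gradient (gauge K) (u : E n)‖⁻¹ • gradient (gauge K) (u : E n) := by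
    ext1 u
    simp only [Function.comp_apply, gaussMap]
    split_ifs <;> rfl
  rw [this]
  exact Measurable.ite (hg (measurableSet_singleton _)) measurable_subtype_coe
    (hg.norm.inv.smul hg)

/-- `v` is the only outer unit normal of `K` at `z`. -/
def IsUniqueNormal (K : Set (E n)) (z : E n) (v : S n) : Prop :=
  ⟪z, (v : E n)⟫ = supportFn K v ∧ ∀ v' : S n, ⟪z, (v' : E n)⟫ = supportFn K v' → v' = v

namespace IsBody

/-- Any normal v at the boundary point on the ray gives a linear function with vector v / h(v) that
touches the gauge from below at u. Differentiability leaves only one such vector, and normalizing it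
recovers v. -/
lemma isUniqueNormal_gaussMap (hK : IsBody K) {u : S n}
    (hd : DifferentiableAt ℝ (gauge K) (u : E n)) :
    IsUniqueNormal K (rho K u • (u : E n)) (gaussMap K u) := by
  have key : ∀ v : S n, ⟪rho K u • (u : E n), (v : E n)⟫ = supportFn K v → gaussMap K u = v := by
    intro v hv
    have hpos := hK.supportFn_pos v
    have hgr : gradient (gauge K) (u : E n) = (supportFn K v)⁻¹ • (v : E n) := by
      refine gradient_eq_of_inner_le hd (fun y => ?_) ?_
      · rw [inner_smul_right, inv_mul_le_iff₀ hpos, mul_comm]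
        exact hK.inner_le_gauge_mul y v
      · rw [inner_smul_left, conj_trivial] at hv
        rw [inner_smul_right, ← hv, rho]
        have h1 := hK.gauge_pos_S u
        have h2 : ⟪(u : E n), (v : E n)⟫ ≠ 0 := by
          intro h0
          rw [h0, mul_zero] at hv
          exact hpos.ne hv
        field_simp
    have hne : gradient (gauge K) (u : E n) ≠ 0 := by
      rw [hgr]
      exact smul_ne_zero (inv_ne_zero hpos.ne') (coe_S_ne_zero v)
    rw [gaussMap, dif_neg hne]
    ext1
    simp only [direction]
    rw [hgr, norm_smul, norm_coe_S, mul_one, smul_smul, norm_inv, inv_inv, Real.norm_eq_abs,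
      abs_of_pos hpos, mul_inv_cancel₀ hpos.ne', one_smul]
  obtain ⟨v, hv⟩ := hK.exists_normal (hK.rho_smul_mem_frontier u)
  have := key v hv
  exact ⟨this ▸ hv, fun v' hv' => (key v' hv').symm⟩

lemma exists_lipschitz_gauge (hK : IsBody K) : ∃ C, LipschitzWith C (gauge K) :=
  hK.convex.lipschitz_gauge hK.mem_nhds

lemma ae_isUniqueNormal (hn : 1 ≤ n) (hK : IsBody K) :
    ∀ᵐ u : S n ∂(sph n), IsUniqueNormal K (rho K u • (u : E n)) (gaussMap K u) := by
  obtain ⟨C, hC⟩ := hK.exists_lipschitz_gauge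
  filter_upwards [ae_differentiableAt_sph hn hC fun c hc x => gauge_smul_nonneg hc.le x] with u hu
  exact hK.isUniqueNormal_gaussMap hu

lemma ae_differentiableAt_supportFn (hn : 1 ≤ n) (hK : IsBody K) :
    ∀ᵐ v : S n ∂(sph n), DifferentiableAt ℝ (supportFn K) (v : E n) := by
  obtain ⟨C, hC⟩ := hK.exists_lipschitz_supportFn
  exact ae_differentiableAt_sph hn hC fun c hc x => hK.supportFn_smul hc.le x

end IsBody

end ChordMinkowski

/-! ### First variation of weighted volumes under perturbed support functions -/

namespace ChordMinkowski

open Metric Filter Topology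
open scoped Pointwise

variable {n : ℕ} {K L : Set (E n)}

/-- The Wulff shape of the perturbed support function `h_K + t g`. -/
def perturb (K : Set (E n)) (g : S n → ℝ) (t : ℝ) : Set (E n) :=
  wulffShape fun u => supportFn K u + t * g u

namespace IsBody

lemma perturb_zero (hK : IsBody K) (g : S n → ℝ) : perturb K g 0 = K := by
  simp only [perturb, zero_mul, add_zero]
  exact hK.wulffShape_supportFn

/-- Perturbing along the support function is a dilation, so the chord integral is explicit in this
direction. -/
lemma perturb_supportFn (hK : IsBody K) {t c : ℝ} (ht : 0 < 1 + t * c) :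
    perturb K (fun u => c * supportFn K u) t = (1 + t * c) • K := by
  ext x
  rw [Set.mem_smul_set_iff_inv_smul_mem₀ ht.ne', hK.mem_iff_forall_inner_le]
  simp only [perturb, wulffShape, Set.mem_ofPred_eq]
  refine forall_congr' fun u => ?_
  rw [inner_smul_left, conj_trivial, inv_mul_le_iff₀ ht, add_mul, one_mul, mul_assoc]

variable {g : S n → ℝ} {M r R : ℝ}

lemma isBody_perturb (hK : IsBody K) (hr : 0 < r) (hrK : closedBall (0 : E n) r ⊆ K)
    (hRK : K ⊆ closedBall (0 : E n) R) (hR : 0 < R)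
    (hM : ∀ u, |g u| ≤ M) {t : ℝ} (ht : 0 ≤ t) (htM : t * M ≤ r / 2) : IsBody (perturb K g t) := by
  have hb : ∀ u, |t * g u| ≤ r / 2 := fun u => by
    rw [abs_mul, abs_of_nonneg ht]
    exact (mul_le_mul_of_nonneg_left (hM u) ht).trans htM
  refine isBody_wulffShape (c := r / 2) (C := R + r / 2) (by positivity) (fun u => ?_) (fun u => ?_) (by positivity)
  · have := hK.mul_norm_le_supportFn hr.le hrK u
    rw [norm_coe_S, mul_one] at this
    have := (abs_le.1 (hb u)).1
    linarith
  · have := hK.supportFn_le_mul_norm hRK u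
    rw [norm_coe_S, mul_one] at this
    have := (abs_le.1 (hb u)).2
    linarith

/-- Since h ≥ r, the perturbation is at most (tM/r) h in absolute value, so the new body lies
between the dilates of K by 1 - tM/r and 1 + tM/r. This provides the dominating function for the
first variation. -/
lemma abs_rho_perturb_sub_le (hK : IsBody K) (hr : 0 < r) (hrK : closedBall (0 : E n) r ⊆ K)
    (hM : ∀ u, |g u| ≤ M) {t : ℝ} (ht : 0 ≤ t) (htM : t * M ≤ r / 2)
    (hP : IsBody (perturb K g t)) (u : S n) :
    |rho (perturb K g t) u - rho K u| ≤ t * (M / r * rho K u) := by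
  have hM0 : 0 ≤ M := (abs_nonneg _).trans (hM u)
  have hh : ∀ v : S n, r ≤ supportFn K v := fun v => by
    simpa using hK.mul_norm_le_supportFn hr.le hrK v
  have hg : ∀ v : S n, |t * g v| ≤ t * M / r * supportFn K v := fun v => by
    rw [abs_mul, abs_of_nonneg ht]
    calc t * |g v| ≤ t * M / r * r := by
          rw [div_mul_cancel₀ _ hr.ne']
          exact mul_le_mul_of_nonneg_left (hM v) ht
      _ ≤ _ := mul_le_mul_of_nonneg_left (hh v) (by positivity)
  have hs : t * M / r ≤ 1 / 2 := by
    rw [div_le_iff₀ hr]; linarith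
  have hs0 : 0 ≤ t * M / r := by positivity
  have hρ := hK.rho_pos u
  have hρ' := hP.rho_pos u
  have e1 : (1 - t * M / r) * rho K u ≤ rho (perturb K g t) u := by
    rw [← hP.smul_mem_iff_le_rho (mul_nonneg (by linarith) hρ.le)]
    intro v
    rw [mul_smul, inner_smul_left, conj_trivial]
    have h1 := hK.inner_le_supportFn (hK.rho_smul_mem u) v
    have h2 := (abs_le.1 (hg v)).1
    have h3 := mul_le_mul_of_nonneg_left h1 (show 0 ≤ 1 - t * M / r by linarith)
    linarith
  have e2 : (1 + t * M / r)⁻¹ * rho (perturb K g t) u ≤ rho K u := by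
    rw [← hK.smul_mem_iff_le_rho (by positivity)]
    rw [hK.mem_iff_forall_inner_le]
    intro v
    rw [mul_smul, inner_smul_left, conj_trivial, inv_mul_le_iff₀ (by positivity)]
    have h1 : _ ≤ supportFn K v + t * g v := hP.rho_smul_mem u v
    have h2 := (abs_le.1 (hg v)).2
    linarith
  rw [inv_mul_le_iff₀ (by positivity)] at e2
  have e3 : t * (M / r * rho K u) = t * M / r * rho K u := by ring
  rw [e3, abs_le]
  constructor <;> linarith

/-- The upper bound comes from the constraint of the normal v alone. For the lower bound, every
other constraint is slack at the boundary point, so only normals near v matter for small t. -/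
lemma tendsto_rho_perturb (hK : IsBody K) (hg : Continuous g) {u v : S n}
    (hv : IsUniqueNormal K (rho K u • (u : E n)) v)
    (hP : ∀ᶠ t in 𝓝[>] (0 : ℝ), IsBody (perturb K g t)) :
    Tendsto (fun t => (rho (perturb K g t) u - rho K u) / t) (𝓝[>] 0)
      (𝓝 (g v / ⟪(u : E n), (v : E n)⟫)) := by
  have hρ := hK.rho_pos u
  have huv : 0 < ⟪(u : E n), (v : E n)⟫ := by
    have h1 := hv.1
    rw [inner_smul_left, conj_trivial] at h1
    have := hK.supportFn_pos v
    rw [← h1] at this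
    exact (mul_pos_iff_of_pos_left hρ).1 this
  rw [tendsto_order]
  constructor
  · intro c' hc'
    obtain ⟨c, hcc, hc⟩ := exists_between hc'
    rw [lt_div_iff₀ huv] at hc
    -- Compactness of the sphere reduces the infinitely many constraints to local ones. Near v the
    -- margin is t (g - c ⟪u, ·⟫), positive by the choice of c; elsewhere it is the strict slack at
    -- t = 0.
    have hall : ∀ᶠ t in 𝓝 (0 : ℝ), ∀ w ∈ (univ : Set (S n)), 0 < t →
        (rho K u + c * t) * ⟪(u : E n), (w : E n)⟫ ≤ supportFn K w + t * g w := by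
      refine isCompact_univ.eventually_forall_of_forall_eventually fun w _ => ?_
      have hle : ∀ w : S n, rho K u * ⟪(u : E n), (w : E n)⟫ ≤ supportFn K w := fun w => by
        have := hK.inner_le_supportFn (hK.rho_smul_mem u) w
        rwa [inner_smul_left, conj_trivial] at this
      have hcs := hK.continuous_supportFn
      by_cases hw : w = v
      · subst hw
        have hcont : Continuous fun z : ℝ × S n => g z.2 - c * ⟪(u : E n), (z.2 : E n)⟫ := by
          fun_prop
        filter_upwards [hcont.continuousAt.eventually (lt_mem_nhds (a := 0) (by simpa using hc))]
          with z hz hz0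
        have := hle z.2
        nlinarith
      · have hlt : rho K u * ⟪(u : E n), (w : E n)⟫ < supportFn K w := by
          refine lt_of_le_of_ne (hle w) fun h => hw (hv.2 w ?_)
          rw [inner_smul_left, conj_trivial, h]
        have hcont : Continuous fun z : ℝ × S n => supportFn K z.2 + z.1 * g z.2 -
            (rho K u + c * z.1) * ⟪(u : E n), (z.2 : E n)⟫ := by
          fun_prop
        filter_upwards [hcont.continuousAt.eventually (lt_mem_nhds (a := 0) (by simpa using hlt))]
          with z hz hz0
        linarith
    have hpos : ∀ᶠ t in 𝓝 (0 : ℝ), 0 < rho K u + c * t :=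
      (by fun_prop : Continuous fun t : ℝ => rho K u + c * t).continuousAt.eventually
        (lt_mem_nhds (by simpa using hρ))
    filter_upwards [hP, nhdsWithin_le_nhds hall, nhdsWithin_le_nhds hpos, self_mem_nhdsWithin]
      with t htP ht hp ht0
    have ht0 : 0 < t := ht0
    have : rho K u + c * t ≤ rho (perturb K g t) u := by
      rw [← htP.smul_mem_iff_le_rho hp.le]
      intro w
      rw [inner_smul_left, conj_trivial]
      exact ht w (mem_univ _) ht0
    rw [lt_div_iff₀ ht0]
    nlinarith
  · intro c hc
    rw [gt_iff_lt, div_lt_iff₀ huv] at hc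
    filter_upwards [hP, self_mem_nhdsWithin] with t htP ht0
    have ht0 : 0 < t := ht0
    have h1 := htP.rho_smul_mem u v
    have h2 := hv.1
    rw [inner_smul_left, conj_trivial] at h1 h2
    rw [div_lt_iff₀ ht0]
    have h3 : (rho (perturb K g t) u - rho K u) * ⟪(u : E n), (v : E n)⟫ ≤ t * g v := by
      linarith
    have h4 : (rho (perturb K g t) u - rho K u) * ⟪(u : E n), (v : E n)⟫ <
        c * t * ⟪(u : E n), (v : E n)⟫ := by nlinarith
    exact lt_of_mul_lt_mul_right h4 huv.le

/-- The first variation of the measure with continuous density `w` under perturbations of the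
support function. -/
lemma tendsto_setIntegral_perturb (hn : 1 ≤ n) (hK : IsBody K) (hg : Continuous g)
    {w : E n → ℝ} (hw : Continuous w) (hw0 : ∀ z, 0 ≤ w z) {B : ℝ} (hB : ∀ z, w z ≤ B) :
    Tendsto (fun t => ((∫ z in perturb K g t, w z) - ∫ z in K, w z) / t) (𝓝[>] 0)
      (𝓝 (∫ u : S n, rho K u ^ (n - 1) * w (rho K u • (u : E n)) *
        (g (gaussMap K u) / ⟪(u : E n), (gaussMap K u : E n)⟫) ∂(sph n))) := by
  obtain ⟨r, hr, hrK⟩ := hK.exists_closedBall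
  obtain ⟨R, hR, hRK⟩ := hK.exists_subset_closedBall
  obtain ⟨M', hM'⟩ := isCompact_univ.exists_bound_of_continuousOn (f := g) hg.continuousOn
  set M := max M' 0 with hMdef
  have hM0 : 0 ≤ M := le_max_right _ _
  have hM : ∀ u, |g u| ≤ M := fun u => (hM' u (mem_univ _)).trans (le_max_left _ _)
  have hsmall : ∀ᶠ t in 𝓝[>] (0 : ℝ), t * M ≤ r / 2 := by
    refine nhdsWithin_le_nhds ?_
    have hc : ContinuousAt (fun t : ℝ => t * M) 0 := by fun_prop
    filter_upwards [hc.eventually (Iio_mem_nhds (show (0 : ℝ) * M < r / 2 by rw [zero_mul]; positivity))] with t ht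
    exact le_of_lt ht
  have hP : ∀ᶠ t in 𝓝[>] (0 : ℝ), IsBody (perturb K g t) := by
    filter_upwards [hsmall, self_mem_nhdsWithin] with t ht ht0
    exact hK.isBody_perturb hr hrK hRK hR hM (le_of_lt ht0) ht
  set P : S n → ℝ → ℝ := fun u s => ∫ ρ in (0 : ℝ)..s, ρ ^ (n - 1) * w (ρ • (u : E n)) with hPdef
  have hcont : ∀ u : S n, Continuous fun ρ : ℝ => ρ ^ (n - 1) * w (ρ • (u : E n)) := fun u => by
    fun_prop
  have hB0 : 0 ≤ B := (hw0 0).trans (hB 0)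
  have h_int : ∀ {L : Set (E n)}, IsBody L → Integrable (fun u => P u (rho L u)) (sph n) := fun hL =>
    (continuous_radial_integral hw hL.continuous_rho).integrable_of_hasCompactSupport
      (HasCompactSupport.of_compactSpace _)
  have heq : ∀ᶠ t in 𝓝[>] (0 : ℝ),
      ∫ u : S n, (P u (rho (perturb K g t) u) - P u (rho K u)) / t ∂(sph n) =
      ((∫ z in perturb K g t, w z) - ∫ z in K, w z) / t := by
    filter_upwards [hP] with t ht
    rw [setIntegral_polar hn ht hw hw0, setIntegral_polar hn hK hw hw0, integral_div,
      integral_sub (h_int ht) (h_int hK)]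
  refine Tendsto.congr' heq ?_
  -- For small t the perturbed radius differs from the old one by at most R, so all radii are at
  -- most 2R; the last factor is the Lipschitz rate of the radius in t.
  refine tendsto_integral_filter_of_dominated_convergence
    (fun _ => (2 * R) ^ (n - 1) * B * (M / r * R)) ?_ ?_ (integrable_const _) ?_
  · filter_upwards [hP] with t ht
    exact (((h_int ht).sub (h_int hK)).div_const t).aestronglyMeasurable
  · filter_upwards [hP, hsmall, self_mem_nhdsWithin] with t ht hts ht0
    have ht0 : 0 < t := ht0
    refine Eventually.of_forall fun u => ?_
    have hρ := hK.rho_pos u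
    have hρR := hK.rho_le hRK u
    have hd := hK.abs_rho_perturb_sub_le hr hrK hM ht0.le hts ht u
    have hd' : |rho (perturb K g t) u - rho K u| ≤ R := by
      refine hd.trans ?_
      calc t * (M / r * rho K u) = (t * M) / r * rho K u := by ring
        _ ≤ 1 * R := by
          have : t * M / r ≤ 1 := by rw [div_le_iff₀ hr]; linarith
          gcongr
        _ = R := one_mul R
    have hsub : P u (rho (perturb K g t) u) - P u (rho K u) =
        ∫ ρ in (rho K u)..(rho (perturb K g t) u), ρ ^ (n - 1) * w (ρ • (u : E n)) :=
      intervalIntegral.integral_interval_sub_left ((hcont u).intervalIntegrable _ _)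
        ((hcont u).intervalIntegrable _ _)
    rw [hsub, norm_div, Real.norm_eq_abs t, abs_of_pos ht0, div_le_iff₀ ht0]
    have hb := intervalIntegral.norm_integral_le_of_norm_le_const (a := rho K u)
      (b := rho (perturb K g t) u) (C := (2 * R) ^ (n - 1) * B)
      (f := fun ρ => ρ ^ (n - 1) * w (ρ • (u : E n))) (fun ρ hρm => by
        have h1 := hρm.1
        have h2 := hρm.2
        have hp := ht.rho_pos u
        have h0 : 0 ≤ ρ := (lt_min hρ hp).le.trans h1.le
        have h3 : ρ ≤ 2 * R := h2.trans (max_le (by linarith) (by linarith [(abs_le.1 hd').2]))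
        rw [Real.norm_eq_abs, abs_of_nonneg (mul_nonneg (pow_nonneg h0 _) (hw0 _))]
        exact mul_le_mul (pow_le_pow_left₀ h0 h3 _) (hB _) (hw0 _) (by positivity))
    refine hb.trans ?_
    calc (2 * R) ^ (n - 1) * B * |rho (perturb K g t) u - rho K u|
        ≤ (2 * R) ^ (n - 1) * B * (t * (M / r * R)) := by
          refine mul_le_mul_of_nonneg_left (hd.trans ?_) (by positivity)
          gcongr
      _ = _ := by ring
  · filter_upwards [hK.ae_isUniqueNormal hn] with u hu
    have h1 := hK.tendsto_rho_perturb hg hu hP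
    -- The pointwise limit is a one-sided chain rule: the radius as a function of t, inside the
    -- primitive of the radial integrand.
    have hder : HasDerivWithinAt (fun t => rho (perturb K g t) u)
        (g (gaussMap K u) / ⟪(u : E n), (gaussMap K u : E n)⟫) (Ioi 0) 0 := by
      rw [hasDerivWithinAt_iff_tendsto_slope' (by simp)]
      refine h1.congr fun t => ?_
      simp [slope_def_field, hK.perturb_zero]
    have hPd : HasDerivAt (P u) (rho K u ^ (n - 1) * w (rho K u • (u : E n))) (rho K u) :=
      intervalIntegral.integral_hasDerivAt_right ((hcont u).intervalIntegrable _ _)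
        ((hcont u).stronglyMeasurableAtFilter _ _) (hcont u).continuousAt
    have hcomp := HasDerivAt.comp_hasDerivWithinAt_of_eq (0 : ℝ) hPd hder (by rw [hK.perturb_zero])
    rw [hasDerivWithinAt_iff_tendsto_slope' (by simp)] at hcomp
    refine hcomp.congr fun t => ?_
    simp [slope_def_field, hK.perturb_zero]

end IsBody

end ChordMinkowski

/-! ### First variation of the chord integral -/

namespace ChordMinkowski

open Metric Filter Topology
open scoped Pointwise

variable {n : ℕ} {K L : Set (E n)} {q : ℝ}

/-- The real-valued chord potential. -/
def chordDensity (q : ℝ) (K : Set (E n)) (z : E n) : ℝ := (chordPotential q K z).toReal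

/-- The unnormalized chord integral. -/
def chordMass (q : ℝ) (K : Set (E n)) : ℝ := ∫ z in K, chordDensity q K z

lemma chordDensity_nonneg (q : ℝ) (K : Set (E n)) (z : E n) : 0 ≤ chordDensity q K z :=
  ENNReal.toReal_nonneg

lemma omega_pos : 0 < omega n :=
  ENNReal.toReal_pos (measure_ball_pos _ _ one_pos).ne' measure_ball_lt_top.ne

namespace IsBody

lemma chordPotential_ne_top (hK : IsBody K) (hq : 1 ≤ q) (z : E n) : chordPotential q K z ≠ ⊤ := by
  obtain ⟨R, hR, hRK⟩ := hK.exists_subset_closedBall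
  refine ((chordPotential_le hq hRK z).trans_lt ?_).ne
  exact ENNReal.mul_lt_top (ENNReal.rpow_lt_top_of_nonneg (by linarith) ENNReal.ofReal_ne_top)
      (measure_lt_top _ _)

lemma ofReal_chordDensity (hK : IsBody K) (hq : 1 ≤ q) (z : E n) :
    ENNReal.ofReal (chordDensity q K z) = chordPotential q K z :=
  ENNReal.ofReal_toReal (hK.chordPotential_ne_top hq z)

lemma continuous_chordDensity (hK : IsBody K) (hn : 1 ≤ n) (hq : 1 ≤ q) :
    Continuous (chordDensity q K) := by
  rw [continuous_iff_continuousAt]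
  intro z
  exact (ENNReal.tendsto_toReal (hK.chordPotential_ne_top hq z)).comp
    (continuous_chordPotential hn hK.convex hK.isBounded hK.measurableSet hq).continuousAt

lemma exists_chordDensity_le (hK : IsBody K) (hq : 1 ≤ q) : ∃ B, ∀ z, chordDensity q K z ≤ B := by
  obtain ⟨R, hR, hRK⟩ := hK.exists_subset_closedBall
  refine ⟨_, fun z => ENNReal.toReal_mono ?_ (chordPotential_le hq hRK z)⟩
  exact (ENNReal.mul_lt_top (ENNReal.rpow_lt_top_of_nonneg (by linarith) ENNReal.ofReal_ne_top)
      (measure_lt_top _ _)).ne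

lemma volume_pos (hK : IsBody K) : volume K ≠ 0 :=
  (Measure.measure_pos_of_mem_nhds volume hK.mem_nhds).ne'

/-- If it vanished, almost every line through z would meet K in length zero, and polar coordinates
about z would give K volume zero. Positivity at every z of the space allows division at any point
later on. -/
lemma chordDensity_pos (hK : IsBody K) (hn : 1 ≤ n) (hq : 1 ≤ q) (z : E n) :
    0 < chordDensity q K z := by
  refine ENNReal.toReal_pos (fun h0 => ?_) (hK.chordPotential_ne_top hq z)
  have hm : Measurable fun u : S n => xray K z u ^ (q - 1) :=
    ((measurable_xray hK.measurableSet).comp measurable_prodMk_left).pow_const _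
  rw [chordPotential, lintegral_eq_zero_iff hm] at h0
  have hx : ∀ᵐ u : S n ∂(sph n), xray K z u = 0 := by
    filter_upwards [h0] with u hu
    rw [Pi.zero_apply, ENNReal.rpow_eq_zero_iff] at hu
    rcases hu with hu | hu
    · exact hu.1
    · exact absurd hu.1 (xray_ne_top hK.isBounded z u)
  have hvol : ∫⁻ y, K.indicator (fun _ => (1 : ℝ≥0∞)) (z + y) = volume K := by
    rw [lintegral_add_left_eq_self (fun y => K.indicator (fun _ => (1 : ℝ≥0∞)) y) z,
      lintegral_indicator hK.measurableSet, setLIntegral_const, one_mul]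
  have hm0 : Measurable fun y => K.indicator (fun _ => (1 : ℝ≥0∞)) (z + y) :=
    (measurable_const.indicator hK.measurableSet).comp (measurable_const_add z)
  rw [lintegral_polar hn hm0] at hvol
  refine hK.volume_pos (hvol.symm.trans ?_)
  rw [← lintegral_zero (μ := sph n)]
  refine lintegral_congr_ae ?_
  filter_upwards [hx] with u hu
  rw [← lintegral_zero (μ := volume.restrict (Ioi (0 : ℝ)))]
  refine lintegral_congr_ae (ae_restrict_of_ae ?_)
  have : ∀ᵐ t : ℝ, z + t • (u : E n) ∉ K := measure_eq_zero_iff_ae_notMem.1 hu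
  filter_upwards [this] with t ht
  rw [indicator_of_notMem ht, mul_zero]

lemma integrableOn_chordDensity (hK : IsBody K) (hL : IsBody L) (hn : 1 ≤ n) (hq : 1 ≤ q) :
    IntegrableOn (chordDensity q K) L :=
  (hK.continuous_chordDensity hn hq).continuousOn.integrableOn_compact hL.isCompact

lemma ofReal_setIntegral_chordDensity (hK : IsBody K) (hL : IsBody L) (hn : 1 ≤ n) (hq : 1 ≤ q) :
    ENNReal.ofReal (∫ z in L, chordDensity q K z) = ∫⁻ z in L, chordPotential q K z := by
  rw [ofReal_integral_eq_lintegral_ofReal (hK.integrableOn_chordDensity hL hn hq)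
    (Eventually.of_forall fun z => chordDensity_nonneg q K z)]
  simp_rw [hK.ofReal_chordDensity hq]

lemma chordIntegral_eq_ofReal (hK : IsBody K) (hn : 1 ≤ n) (hq : 1 ≤ q) :
    chordIntegral q K = ENNReal.ofReal (chordMass q K / (n * omega n)) := by
  have h0 : 0 < n * omega n := mul_pos (by exact_mod_cast hn) omega_pos
  rw [chordIntegral_eq hK.measurableSet hq, ← hK.ofReal_setIntegral_chordDensity hK hn hq,
    ENNReal.ofReal_div_of_pos h0, mul_comm, ENNReal.div_eq_inv_mul, mul_comm, chordMass]

lemma chordMass_nonneg (K : Set (E n)) : 0 ≤ chordMass q K :=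
  integral_nonneg fun z => chordDensity_nonneg q K z

lemma mul_setIntegral_chordDensity_le (hK : IsBody K) (hL : IsBody L) (hn : 1 ≤ n) (hq : 1 ≤ q) :
    q * ∫ z in L, chordDensity q K z ≤ chordMass q L + (q - 1) * chordMass q K := by
  have h := mul_setLIntegral_chordPotential_le hK.measurableSet hK.isBounded hL.measurableSet
    hL.isBounded hq
  have hq1 : 0 ≤ q - 1 := by linarith
  have hN : 0 ≤ (q - 1) * chordMass q K := mul_nonneg hq1 (chordMass_nonneg K)
  rw [← hK.ofReal_setIntegral_chordDensity hL hn hq, ← hK.ofReal_setIntegral_chordDensity hK hn hq,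
    ← hL.ofReal_setIntegral_chordDensity hL hn hq, ← ENNReal.ofReal_mul (by linarith),
    ← ENNReal.ofReal_mul hq1, ← chordMass, ← chordMass,
    ← ENNReal.ofReal_add (chordMass_nonneg L) hN, ENNReal.ofReal_le_ofReal_iff (add_nonneg (chordMass_nonneg L) hN)] at h
  exact h

lemma smul (hK : IsBody K) {s : ℝ} (hs : 0 < s) : IsBody (s • K) :=
  ⟨hK.isCompact.smul s, hK.convex.smul s, by
    rw [interior_smul₀ hs.ne']
    exact ⟨0, hK.zero_mem, by simp⟩⟩

lemma chordMass_smul (hK : IsBody K) (hn : 1 ≤ n) (hq : 1 ≤ q) {s : ℝ} (hs : 0 < s) :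
    chordMass q (s • K) = s ^ ((n : ℝ) + q - 1) * chordMass q K := by
  have h := setLIntegral_chordPotential_smul (q := q) hs hK.measurableSet hq
  rw [← (hK.smul hs).ofReal_setIntegral_chordDensity (hK.smul hs) hn hq,
    ← hK.ofReal_setIntegral_chordDensity hK hn hq, ← ENNReal.ofReal_mul (by positivity)] at h
  exact (ENNReal.ofReal_eq_ofReal_iff (chordMass_nonneg _)
    (mul_nonneg (by positivity) (chordMass_nonneg K))).1 h

/-- The first variation of the `chordDensity`-weighted volume in the direction `g`. -/
def _root_.ChordMinkowski.firstVariation (q : ℝ) (K : Set (E n)) (g : S n → ℝ) : ℝ :=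
  ∫ u : S n, rho K u ^ (n - 1) * chordDensity q K (rho K u • (u : E n)) *
        (g (gaussMap K u) / ⟪(u : E n), (gaussMap K u : E n)⟫) ∂(sph n)

lemma tendsto_firstVariation (hK : IsBody K) (hn : 1 ≤ n) (hq : 1 ≤ q) {g : S n → ℝ}
    (hg : Continuous g) :
    Tendsto (fun t => ((∫ z in perturb K g t, chordDensity q K z) - chordMass q K) / t) (𝓝[>] 0)
      (𝓝 (firstVariation q K g)) :=
  hK.tendsto_setIntegral_perturb hn hg (hK.continuous_chordDensity hn hq)
    (chordDensity_nonneg q K) (hK.exists_chordDensity_le hq).choose_spec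

lemma eventually_isBody_perturb (hK : IsBody K) {g : S n → ℝ} (hg : Continuous g) :
    ∀ᶠ t in 𝓝[>] (0 : ℝ), IsBody (perturb K g t) := by
  obtain ⟨r, hr, hrK⟩ := hK.exists_closedBall
  obtain ⟨R, hR, hRK⟩ := hK.exists_subset_closedBall
  obtain ⟨M, hM⟩ := isCompact_univ.exists_bound_of_continuousOn (f := g) hg.continuousOn
  have hc : ContinuousAt (fun t : ℝ => t * M) 0 := by fun_prop
  filter_upwards [nhdsWithin_le_nhds
    (hc.eventually (Iio_mem_nhds (show (0 : ℝ) * M < r / 2 by rw [zero_mul]; positivity))),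
    self_mem_nhdsWithin] with t ht ht0
  exact hK.isBody_perturb hr hrK hRK hR (fun u => hM u (mem_univ _)) (le_of_lt ht0) (le_of_lt ht)

/-- A first-order gain of the integral with frozen weight is a gain of the full chord integral,
because the latter lies above its linearization. -/
lemma eventually_chordMass_lt_perturb (hK : IsBody K) (hn : 1 ≤ n) (hq : 1 ≤ q) {g : S n → ℝ}
    (hg : Continuous g) (hpos : 0 < firstVariation q K g) :
    ∀ᶠ t in 𝓝[>] (0 : ℝ), chordMass q K < chordMass q (perturb K g t) := by
  filter_upwards [hK.eventually_isBody_perturb hg,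
    (hK.tendsto_firstVariation hn hq hg).eventually (lt_mem_nhds hpos), self_mem_nhdsWithin]
    with t hb ht ht0
  have ht0 : 0 < t := ht0
  have h1 := hK.mul_setIntegral_chordDensity_le hb hn hq
  have h2 := (div_pos_iff_of_pos_right ht0).1 ht
  nlinarith

/-- The linearization inequality for the dilates (1 + tc) K, divided by t: the right side is known
by homogeneity, and its derivative at 0 produces the factor n + q - 1. -/
lemma firstVariation_mul_le (hK : IsBody K) (hn : 1 ≤ n) (hq : 1 ≤ q) (c : ℝ) :
    q * firstVariation q K (fun u => c * supportFn K u) ≤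
      ((n : ℝ) + q - 1) * c * chordMass q K := by
  have hg : Continuous fun u : S n => c * supportFn K u :=
    continuous_const.mul (hK.continuous_supportFn.comp continuous_subtype_val)
  have h1 := (hK.tendsto_firstVariation hn hq hg).const_mul q
  have hd : HasDerivAt (fun t : ℝ => (1 + t * c) ^ ((n : ℝ) + q - 1) * chordMass q K)
      (((n : ℝ) + q - 1) * c * chordMass q K) 0 := by
    have h0 : HasDerivAt (fun t : ℝ => 1 + t * c) c 0 := by
      simpa using ((hasDerivAt_id (0 : ℝ)).mul_const c).const_add 1
    have := (h0.rpow_const (p := (n : ℝ) + q - 1) (Or.inl (by simp))).mul_const (chordMass q K)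
    refine this.congr_deriv ?_
    rw [zero_mul, add_zero, Real.one_rpow]
    ring
  have h2 := (hasDerivWithinAt_iff_tendsto_slope' (by simp)).1 (hd.hasDerivWithinAt (s := Ioi 0))
  refine le_of_tendsto_of_tendsto h1 h2 ?_
  have hpos : ∀ᶠ t in 𝓝 (0 : ℝ), 0 < 1 + t * c :=
    (by fun_prop : Continuous fun t : ℝ => 1 + t * c).continuousAt.eventually
      (lt_mem_nhds (by simp))
  filter_upwards [nhdsWithin_le_nhds hpos, self_mem_nhdsWithin] with t ht ht0
  have ht0 : 0 < t := ht0
  have h3 := hK.mul_setIntegral_chordDensity_le (hK.smul ht) hn hq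
  rw [hK.chordMass_smul hn hq ht] at h3
  rw [hK.perturb_supportFn ht, slope_def_field, mul_div_assoc']
  simp only [sub_zero, zero_mul, add_zero, Real.one_rpow, one_mul]
  gcongr
  linarith

lemma firstVariation_const_mul (c : ℝ) (g : S n → ℝ) :
    firstVariation q K (fun u => c * g u) = c * firstVariation q K g := by
  unfold firstVariation
  rw [← integral_const_mul]
  congr 1
  ext u
  ring

/-- The inequality for c = 1 and for c = -1 gives both directions. -/
lemma mul_firstVariation_supportFn (hK : IsBody K) (hn : 1 ≤ n) (hq : 1 ≤ q) :
    q * firstVariation q K (fun u => supportFn K u) = ((n : ℝ) + q - 1) * chordMass q K := by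
  have h1 := hK.firstVariation_mul_le hn hq 1
  have h2 := hK.firstVariation_mul_le hn hq (-1)
  rw [firstVariation_const_mul] at h1 h2
  linarith

end IsBody

end ChordMinkowski

/-! ### The function φ and the functional Φ -/

namespace ChordMinkowski

open Metric Filter Topology
open scoped Pointwise

variable {n : ℕ} {K : Set (E n)} {p p' ε q Λ : ℝ} {φ : ℝ → ℝ} {f : S n → ℝ}

section ApproxFn

lemma extFn_of_pos {z : ℝ} (hz : 0 < z) : extFn φ z = ENNReal.ofReal (φ z) := if_pos hz

lemma extFn_of_nonpos {z : ℝ} (hz : z ≤ 0) : extFn φ z = ⊤ := if_neg (not_lt.2 hz)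

namespace IsApproxFn

lemma differentiableAt (hφ : IsApproxFn n p p' ε φ) {z : ℝ} (hz : 0 < z) :
    DifferentiableAt ℝ φ z :=
  hφ.diff.differentiableAt (Ioi_mem_nhds hz)

lemma add_deriv_mul_le (hφ : IsApproxFn n p p' ε φ) {x y : ℝ} (hx : 0 < x) (hy : 0 < y) :
    φ x + deriv φ x * (y - x) ≤ φ y := by
  rcases lt_trichotomy x y with h | rfl | h
  · have := hφ.strictConvex.convexOn.deriv_le_slope hx hy h (hφ.differentiableAt hx)
    rw [slope_def_field, le_div_iff₀ (by linarith)] at this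
    linarith
  · simp
  · have := hφ.strictConvex.convexOn.slope_le_deriv hy hx h (hφ.differentiableAt hx)
    rw [slope_def_field, div_le_iff₀ (by linarith)] at this
    linarith

lemma strictMonoOn_deriv (hφ : IsApproxFn n p p' ε φ) : StrictMonoOn (deriv φ) (Ioi 0) :=
  hφ.strictConvex.strictMonoOn_deriv fun _ hx => hφ.differentiableAt hx

/-- Strict monotonicity of φ' makes a nonnegative derivative strictly positive one unit later, after
which φ would increase. -/
lemma deriv_neg (hφ : IsApproxFn n p p' ε φ) {x : ℝ} (hx : 0 < x) : deriv φ x < 0 := by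
  by_contra! h
  have h1 : deriv φ x < deriv φ (x + 1) :=
    hφ.strictMonoOn_deriv hx (show 0 < x + 1 by linarith) (by linarith)
  have h2 := hφ.add_deriv_mul_le (show 0 < x + 1 by linarith) (show 0 < x + 2 by linarith)
  have h3 := hφ.anti (show 0 < x + 1 by linarith) (show 0 < x + 2 by linarith) (by linarith)
  nlinarith

/-- A derivative has the intermediate value property (Darboux), and a monotone function with that
property has no jumps. -/
lemma continuousOn_deriv (hφ : IsApproxFn n p p' ε φ) : ContinuousOn (deriv φ) (Ioi 0) := by
  intro a ha
  have ha : 0 < a := ha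
  have hord : OrdConnected (deriv φ '' Ioi 0) :=
    ordConnected_Ioi.image_hasDerivWithinAt fun x hx =>
      (hφ.differentiableAt hx).hasDerivAt.hasDerivWithinAt
  have hmono := hφ.strictMonoOn_deriv
  refine (continuousAt_of_monotoneOn_of_exists_between hmono.monotoneOn (Ioi_mem_nhds ha)
    (fun b hb => ?_) fun b hb => ?_).continuousWithinAt
  · have hx : deriv φ (a / 2) < deriv φ a := hmono (half_pos ha) ha (by linarith)
    obtain ⟨m, hm1, hm2⟩ := exists_between (max_lt hb hx)
    obtain ⟨c, hc, rfl⟩ := hord.out ⟨a / 2, half_pos ha, rfl⟩ ⟨a, ha, rfl⟩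
      ⟨(le_max_right _ _).trans hm1.le, hm2.le⟩
    exact ⟨c, hc, (le_max_left _ _).trans_lt hm1, hm2⟩
  · have hx : deriv φ a < deriv φ (a + 1) := hmono ha (show 0 < a + 1 by linarith) (by linarith)
    obtain ⟨m, hm1, hm2⟩ := exists_between (lt_min hb hx)
    obtain ⟨c, hc, rfl⟩ := hord.out ⟨a, ha, rfl⟩ ⟨a + 1, show 0 < a + 1 by linarith, rfl⟩
      ⟨hm1.le, hm2.le.trans (min_le_right _ _)⟩
    exact ⟨c, hc, hm1, hm2.trans_le (min_le_left _ _)⟩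

lemma antitone_extFn (hφ : IsApproxFn n p p' ε φ) : Antitone (extFn φ) := by
  intro x y hxy
  by_cases hx : 0 < x
  · rw [extFn_of_pos hx, extFn_of_pos (hx.trans_le hxy)]
    exact ENNReal.ofReal_le_ofReal (hφ.anti hx (hx.trans_le hxy) hxy)
  · rw [extFn_of_nonpos (not_lt.1 hx)]
    exact le_top

/-- Only 0 is delicate. There φ(z) ≥ z^(1-n)/(n-1), and n ≥ 2 makes this at least z^(-1)/(n-1) for z
< 1, so the value +∞ is the limit. -/
lemma continuous_extFn (hφ : IsApproxFn n p p' ε φ) (hn : 2 ≤ n) (hε : 0 < ε) :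
    Continuous (extFn φ) := by
  rw [continuous_iff_continuousAt]
  intro z
  rcases lt_trichotomy z 0 with hz | rfl | hz
  · refine (continuousAt_const (y := (⊤ : ℝ≥0∞))).congr ?_
    filter_upwards [Iio_mem_nhds hz] with y hy
    exact (extFn_of_nonpos (le_of_lt hy)).symm
  · rw [ContinuousAt, extFn_of_nonpos le_rfl, ENNReal.tendsto_nhds_top_iff_nnreal]
    intro M
    have hn2 : (2 : ℝ) ≤ n := by exact_mod_cast hn
    have hn1 : (0 : ℝ) < (n : ℝ) - 1 := by linarith
    set δ := min (min ε 1) (1 / (((n : ℝ) - 1) * (M + 1)))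
    have hδ : 0 < δ := by positivity
    filter_upwards [Iio_mem_nhds hδ] with y hy
    by_cases hy0 : 0 < y
    · rw [extFn_of_pos hy0, ENNReal.lt_ofReal_iff_toReal_lt ENNReal.coe_ne_top, ENNReal.coe_toReal]
      have hyε : y < ε := (lt_of_lt_of_le hy (min_le_left _ _)).trans_le (min_le_left _ _)
      have hy1 : y < 1 := (lt_of_lt_of_le hy (min_le_left _ _)).trans_le (min_le_right _ _)
      have hyM : y < 1 / (((n : ℝ) - 1) * (M + 1)) := lt_of_lt_of_le hy (min_le_right _ _)
      refine lt_of_lt_of_le ?_ (hφ.lower y hy0 hyε)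
      have h1 : y ^ (-1 : ℝ) ≤ y ^ (-(n : ℝ) + 1) :=
        Real.rpow_le_rpow_of_exponent_ge hy0 hy1.le (by linarith)
      rw [Real.rpow_neg_one] at h1
      rw [lt_div_iff₀ (by positivity)] at hyM
      have h2 : (M : ℝ) + 1 < 1 / ((n : ℝ) - 1) * y⁻¹ := by
        rw [one_div, ← mul_inv, ← one_div, lt_div_iff₀ (by positivity)]
        linarith
      have h3 : 1 / ((n : ℝ) - 1) * y⁻¹ ≤ 1 / ((n : ℝ) - 1) * y ^ (-(n : ℝ) + 1) := by
        gcongr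
      linarith
    · rw [extFn_of_nonpos (not_lt.1 hy0)]
      exact ENNReal.coe_lt_top
  · have : ContinuousAt (fun y => ENNReal.ofReal (φ y)) z :=
      ENNReal.continuous_ofReal.continuousAt.comp (hφ.differentiableAt hz).continuousAt
    refine this.congr ?_
    filter_upwards [Ioi_mem_nhds hz] with y hy
    exact (extFn_of_pos hy).symm

/-- The second argument may be 0, since h - ξ·v can vanish when ξ is a boundary point; then the
right side is infinite while the midpoint is still positive. -/
lemma extFn_midpoint_le (hφ : IsApproxFn n p p' ε φ) {a b : ℝ} (ha : 0 < a) (hb : 0 ≤ b) :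
    2 * extFn φ ((a + b) / 2) ≤ extFn φ a + extFn φ b ∧
      (a ≠ b → 2 * extFn φ ((a + b) / 2) < extFn φ a + extFn φ b) := by
  have hm : 0 < (a + b) / 2 := by linarith
  have h2 : (2 : ℝ≥0∞) * ENNReal.ofReal (φ ((a + b) / 2)) = ENNReal.ofReal (2 * φ ((a + b) / 2)) := by
    rw [ENNReal.ofReal_mul zero_le_two]; norm_num
  rcases hb.eq_or_lt with rfl | hb
  · rw [extFn_of_nonpos (le_refl (0 : ℝ)), extFn_of_pos hm, add_top, h2]
    exact ⟨le_top, fun _ => ENNReal.ofReal_lt_top⟩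
  · rw [extFn_of_pos hm, extFn_of_pos ha, extFn_of_pos hb, h2,
      ← ENNReal.ofReal_add (hφ.pos a ha).le (hφ.pos b hb).le]
    have hlt : a ≠ b → 2 * φ ((a + b) / 2) < φ a + φ b := fun hab => by
      have := hφ.strictConvex.2 ha hb hab (show (0 : ℝ) < 1 / 2 by norm_num)
        (show (0 : ℝ) < 1 / 2 by norm_num) (by norm_num)
      simp only [smul_eq_mul] at this
      rw [show (a + b) / 2 = 1 / 2 * a + 1 / 2 * b by ring]
      linarith
    refine ⟨ENNReal.ofReal_le_ofReal ?_, fun hab => ?_⟩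
    · by_cases hab : a = b
      · subst hab
        rw [add_self_div_two]
        linarith
      · exact (hlt hab).le
    · exact (ENNReal.ofReal_lt_ofReal_iff (by linarith [hφ.pos a ha, hφ.pos b hb])).2 (hlt hab)

end IsApproxFn

end ApproxFn

section Phi

variable {H : S n → ℝ}

lemma aemeasurable_Phi_integrand (hφ : IsApproxFn n p p' ε φ) (hn : 2 ≤ n) (hε : 0 < ε)
    (hf : AEMeasurable f (sph n)) (hH : Continuous H) (ξ : E n) :
    AEMeasurable (fun v : S n => ENNReal.ofReal (f v) * extFn φ (H v - ⟪ξ, (v : E n)⟫)) (sph n) :=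
  hf.ennreal_ofReal.mul (((hφ.continuous_extFn hn hε).comp (by fun_prop)).aemeasurable)

lemma Phi_anti (hφ : IsApproxFn n p p' ε φ) {H' : S n → ℝ} (h : ∀ v, H v ≤ H' v) (ξ : E n) :
    Phi f φ H' ξ ≤ Phi f φ H ξ :=
  lintegral_mono fun v => mul_le_mul_right (hφ.antitone_extFn (by linarith [h v])) _

lemma integrable_mul_comp {G : S n → ℝ} (hf : AEMeasurable f (sph n))
    (hfΛ : ∀ᵐ v ∂(sph n), 1 / Λ < f v ∧ f v < Λ) (hΛ : 0 < Λ) (hG : Continuous G) :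
    Integrable (fun v => f v * G v) (sph n) := by
  obtain ⟨M, hM⟩ := isCompact_univ.exists_bound_of_continuousOn (f := G) hG.continuousOn
  have hGi : Integrable G (sph n) := hG.integrable_of_hasCompactSupport (HasCompactSupport.of_compactSpace _)
  refine hGi.bdd_mul hf.aestronglyMeasurable (c := Λ) ?_
  filter_upwards [hfΛ] with v hv
  have : 0 < f v := (by positivity : 0 < 1 / Λ).trans hv.1
  rw [Real.norm_eq_abs, abs_of_pos this]
  exact hv.2.le

lemma continuous_comp_of_pos {F : ℝ → ℝ} (hF : ContinuousOn F (Ioi 0)) {G : S n → ℝ}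
    (hG : Continuous G) (hpos : ∀ v, 0 < G v) : Continuous fun v => F (G v) :=
  hF.comp_continuous hG hpos

lemma Phi_eq_ofReal (hφ : IsApproxFn n p p' ε φ) (hf : AEMeasurable f (sph n))
    (hfΛ : ∀ᵐ v ∂(sph n), 1 / Λ < f v ∧ f v < Λ) (hΛ : 0 < Λ) (hH : Continuous H) {ξ : E n}
    (hpos : ∀ v : S n, 0 < H v - ⟪ξ, (v : E n)⟫) :
    Phi f φ H ξ = ENNReal.ofReal (∫ v, f v * φ (H v - ⟪ξ, (v : E n)⟫) ∂(sph n)) := by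
  have hc : Continuous fun v : S n => φ (H v - ⟪ξ, (v : E n)⟫) :=
    continuous_comp_of_pos hφ.diff.continuousOn (by fun_prop) hpos
  have hf0 : ∀ᵐ v ∂(sph n), 0 < f v := by
    filter_upwards [hfΛ] with v hv
    exact (by positivity : 0 < 1 / Λ).trans hv.1
  rw [ofReal_integral_eq_lintegral_ofReal (integrable_mul_comp hf hfΛ hΛ hc)]
  · refine lintegral_congr_ae ?_
    filter_upwards [hf0] with v hv
    rw [extFn_of_pos (hpos v), ENNReal.ofReal_mul hv.le]
  · filter_upwards [hf0] with v hv
    exact mul_nonneg hv.le (hφ.pos _ (hpos v)).le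

/-- The minimum point of `Phi` is unique. -/
lemma eq_zero_of_Phi_le (hn : 2 ≤ n) (hε : 0 < ε) (hφ : IsApproxFn n p p' ε φ)
    (hf : AEMeasurable f (sph n)) (hfΛ : ∀ᵐ v ∂(sph n), 1 / Λ < f v ∧ f v < Λ) (hΛ : 0 < Λ)
    (hK : IsBody K) (hξ : IsMinOn (Phi f φ fun v => supportFn K v) K 0)
    {ξ : E n} (hξK : ξ ∈ K) (hle : Phi f φ (fun v => supportFn K v) ξ ≤
      Phi f φ (fun v => supportFn K v) 0) : ξ = 0 := by
  by_contra h0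
  have hh : Continuous fun v : S n => supportFn K v :=
    hK.continuous_supportFn.comp continuous_subtype_val
  set h : S n → ℝ := fun v => supportFn K v
  -- The midpoint of the two minimum points would have a strictly smaller value.
  have hmem : (1 / 2 : ℝ) • ξ ∈ K := by
    have := hK.convex.smul_mem_of_zero_mem hK.zero_mem' hξK (t := 1 / 2) ⟨by norm_num, by norm_num⟩
    exact this
  have hmin : Phi f φ h 0 ≤ Phi f φ h ((1 / 2 : ℝ) • ξ) := hξ hmem
  have hfin : Phi f φ h 0 ≠ ⊤ := by
    rw [Phi_eq_ofReal hφ hf hfΛ hΛ hh (fun v => by simpa using hK.supportFn_pos v)]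
    exact ENNReal.ofReal_ne_top
  have hf0 : ∀ᵐ v ∂(sph n), 0 < f v := by
    filter_upwards [hfΛ] with v hv
    exact (by positivity : 0 < 1 / Λ).trans hv.1
  have hmid (v : S n) : h v - ⟪(1 / 2 : ℝ) • ξ, (v : E n)⟫ = (h v + (h v - ⟪ξ, (v : E n)⟫)) / 2 := by
    rw [inner_smul_left, conj_trivial]; ring
  have hpt (v : S n) := hφ.extFn_midpoint_le (hK.supportFn_pos v)
    (sub_nonneg.2 (hK.inner_le_supportFn hξK v))
  have hm0 := aemeasurable_Phi_integrand hφ hn hε hf hh (0 : E n)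
  have hm1 := aemeasurable_Phi_integrand hφ hn hε hf hh ξ
  have hm2 := aemeasurable_Phi_integrand hφ hn hε hf hh ((1 / 2 : ℝ) • ξ)
  have hsum : ∫⁻ v : S n, (ENNReal.ofReal (f v) * extFn φ (h v - ⟪(0 : E n), (v : E n)⟫) +
      ENNReal.ofReal (f v) * extFn φ (h v - ⟪ξ, (v : E n)⟫)) ∂(sph n) =
      Phi f φ h 0 + Phi f φ h ξ := lintegral_add_left' hm0 _
  have htwo : ∫⁻ v : S n, 2 * (ENNReal.ofReal (f v) *
      extFn φ (h v - ⟪(1 / 2 : ℝ) • ξ, (v : E n)⟫)) ∂(sph n) = 2 * Phi f φ h ((1 / 2 : ℝ) • ξ) :=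
    lintegral_const_mul'' _ hm2
  have hrew (v : S n) : 2 * (ENNReal.ofReal (f v) * extFn φ (h v - ⟪(1 / 2 : ℝ) • ξ, (v : E n)⟫)) =
      ENNReal.ofReal (f v) * (2 * extFn φ ((h v + (h v - ⟪ξ, (v : E n)⟫)) / 2)) := by
    rw [hmid]; ring
  have hle2 (v : S n) : 2 * (ENNReal.ofReal (f v) * extFn φ (h v - ⟪(1 / 2 : ℝ) • ξ, (v : E n)⟫)) ≤
      ENNReal.ofReal (f v) * extFn φ (h v - ⟪(0 : E n), (v : E n)⟫) +
        ENNReal.ofReal (f v) * extFn φ (h v - ⟪ξ, (v : E n)⟫) := by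
    rw [hrew, ← mul_add, inner_zero_left, sub_zero]
    exact mul_le_mul_right (hpt v).1 _
  have hsumfin : Phi f φ h 0 + Phi f φ h ξ ≠ ⊤ :=
    ENNReal.add_ne_top.2 ⟨hfin, (hle.trans_lt (lt_top_iff_ne_top.2 hfin)).ne⟩
  -- Strictness holds where the two arguments h and h - ξ·v differ, an open set containing the
  -- direction of ξ.
  have hset : sph n {v : S n | ⟪ξ, (v : E n)⟫ ≠ 0} ≠ 0 := by
    have hopen : IsOpen {v : S n | ⟪ξ, (v : E n)⟫ ≠ 0} :=
      isOpen_ne_fun (by fun_prop) continuous_const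
    refine hopen.measure_ne_zero (volume : Measure (E n)).toSphere ⟨direction ξ h0, ?_⟩
    simp only [direction, ne_eq, Set.mem_ofPred_eq, inner_smul_right, real_inner_self_eq_norm_sq]
    have : ‖ξ‖ ≠ 0 := norm_ne_zero_iff.2 h0
    positivity
  have hlt := lintegral_strict_mono_of_ae_le_of_ae_lt_on (μ := sph n) (hm0.add hm1)
    (f := fun v => 2 * (ENNReal.ofReal (f v) *
      extFn φ (h v - ⟪(1 / 2 : ℝ) • ξ, (v : E n)⟫)))
    (((lintegral_mono hle2).trans_lt (hsum ▸ lt_top_iff_ne_top.2 hsumfin)).ne)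
    (Eventually.of_forall hle2) hset (by
      filter_upwards [hf0] with v hv hne
      rw [hrew, Pi.add_apply, ← mul_add, inner_zero_left, sub_zero]
      refine (ENNReal.mul_lt_mul_iff_right (by simpa using hv) ENNReal.ofReal_ne_top).2 ((hpt v).2 ?_)
      intro heq
      exact hne (by linarith))
  have hlt' : 2 * Phi f φ h ((1 / 2 : ℝ) • ξ) < Phi f φ h 0 + Phi f φ h ξ := by
    rw [← htwo, ← hsum]; exact hlt
  have : Phi f φ h 0 + Phi f φ h ξ ≤ 2 * Phi f φ h ((1 / 2 : ℝ) • ξ) := by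
    rw [two_mul]
    exact add_le_add hmin (hle.trans hmin)
  exact absurd hlt' (not_lt.2 this)

end Phi

end ChordMinkowski

/-! ### The first-order condition at a maximizer -/

namespace ChordMinkowski

open Metric Filter Topology
open scoped Pointwise

variable {n : ℕ} {K : Set (E n)} {p p' ε q Λ : ℝ} {φ : ℝ → ℝ} {f g : S n → ℝ}

/-- Rescaling `perturb K g t` to the chord integral of `K` gives competitors. -/
lemma eventually_exists_Phi_le (hn : 2 ≤ n) (hq : 1 ≤ q) (hφ : IsApproxFn n p p' ε φ)
    (hf : AEMeasurable f (sph n)) (hfΛ : ∀ᵐ v ∂(sph n), 1 / Λ < f v ∧ f v < Λ) (hΛ : 0 < Λ)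
    (hK : IsBody K) (hmax : IsMaximizer q f φ fun v => supportFn K v)
    (hg : Continuous g) (hpos : 0 < firstVariation q K g) :
    ∀ᶠ t in 𝓝[>] (0 : ℝ), ∃ ξ ∈ perturb K g t,
      Phi f φ (fun v => supportFn K v + t * g v) ξ ≤
        Phi f φ (fun v => supportFn K v) 0 + ENNReal.ofReal (t ^ 2) := by
  have hn1 : 1 ≤ n := by omega
  have hh : Continuous fun v : S n => supportFn K v :=
    hK.continuous_supportFn.comp continuous_subtype_val
  have hfin : Phi f φ (fun v => supportFn K v) 0 ≠ ⊤ := by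
    rw [Phi_eq_ofReal hφ hf hfΛ hΛ hh (fun v => by simpa using hK.supportFn_pos v)]
    exact ENNReal.ofReal_ne_top
  obtain ⟨-, hI, hsup⟩ := hmax
  rw [hK.wulffShape_supportFn] at hI hsup
  have hc0 : 0 < n * omega n := mul_pos (by exact_mod_cast hn1) omega_pos
  have hmass : 0 < chordMass q K := by
    rw [hK.chordIntegral_eq_ofReal hn1 hq] at hI
    have : 0 < chordMass q K / (n * omega n) := by
      rw [← ENNReal.ofReal_pos, hI]; exact one_pos
    exact (div_pos_iff_of_pos_right hc0).1 this
  filter_upwards [hK.eventually_isBody_perturb hg,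
    hK.eventually_chordMass_lt_perturb hn1 hq hg hpos, self_mem_nhdsWithin] with t hP hlt ht0
  have ht0 : 0 < t := ht0
  set a : ℝ := (n : ℝ) + q - 1
  have ha : 0 < a := by
    have : (2 : ℝ) ≤ n := by exact_mod_cast hn
    simp only [a]; linarith
  have hmP : 0 < chordMass q (perturb K g t) := hmass.trans hlt
  -- The dilation factor that restores the chord integral. It is at most 1 because the perturbed
  -- body has the larger integral, so the rescaled body stays inside the perturbed one.
  set s : ℝ := (chordMass q K / chordMass q (perturb K g t)) ^ a⁻¹
  have hs : 0 < s := Real.rpow_pos_of_pos (div_pos hmass hmP) _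
  have hs1 : s ≤ 1 := Real.rpow_le_one (div_pos hmass hmP).le ((div_le_one hmP).2 hlt.le)
    (inv_nonneg.2 ha.le)
  have hsa : s ^ a = chordMass q K / chordMass q (perturb K g t) :=
    Real.rpow_inv_rpow (div_pos hmass hmP).le ha.ne'
  have hb := hP.smul hs
  have hsub : s • perturb K g t ⊆ perturb K g t := by
    rintro _ ⟨x, hx, rfl⟩
    exact hP.convex.smul_mem_of_zero_mem hP.zero_mem' hx ⟨hs.le, hs1⟩
  have hI' : chordIntegral q (s • perturb K g t) = 1 := by
    rw [← hI, hb.chordIntegral_eq_ofReal hn1 hq, hK.chordIntegral_eq_ofReal hn1 hq,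
      hP.chordMass_smul hn1 hq hs, hsa, div_mul_cancel₀ _ hmP.ne']
  have hle : (⨅ ξ ∈ s • perturb K g t, Phi f φ (fun v => supportFn (s • perturb K g t) v) ξ) ≤
      Phi f φ (fun v => supportFn K v) 0 := by
    calc _ = ⨅ ξ ∈ wulffShape (fun v : S n => supportFn (s • perturb K g t) v),
            Phi f φ (fun v => supportFn (s • perturb K g t) v) ξ := by rw [hb.wulffShape_supportFn]
      _ ≤ _ := le_iSup₂_of_le (fun v : S n => supportFn (s • perturb K g t) v)
          ⟨hb.supportFn_mem_SPlus, by rw [hb.wulffShape_supportFn, hI']⟩ le_rfl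
      _ = _ := hsup.symm
      _ ≤ _ := iInf₂_le 0 hK.zero_mem'
  -- The competitor's infimum need not be attained. An error t² is harmless because the final
  -- estimate is divided by t.
  have hlt' := hle.trans_lt (ENNReal.lt_add_right hfin
    (ENNReal.ofReal_pos.2 (by positivity : 0 < t ^ 2)).ne')
  simp only [iInf_lt_iff] at hlt'
  obtain ⟨ξ, hξ, hξlt⟩ := hlt'
  -- The support function of the shrunken body is at most h + tg, and Φ decreases in its function
  -- argument. It does not matter that h + tg need not be a support function.
  refine ⟨ξ, hsub hξ, (Phi_anti hφ (fun v => ?_) ξ).trans hξlt.le⟩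
  exact hb.supportFn_le fun x hx => hsub hx v

/-- The points stay bounded. Any limit point lies in K and, by Fatou's lemma, has Φ-value at most
that of the origin, so uniqueness of the minimum point identifies it with 0. -/
lemma tendsto_zero_of_Phi_le (hn : 2 ≤ n) (hε : 0 < ε) (hφ : IsApproxFn n p p' ε φ)
    (hf : AEMeasurable f (sph n)) (hfΛ : ∀ᵐ v ∂(sph n), 1 / Λ < f v ∧ f v < Λ) (hΛ : 0 < Λ)
    (hK : IsBody K) (hξ : IsMinOn (Phi f φ fun v => supportFn K v) K 0)
    (hg : Continuous g) {t : ℕ → ℝ} (ht : Tendsto t atTop (𝓝 0)) {ξ : ℕ → E n}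
    (hmem : ∀ k, ξ k ∈ perturb K g (t k))
    (hle : ∀ k, Phi f φ (fun v => supportFn K v + t k * g v) (ξ k) ≤
        Phi f φ (fun v => supportFn K v) 0 + ENNReal.ofReal (t k ^ 2)) :
    Tendsto ξ atTop (𝓝 0) := by
  have hh : Continuous fun v : S n => supportFn K v :=
    hK.continuous_supportFn.comp continuous_subtype_val
  obtain ⟨R, hR, hRK⟩ := hK.exists_subset_closedBall
  obtain ⟨M, hM⟩ := isCompact_univ.exists_bound_of_continuousOn (f := g) hg.continuousOn
  obtain ⟨T, hT⟩ := ht.norm.bddAbove_range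
  have hbdd : ∀ k, ξ k ∈ closedBall (0 : E n) (R + |T| * |M|) := fun k => by
    rw [mem_closedBall_zero_iff]
    rcases eq_or_ne (ξ k) 0 with h0 | h0
    · rw [h0, norm_zero]; positivity
    have h1 : _ ≤ supportFn K _ + t k * g _ := hmem k (direction (ξ k) h0)
    have h2 := hK.supportFn_le_mul_norm hRK (direction (ξ k) h0)
    have h3 : t k * g (direction (ξ k) h0) ≤ |T| * |M| := by
      refine (le_abs_self _).trans ?_
      rw [abs_mul]
      exact mul_le_mul ((hT ⟨k, rfl⟩).trans (le_abs_self _))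
        ((hM _ (mem_univ _)).trans (le_abs_self _)) (abs_nonneg _) (abs_nonneg _)
    have h4 : ⟪ξ k, (direction (ξ k) h0 : E n)⟫ = ‖ξ k‖ := by
      simp only [direction, inner_smul_right, real_inner_self_eq_norm_sq]
      have : ‖ξ k‖ ≠ 0 := norm_ne_zero_iff.2 h0
      field_simp
    rw [norm_coe_S, mul_one] at h2
    linarith
  refine tendsto_of_subseq_tendsto fun ns hns => ?_
  obtain ⟨x, -, ms, hms, hlim⟩ := (isCompact_closedBall (0 : E n) (R + |T| * |M|)).tendsto_subseq
    fun k => hbdd (ns k)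
  refine ⟨ms, ?_⟩
  have hsub : Tendsto (fun k => ns (ms k)) atTop atTop := hns.comp hms.tendsto_atTop
  have ht' : Tendsto (fun k => t (ns (ms k))) atTop (𝓝 0) := ht.comp hsub
  have hlim' : Tendsto (fun k => ξ (ns (ms k))) atTop (𝓝 x) := hlim
  suffices hx : x = 0 by rw [← hx]; exact hlim'
  have hpt (v : S n) : Tendsto (fun k => supportFn K v + t (ns (ms k)) * g v -
      ⟪ξ (ns (ms k)), (v : E n)⟫) atTop (𝓝 (supportFn K v - ⟪x, (v : E n)⟫)) := by
    have h1 := (ht'.mul_const (g v)).const_add (supportFn K v)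
    rw [zero_mul, add_zero] at h1
    exact h1.sub (hlim'.inner tendsto_const_nhds)
  have hxK : x ∈ K := by
    rw [hK.mem_iff_forall_inner_le]
    intro v
    refine sub_nonneg.1 (ge_of_tendsto' (hpt v) fun k => ?_)
    exact sub_nonneg.2 (hmem (ns (ms k)) v)
  refine eq_zero_of_Phi_le hn hε hφ hf hfΛ hΛ hK hξ hxK ?_
  have hcont := hφ.continuous_extFn hn hε
  -- Fatou is needed because the arguments of φ may approach 0; continuity of the extended φ into
  -- [0, ∞] identifies the lower limit.
  have hfatou := lintegral_liminf_le' (μ := sph n) (u := atTop)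
    (f := fun (k : ℕ) (v : S n) => ENNReal.ofReal (f v) *
      extFn φ (supportFn K v + t (ns (ms k)) * g v - ⟪ξ (ns (ms k)), (v : E n)⟫))
    (fun k => aemeasurable_Phi_integrand hφ hn hε hf (by fun_prop) (ξ (ns (ms k))))
  have hlhs : ∫⁻ v : S n, liminf (fun k : ℕ => ENNReal.ofReal (f v) *
      extFn φ (supportFn K v + t (ns (ms k)) * g v - ⟪ξ (ns (ms k)), (v : E n)⟫)) atTop ∂(sph n) =
      Phi f φ (fun v => supportFn K v) x := by
    refine lintegral_congr fun v => Tendsto.liminf_eq ?_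
    exact ENNReal.Tendsto.const_mul ((hcont.tendsto _).comp (hpt v)) (Or.inr ENNReal.ofReal_ne_top)
  rw [hlhs] at hfatou
  refine hfatou.trans ?_
  have hlimR : Tendsto (fun k => Phi f φ (fun v => supportFn K v) 0 +
      ENNReal.ofReal (t (ns (ms k)) ^ 2)) atTop (𝓝 (Phi f φ (fun v => supportFn K v) 0)) := by
    have h1 : Tendsto (fun k => ENNReal.ofReal (t (ns (ms k)) ^ 2)) atTop (𝓝 0) := by
      rw [← ENNReal.ofReal_zero]
      refine (ENNReal.continuous_ofReal.tendsto _).comp ?_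
      simpa using ht'.pow 2
    simpa using tendsto_const_nhds.add h1
  rw [← hlimR.liminf_eq]
  exact liminf_le_liminf (Eventually.of_forall fun k => hle (ns (ms k)))

/-- The first-order condition at a maximizer. -/
lemma integral_deriv_mul_nonpos (hn : 2 ≤ n) (hq : 1 ≤ q) (hε : 0 < ε)
    (hφ : IsApproxFn n p p' ε φ)
    (hf : AEMeasurable f (sph n)) (hfΛ : ∀ᵐ v ∂(sph n), 1 / Λ < f v ∧ f v < Λ) (hΛ : 0 < Λ)
    (hK : IsBody K) (hmax : IsMaximizer q f φ fun v => supportFn K v)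
    (hξ : IsMinOn (Phi f φ fun v => supportFn K v) K 0)
    (hg : Continuous g) (hpos : 0 < firstVariation q K g) :
    ∫ v : S n, f v * (deriv φ (supportFn K v) * g v) ∂(sph n) ≤ 0 := by
  have hh : Continuous fun v : S n => supportFn K v :=
    hK.continuous_supportFn.comp continuous_subtype_val
  obtain ⟨r, hr, hrK⟩ := hK.exists_closedBall
  have hrh : ∀ v : S n, r ≤ supportFn K v := fun v => by
    simpa using hK.mul_norm_le_supportFn hr.le hrK v
  obtain ⟨M, hM⟩ := isCompact_univ.exists_bound_of_continuousOn (f := g) hg.continuousOn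
  have hev := eventually_exists_Phi_le hn hq hφ hf hfΛ hΛ hK hmax hg hpos
  obtain ⟨t, htlim, htev⟩ : ∃ t : ℕ → ℝ, Tendsto t atTop (𝓝[>] 0) ∧
      ∀ k, ∃ ξ ∈ perturb K g (t k), Phi f φ (fun v => supportFn K v + t k * g v) ξ ≤
        Phi f φ (fun v => supportFn K v) 0 + ENNReal.ofReal (t k ^ 2) :=
    exists_seq_forall_of_frequently hev.frequently
  choose ξ hξmem hξle using htev
  have ht0 : Tendsto t atTop (𝓝 0) := htlim.mono_right nhdsWithin_le_nhds
  have htpos : ∀ᶠ k in atTop, 0 < t k := htlim.eventually self_mem_nhdsWithin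
  have hξ0 := tendsto_zero_of_Phi_le hn hε hφ hf hfΛ hΛ hK hξ hg ht0 hξmem hξle
  have hξsmall : ∀ᶠ k in atTop, ‖ξ k‖ < r / 2 := by
    have := hξ0.norm
    rw [norm_zero] at this
    exact this.eventually (gt_mem_nhds (by positivity))
  have htsmall : ∀ᶠ k in atTop, |t k| * |M| < r / 2 := by
    have : Tendsto (fun k => |t k| * |M|) atTop (𝓝 (|0| * |M|)) := ht0.abs.mul_const _
    rw [abs_zero, zero_mul] at this
    exact this.eventually (gt_mem_nhds (by positivity))
  have hinner : ∀ k, ‖ξ k‖ < r / 2 → ∀ v : S n, r / 2 < supportFn K v - ⟪ξ k, (v : E n)⟫ :=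
    fun k hk v => by
      have := real_inner_le_norm (ξ k) v
      rw [norm_coe_S, mul_one] at this
      linarith [hrh v]
  have hineq : ∀ᶠ k in atTop,
      ∫ v : S n, f v * (deriv φ (supportFn K v - ⟪ξ k, (v : E n)⟫) * g v) ∂(sph n) ≤ t k := by
    filter_upwards [htpos, hξsmall, htsmall] with k hk hξk htk
    have hp1 : ∀ v : S n, 0 < supportFn K v - ⟪ξ k, (v : E n)⟫ := fun v => by
      linarith [hinner k hξk v]
    have hp2 : ∀ v : S n, 0 < supportFn K v + t k * g v - ⟪ξ k, (v : E n)⟫ := fun v => by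
      have h1 : |t k * g v| < r / 2 := by
        rw [abs_mul]
        refine lt_of_le_of_lt (mul_le_mul_of_nonneg_left ?_ (abs_nonneg _)) htk
        exact (hM v (mem_univ _)).trans (le_abs_self _)
      linarith [hinner k hξk v, (abs_lt.1 h1).1]
    have hp0 : ∀ v : S n, 0 < supportFn K v - ⟪(0 : E n), (v : E n)⟫ := fun v => by
      simpa using hK.supportFn_pos v
    have hξK : ξ k ∈ K := hK.mem_iff_forall_inner_le.2 fun v => by linarith [hp1 v]
    have hmin : Phi f φ (fun v => supportFn K v) 0 ≤ Phi f φ (fun v => supportFn K v) (ξ k) := hξ hξK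
    have hle := hξle k
    have hf0 : ∀ᵐ v ∂(sph n), 0 < f v := by
      filter_upwards [hfΛ] with v hv
      exact (by positivity : 0 < 1 / Λ).trans hv.1
    have hnn : ∀ {G : S n → ℝ}, (∀ v, 0 < G v) → 0 ≤ ∫ v, f v * φ (G v) ∂(sph n) := fun hG =>
      integral_nonneg_of_ae (by
        filter_upwards [hf0] with v hv
        exact mul_nonneg hv.le (hφ.pos _ (hG v)).le)
    rw [Phi_eq_ofReal hφ hf hfΛ hΛ hh hp0, Phi_eq_ofReal hφ hf hfΛ hΛ (by fun_prop) hp1,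
      ENNReal.ofReal_le_ofReal_iff (hnn hp1)] at hmin
    rw [Phi_eq_ofReal hφ hf hfΛ hΛ hh hp0, Phi_eq_ofReal hφ hf hfΛ hΛ (by fun_prop) hp2,
      ← ENNReal.ofReal_add (hnn hp0) (by positivity),
      ENNReal.ofReal_le_ofReal_iff (add_nonneg (hnn hp0) (by positivity))] at hle
    have hc1 : Continuous fun v : S n => φ (supportFn K v - ⟪ξ k, (v : E n)⟫) :=
      continuous_comp_of_pos hφ.diff.continuousOn (by fun_prop) hp1
    have hc2 : Continuous fun v : S n => φ (supportFn K v + t k * g v - ⟪ξ k, (v : E n)⟫) :=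
      continuous_comp_of_pos hφ.diff.continuousOn (by fun_prop) hp2
    have hc3 : Continuous fun v : S n => deriv φ (supportFn K v - ⟪ξ k, (v : E n)⟫) :=
      continuous_comp_of_pos hφ.continuousOn_deriv (by fun_prop) hp1
    have hi1 := integrable_mul_comp hf hfΛ hΛ hc1
    have hi2 := integrable_mul_comp hf hfΛ hΛ hc2
    have hi3 : Integrable (fun v : S n =>
        f v * (deriv φ (supportFn K v - ⟪ξ k, (v : E n)⟫) * g v)) (sph n) :=
      integrable_mul_comp hf hfΛ hΛ (hc3.mul hg)
    -- The tangent is taken at h - ξ_k rather than h, so no term linear in ξ_k appears and no rate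
    -- of convergence of ξ_k is required. Minimality at the origin disposes of the zeroth-order
    -- term.
    have hmono : (∫ v : S n, f v * φ (supportFn K v - ⟪ξ k, (v : E n)⟫) ∂(sph n)) +
        t k * ∫ v : S n, f v * (deriv φ (supportFn K v - ⟪ξ k, (v : E n)⟫) * g v) ∂(sph n) ≤
        ∫ v : S n, f v * φ (supportFn K v + t k * g v - ⟪ξ k, (v : E n)⟫) ∂(sph n) := by
      rw [← integral_const_mul, ← integral_add hi1 (hi3.const_mul _)]
      refine integral_mono_ae (hi1.add (hi3.const_mul _)) hi2 ?_
      filter_upwards [hf0] with v hv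
      have h1 := hφ.add_deriv_mul_le (hp1 v) (hp2 v)
      have h2 := mul_le_mul_of_nonneg_left h1 hv.le
      refine le_trans (le_of_eq ?_) h2
      ring
    have hfinal : t k * ∫ v : S n, f v * (deriv φ (supportFn K v - ⟪ξ k, (v : E n)⟫) * g v) ∂(sph n)
        ≤ t k * t k := by
      have : t k ^ 2 = t k * t k := sq (t k)
      linarith
    exact le_of_mul_le_mul_left hfinal hk
  have hlim : Tendsto (fun k => ∫ v : S n,
      f v * (deriv φ (supportFn K v - ⟪ξ k, (v : E n)⟫) * g v) ∂(sph n)) atTop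
      (𝓝 (∫ v : S n, f v * (deriv φ (supportFn K v) * g v) ∂(sph n))) := by
    -- The arguments stay above r/2, and φ' is negative and increasing, so |φ'(r/2)| dominates.
    refine tendsto_integral_filter_of_dominated_convergence
      (fun _ => Λ * (|deriv φ (r / 2)| * |M|)) ?_ ?_ (integrable_const _) ?_
    · filter_upwards [hξsmall] with k hk
      have hc3 : Continuous fun v : S n => deriv φ (supportFn K v - ⟪ξ k, (v : E n)⟫) :=
        continuous_comp_of_pos hφ.continuousOn_deriv (by fun_prop)
          fun v => by linarith [hinner k hk v]
      exact (integrable_mul_comp hf hfΛ hΛ (hc3.mul hg)).aestronglyMeasurable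
    · filter_upwards [hξsmall] with k hk
      filter_upwards [hfΛ] with v hv
      have hfv : 0 < f v := (by positivity : 0 < 1 / Λ).trans hv.1
      have hx := hinner k hk v
      have hxpos : 0 < supportFn K v - ⟪ξ k, (v : E n)⟫ := by linarith
      have hd : |deriv φ (supportFn K v - ⟪ξ k, (v : E n)⟫)| ≤ |deriv φ (r / 2)| := by
        have h1 := hφ.deriv_neg hxpos
        have h2 := hφ.deriv_neg (half_pos hr)
        rw [abs_of_neg h1, abs_of_neg h2, neg_le_neg_iff]
        exact hφ.strictMonoOn_deriv.monotoneOn (half_pos hr) hxpos hx.le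
      rw [norm_mul, norm_mul, Real.norm_eq_abs (f v), abs_of_pos hfv, Real.norm_eq_abs]
      gcongr
      · exact hv.2.le
      · exact (hM v (mem_univ _)).trans (le_abs_self _)
    · refine Eventually.of_forall fun v => ?_
      have h1 : Tendsto (fun k => supportFn K v - ⟪ξ k, (v : E n)⟫) atTop (𝓝 (supportFn K v)) := by
        have := (hξ0.inner (tendsto_const_nhds (x := (v : E n)))).const_sub (supportFn K v)
        simpa using this
      have h2 : ContinuousAt (deriv φ) (supportFn K v) :=
        hφ.continuousOn_deriv.continuousAt (Ioi_mem_nhds (hK.supportFn_pos v))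
      exact ((h2.tendsto.comp h1).mul_const _).const_mul _
  exact le_of_tendsto_of_tendsto hlim ht0 hineq

end ChordMinkowski

/-! ### Hausdorff measure and cone volumes -/

namespace ChordMinkowski

open Metric Filter Topology
open scoped Pointwise

variable {n : ℕ} {K : Set (E n)}

section Hausdorff

lemma euclideanHausdorffMeasure_image_le {X Y : Type*} [EMetricSpace X] [MeasurableSpace X]
    [BorelSpace X] [EMetricSpace Y] [MeasurableSpace Y] [BorelSpace Y] {F : X → Y} {s : Set X}
    {b : NNReal} (hF : LipschitzOnWith b F s) (d : ℕ) :
    Measure.euclideanHausdorffMeasure d (F '' s) ≤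
      (b : ℝ≥0∞) ^ d * Measure.euclideanHausdorffMeasure d s := by
  simp only [Measure.euclideanHausdorffMeasure_def, Measure.smul_apply, ENNReal.smul_def, smul_eq_mul]
  have := hF.hausdorffMeasure_image_le (d := d) (by positivity)
  rw [ENNReal.rpow_natCast] at this
  rw [mul_left_comm]
  gcongr

lemma euclideanHausdorffMeasure_le_image {X Y : Type*} [EMetricSpace X] [MeasurableSpace X]
    [BorelSpace X] [EMetricSpace Y] [MeasurableSpace Y] [BorelSpace Y] {F : X → Y} {s : Set X}
    {b : NNReal} (hF : AntilipschitzWith b (s.domRestrict F)) (d : ℕ) :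
    Measure.euclideanHausdorffMeasure d s ≤
      (b : ℝ≥0∞) ^ d * Measure.euclideanHausdorffMeasure d (F '' s) := by
  simp only [Measure.euclideanHausdorffMeasure_def, Measure.smul_apply, ENNReal.smul_def, smul_eq_mul]
  have h1 := hF.le_hausdorffMeasure_image (d := d) (by positivity) univ
  have h2 := (isometry_subtype_coe (s := s)).hausdorffMeasure_image (d := d) (Or.inl (by positivity))
    univ
  rw [image_univ, Subtype.range_coe] at h2
  rw [← h2, image_univ, range_domRestrict, ENNReal.rpow_natCast] at h1
  rw [mul_left_comm]
  gcongr

lemma volume_eq_euclideanHausdorffMeasure :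
    (volume : Measure (E n)) = Measure.euclideanHausdorffMeasure n :=
  (EuclideanSpace.euclideanHausdorffMeasure_eq_volume n).symm

/-- The volume of the cone over a subset of a hyperplane. -/
lemma mul_volume_flat_cone (hn : 1 ≤ n) (v : S n) {c : ℝ} (hc : 0 < c) {A : Set (E n)}
    (hA : MeasurableSet A) (hAc : ∀ x ∈ A, ⟪x, (v : E n)⟫ = c) :
    n * volume (Ioo (0 : ℝ) 1 • A) =
      ENNReal.ofReal c * Measure.euclideanHausdorffMeasure (n - 1) A := by
  have hmem : ∀ y : E n, y ∈ Ioo (0 : ℝ) 1 • A ↔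
      (0 < ⟪y, (v : E n)⟫ ∧ ⟪y, (v : E n)⟫ < c) ∧ (c / ⟪y, (v : E n)⟫) • y ∈ A := by
    intro y
    constructor
    · rintro ⟨s, hs, x, hx, rfl⟩
      have hs0 : 0 < s := hs.1
      have : ⟪s • x, (v : E n)⟫ = s * c := by
        rw [inner_smul_left, conj_trivial, hAc x hx]
      simp only [this]
      refine ⟨⟨mul_pos hs.1 hc, by nlinarith [hs.2]⟩, ?_⟩
      rw [smul_smul, show c / (s * c) * s = 1 by field_simp, one_smul]
      exact hx
    · rintro ⟨⟨h1, h2⟩, h3⟩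
      refine ⟨⟪y, (v : E n)⟫ / c, ⟨by positivity, (div_lt_one hc).2 h2⟩, _, h3, ?_⟩
      simp only [smul_smul]
      rw [show ⟪y, (v : E n)⟫ / c * (c / ⟪y, (v : E n)⟫) = 1 by field_simp, one_smul]
  have hmeas : MeasurableSet (Ioo (0 : ℝ) 1 • A) := by
    have : Ioo (0 : ℝ) 1 • A = (fun y : E n => ⟪y, (v : E n)⟫) ⁻¹' Ioo 0 c ∩
        (fun y : E n => (c / ⟪y, (v : E n)⟫) • y) ⁻¹' A := by
      ext y; rw [hmem]; rfl
    rw [this]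
    have h1 : Measurable fun y : E n => ⟪y, (v : E n)⟫ := by fun_prop
    exact (h1 measurableSet_Ioo).inter (((h1.const_div c).smul measurable_id) hA)
  -- Fubini along v: the slice of the cone at height x is the copy of A scaled by x / c, and the
  -- integral of (x/c)^(n-1) over (0, c) is c / n.
  have hfub := EuclideanGeometry.euclideanHausdorffMeasure_eq_lintegral (0 : E n) (coe_S_ne_zero v)
    hmeas
  rw [finrank_E, ← volume_eq_euclideanHausdorffMeasure] at hfub
  have hslice : ∀ x : ℝ, Measure.euclideanHausdorffMeasure (n - 1) (Ioo (0 : ℝ) 1 • A ∩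
      (AffineSubspace.mk' (x • (v : E n) +ᵥ (0 : E n)) (ℝ ∙ (v : E n))ᗮ : Set (E n))) =
      (Ioo 0 c).indicator (fun x => ENNReal.ofReal ((x / c) ^ (n - 1)) *
        Measure.euclideanHausdorffMeasure (n - 1) A) x := by
    intro x
    have hin : ∀ y : E n, y ∈ (AffineSubspace.mk' (x • (v : E n) +ᵥ (0 : E n))
        (ℝ ∙ (v : E n))ᗮ : Set (E n)) ↔ ⟪y, (v : E n)⟫ = x := by
      intro y
      rw [SetLike.mem_coe, AffineSubspace.mem_mk', Submodule.mem_orthogonal_singleton_iff_inner_left]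
      simp only [vadd_eq_add, add_zero, vsub_eq_sub, inner_sub_left, inner_smul_left, conj_trivial,
        real_inner_self_eq_norm_sq, norm_coe_S, one_pow, mul_one, sub_eq_zero]
    by_cases hx : x ∈ Ioo 0 c
    · have hx0 : 0 < x := hx.1
      rw [indicator_of_mem hx]
      have : Ioo (0 : ℝ) 1 • A ∩ (AffineSubspace.mk' (x • (v : E n) +ᵥ (0 : E n))
          (ℝ ∙ (v : E n))ᗮ : Set (E n)) = (x / c) • A := by
        ext y
        rw [mem_inter_iff, hin, hmem, Set.mem_smul_set_iff_inv_smul_mem₀ (by positivity), inv_div]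
        constructor
        · rintro ⟨⟨-, h⟩, rfl⟩
          exact h
        · intro h
          have h1 := hAc _ h
          rw [inner_smul_left, conj_trivial] at h1
          have h2 : ⟪y, (v : E n)⟫ = x := by
            field_simp at h1
            linarith
          rw [h2]
          exact ⟨⟨hx, h⟩, rfl⟩
      rw [this, Measure.euclideanHausdorffMeasure_smul₀ _ (by positivity), ENNReal.smul_def,
        smul_eq_mul]
      congr 1
      have hxc : 0 ≤ x / c := by positivity
      rw [ENNReal.ofReal_pow hxc, ENNReal.coe_pow, ENNReal.ofReal, Real.toNNReal_of_nonneg hxc]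
      congr 2
      ext
      simp [abs_of_nonneg hx0.le, abs_of_pos hc]
    · rw [indicator_of_notMem hx]
      have : Ioo (0 : ℝ) 1 • A ∩ (AffineSubspace.mk' (x • (v : E n) +ᵥ (0 : E n))
          (ℝ ∙ (v : E n))ᗮ : Set (E n)) = ∅ := by
        ext y
        rw [mem_inter_iff, hin, hmem]
        simp only [mem_empty_iff_false, iff_false]
        rintro ⟨⟨h, -⟩, rfl⟩
        exact hx h
      rw [this, measure_empty]
  have hnorm : ‖(v : E n)‖ₑ = 1 := by
    rw [← ofReal_norm, norm_coe_S, ENNReal.ofReal_one]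
  rw [hfub, hnorm, one_mul]
  simp_rw [hslice]
  rw [lintegral_indicator measurableSet_Ioo, lintegral_mul_const _ (by fun_prop), ← mul_assoc]
  congr 1
  have h_int : ∫⁻ x in Ioo 0 c, ENNReal.ofReal ((x / c) ^ (n - 1)) = ENNReal.ofReal (c / n) := by
    rw [Measure.restrict_congr_set Ioo_ae_eq_Ioc, ← ofReal_integral_eq_lintegral_ofReal
      (Continuous.integrableOn_Ioc (by fun_prop)) ((ae_restrict_iff' measurableSet_Ioc).2
        (Eventually.of_forall fun x hx => pow_nonneg (div_nonneg hx.1.le hc.le) _)),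
      ← intervalIntegral.integral_of_le hc.le]
    congr 1
    simp_rw [div_pow]
    rw [intervalIntegral.integral_div, integral_pow]
    have hn' : n - 1 + 1 = n := by omega
    have hcast : ((n - 1 : ℕ) : ℝ) + 1 = n := by exact_mod_cast hn'
    rw [hcast, hn', zero_pow (by omega), sub_zero]
    have : c ^ n = c ^ (n - 1) * c := by rw [← pow_succ, hn']
    rw [this]
    field_simp
  rw [h_int, ← ENNReal.ofReal_natCast, ← ENNReal.ofReal_mul (by positivity)]
  congr 1
  have : (n : ℝ) ≠ 0 := by positivity
  field_simp

end Hausdorff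

/-- The boundary point of `K` in the direction `u`. -/
def boundaryPt (K : Set (E n)) (u : S n) : E n := rho K u • (u : E n)

namespace IsBody

lemma continuous_boundaryPt (hK : IsBody K) : Continuous (boundaryPt K) :=
  hK.continuous_rho.smul continuous_subtype_val

lemma eq_of_smul_eq_smul {a b : ℝ} {u u' : S n} (ha : 0 < a) (hb : 0 < b)
    (h : a • (u : E n) = b • (u' : E n)) : a = b ∧ u = u' := by
  have h1 : a = b := by
    have := congrArg norm h
    rwa [norm_smul, norm_smul, norm_coe_S, norm_coe_S, mul_one, mul_one, Real.norm_eq_abs,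
      Real.norm_eq_abs, abs_of_pos ha, abs_of_pos hb] at this
  subst h1
  exact ⟨rfl, Subtype.ext (smul_right_injective _ ha.ne' h)⟩

lemma injective_boundaryPt (hK : IsBody K) : Function.Injective (boundaryPt K) := fun u u' h =>
  (eq_of_smul_eq_smul (hK.rho_pos u) (hK.rho_pos u') h).2

lemma measurableSet_image_boundaryPt (hK : IsBody K) {ω : Set (S n)} (hω : MeasurableSet ω) :
    MeasurableSet (boundaryPt K '' ω) :=
  hω.image_of_continuousOn_injOn hK.continuous_boundaryPt.continuousOn
    hK.injective_boundaryPt.injOn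

lemma gauge_boundaryPt (hK : IsBody K) (u : S n) : gauge K (boundaryPt K u) = 1 := by
  rw [gauge_eq_one_iff_mem_frontier hK.convex hK.mem_nhds]
  exact hK.rho_smul_mem_frontier u

/-- A ray in direction u of ω meets the cone in the radii below ρ(u), which contribute ρ(u)^n / n;
other rays miss it. -/
lemma mul_volume_cone (hn : 1 ≤ n) (hK : IsBody K) {ω : Set (S n)} (hω : MeasurableSet ω) :
    n * volume (Ioo (0 : ℝ) 1 • (boundaryPt K '' ω)) =
      ∫⁻ u in ω, ENNReal.ofReal (rho K u ^ n) ∂(sph n) := by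
  have hcone : Ioo (0 : ℝ) 1 • (boundaryPt K '' ω) =
      (fun p : ℝ × S n => p.1 • boundaryPt K p.2) '' (Ioo 0 1 ×ˢ ω) := by
    ext y
    constructor
    · rintro ⟨s, hs, _, ⟨u, hu, rfl⟩, rfl⟩
      exact ⟨(s, u), ⟨hs, hu⟩, rfl⟩
    · rintro ⟨⟨s, u⟩, ⟨hs, hu⟩, rfl⟩
      exact ⟨s, hs, _, ⟨u, hu, rfl⟩, rfl⟩
  have hmem : ∀ (u : S n) {r : ℝ}, 0 < r →
      (r • (u : E n) ∈ Ioo (0 : ℝ) 1 • (boundaryPt K '' ω) ↔ u ∈ ω ∧ r < rho K u) := by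
    intro u r hr
    constructor
    · rintro ⟨s, hs, _, ⟨u', hu', rfl⟩, h⟩
      simp only [boundaryPt, smul_smul] at h
      obtain ⟨h1, rfl⟩ := eq_of_smul_eq_smul (mul_pos hs.1 (hK.rho_pos u')) hr h
      refine ⟨hu', ?_⟩
      rw [← h1]
      nlinarith [hK.rho_pos u', hs.2]
    · rintro ⟨hu, h⟩
      have hρ := hK.rho_pos u
      refine ⟨r / rho K u, ⟨by positivity, (div_lt_one hρ).2 h⟩, _, ⟨u, hu, rfl⟩, ?_⟩
      simp only [boundaryPt, smul_smul]
      rw [div_mul_cancel₀ _ hρ.ne']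
  have hmeas : MeasurableSet (Ioo (0 : ℝ) 1 • (boundaryPt K '' ω)) := by
    rw [hcone]
    -- The cone is an injective continuous image of a Borel set, hence Borel by Lusin–Souslin.
    refine (measurableSet_Ioo.prod hω).image_of_continuousOn_injOn
      (continuous_fst.smul (hK.continuous_boundaryPt.comp continuous_snd)).continuousOn ?_
    rintro ⟨s, u⟩ ⟨hs, -⟩ ⟨s', u'⟩ ⟨hs', -⟩ h
    simp only [boundaryPt, smul_smul] at h
    obtain ⟨h1, rfl⟩ := eq_of_smul_eq_smul (mul_pos hs.1 (hK.rho_pos u))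
      (mul_pos hs'.1 (hK.rho_pos u')) h
    exact Prod.ext (mul_right_cancel₀ (hK.rho_pos u).ne' h1) rfl
  rw [← lintegral_indicator_one hmeas, lintegral_polar hn (measurable_one.indicator hmeas),
    ← lintegral_indicator hω, ← lintegral_const_mul']
  · refine lintegral_congr fun u => ?_
    by_cases hu : u ∈ ω
    · rw [indicator_of_mem hu]
      have hρ := hK.rho_pos u
      have : ∫⁻ r in Ioi (0 : ℝ), ENNReal.ofReal (r ^ (n - 1)) *
          (Ioo (0 : ℝ) 1 • (boundaryPt K '' ω)).indicator 1 (r • (u : E n)) =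
          ∫⁻ r in Ioo (0 : ℝ) (rho K u), ENNReal.ofReal (r ^ (n - 1)) := by
        rw [← lintegral_indicator measurableSet_Ioi, ← lintegral_indicator measurableSet_Ioo]
        refine lintegral_congr fun r => ?_
        by_cases hr : 0 < r
        · rw [indicator_of_mem (show r ∈ Ioi (0 : ℝ) from hr)]
          by_cases hr2 : r < rho K u
          · rw [indicator_of_mem (show r ∈ Ioo 0 (rho K u) from ⟨hr, hr2⟩),
              indicator_of_mem ((hmem u hr).2 ⟨hu, hr2⟩), Pi.one_apply, mul_one]
          · rw [indicator_of_notMem (fun h => hr2 ((hmem u hr).1 h).2), mul_zero,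
              indicator_of_notMem (fun h => hr2 h.2)]
        · rw [indicator_of_notMem (show r ∉ Ioi (0 : ℝ) from hr),
            indicator_of_notMem (fun h => hr h.1)]
      rw [this, Measure.restrict_congr_set Ioo_ae_eq_Ioc, ← ofReal_integral_eq_lintegral_ofReal
        (Continuous.integrableOn_Ioc (by fun_prop)) ((ae_restrict_iff' measurableSet_Ioc).2
          (Eventually.of_forall fun x hx => pow_nonneg hx.1.le _)),
        ← intervalIntegral.integral_of_le hρ.le, integral_pow, ← ENNReal.ofReal_natCast,
        ← ENNReal.ofReal_mul (by positivity)]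
      have hn' : n - 1 + 1 = n := by omega
      have hcast : ((n - 1 : ℕ) : ℝ) + 1 = n := by exact_mod_cast hn'
      have hn0 : (n : ℝ) ≠ 0 := by positivity
      rw [hcast, hn', zero_pow (by omega), sub_zero]
      congr 1
      field_simp
    · rw [indicator_of_notMem hu]
      have : ∫⁻ r in Ioi (0 : ℝ), ENNReal.ofReal (r ^ (n - 1)) *
          (Ioo (0 : ℝ) 1 • (boundaryPt K '' ω)).indicator 1 (r • (u : E n)) = 0 := by
        rw [← lintegral_zero (μ := volume.restrict (Ioi (0 : ℝ)))]
        refine setLIntegral_congr_fun measurableSet_Ioi fun r hr => ?_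
        rw [indicator_of_notMem (fun h => hu ((hmem u hr).1 h).1), mul_zero]
      rw [this, mul_zero]
  · exact ENNReal.natCast_ne_top n

end IsBody

end ChordMinkowski

/-! ### Flattening boundary pieces with nearly constant normal -/

namespace ChordMinkowski

open Metric Filter Topology
open scoped Pointwise

variable {n : ℕ} {K : Set (E n)}

/-- The map which takes each boundary point of `K` to its orthogonal projection on the supporting
hyperplane with normal `v`, extended positively homogeneously. -/
def flatten (K : Set (E n)) (v : S n) (y : E n) : E n :=
  y + (supportFn K v * gauge K y - ⟪y, (v : E n)⟫) • (v : E n)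

lemma flatten_smul (v : S n) {s : ℝ} (hs : 0 ≤ s) (y : E n) :
    flatten K v (s • y) = s • flatten K v y := by
  simp only [flatten, IsBody.gauge_smul_nonneg hs, inner_smul_left, conj_trivial, smul_add, smul_smul]
  congr 2
  ring

/-- The points of the rays through the boundary points of `K` which have an outer normal at distance
at most `δ` from `v`. -/
def normalCone (K : Set (E n)) (v : S n) (δ : ℝ) : Set (E n) :=
  {y | ∃ w : S n, ‖(w : E n) - v‖ ≤ δ ∧ ⟪y, (w : E n)⟫ = gauge K y * supportFn K w}

lemma smul_mem_normalCone {v : S n} {δ s : ℝ} (hs : 0 ≤ s) {y : E n} (hy : y ∈ normalCone K v δ) :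
    s • y ∈ normalCone K v δ := by
  obtain ⟨w, hw, h⟩ := hy
  refine ⟨w, hw, ?_⟩
  rw [inner_smul_left, conj_trivial, IsBody.gauge_smul_nonneg hs, h, mul_assoc]

namespace IsBody

variable {r R κ : ℝ}

/-- The displacement is a scalar multiple of v, with coefficient h(v) gauge - ⟪·, v⟫. If y has
normal w, the gauge has subgradient w / h(w) there, which bounds the increment of the coefficient by
the norm of (h(v)/h(w)) w - v, small when w is near v. Exchanging y and y' gives the other sign. -/
lemma norm_flatten_sub_le (hK : IsBody K) (hr : 0 < r) (hrK : closedBall (0 : E n) r ⊆ K)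
    (hRK : K ⊆ closedBall (0 : E n) R) (hR : 0 < R) {δ : ℝ}
    {v : S n} {y y' : E n} (hy : y ∈ normalCone K v δ) (hy' : y' ∈ normalCone K v δ) :
    ‖(flatten K v y - flatten K v y') - (y - y')‖ ≤ (R / r + 1) * δ * ‖y - y'‖ := by
  have key : ∀ y ∈ normalCone K v δ, ∀ y' : E n,
      supportFn K v * (gauge K y - gauge K y') - ⟪y - y', (v : E n)⟫ ≤
        (R / r + 1) * δ * ‖y - y'‖ := by
    rintro y ⟨w, hw, h⟩ y'
    have hv := hK.supportFn_pos v
    have hw0 := hK.supportFn_pos w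
    have hrw : r ≤ supportFn K w := by
      simpa using hK.mul_norm_le_supportFn hr.le hrK w
    have hg : gauge K y - gauge K y' ≤ ⟪y - y', (w : E n)⟫ / supportFn K w := by
      rw [le_div_iff₀ hw0, inner_sub_left, sub_mul, h]
      linarith [hK.inner_le_gauge_mul y' w]
    have h1 : supportFn K v * (gauge K y - gauge K y') - ⟪y - y', (v : E n)⟫ ≤
        ⟪y - y', (supportFn K v / supportFn K w) • (w : E n) - v⟫ := by
      rw [inner_sub_right, inner_smul_right]
      have := mul_le_mul_of_nonneg_left hg hv.le
      rw [show supportFn K v / supportFn K w * ⟪y - y', (w : E n)⟫ =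
        supportFn K v * (⟪y - y', (w : E n)⟫ / supportFn K w) by ring]
      linarith
    have h2 : ‖(supportFn K v / supportFn K w) • (w : E n) - v‖ ≤ (R / r + 1) * δ := by
      have e : (supportFn K v / supportFn K w) • (w : E n) - v =
          ((supportFn K v - supportFn K w) / supportFn K w) • (w : E n) + (w - v) := by
        rw [sub_div, div_self hw0.ne', sub_smul, one_smul]
        abel
      rw [e]
      refine (norm_add_le _ _).trans ?_
      rw [norm_smul, norm_coe_S, mul_one, Real.norm_eq_abs, abs_div, abs_of_pos hw0]
      have h3 := hK.abs_supportFn_sub_le hRK (v : E n) w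
      rw [norm_sub_rev] at h3
      have h4 : |supportFn K v - supportFn K w| / supportFn K w ≤ R / r * δ := by
        rw [div_le_iff₀ hw0]
        calc |supportFn K v - supportFn K w| ≤ R * δ := h3.trans (by gcongr)
          _ = R / r * δ * r := by field_simp
          _ ≤ _ := by
            have : 0 ≤ δ := (norm_nonneg _).trans hw
            gcongr
      linarith
    calc _ ≤ _ := h1
      _ ≤ ‖y - y'‖ * ‖(supportFn K v / supportFn K w) • (w : E n) - v‖ := real_inner_le_norm _ _
      _ ≤ ‖y - y'‖ * ((R / r + 1) * δ) := by gcongr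
      _ = _ := by ring
  have e : (flatten K v y - flatten K v y') - (y - y') =
      (supportFn K v * (gauge K y - gauge K y') - ⟪y - y', (v : E n)⟫) • (v : E n) := by
    simp only [flatten, inner_sub_left]
    module
  rw [e, norm_smul, norm_coe_S, mul_one, Real.norm_eq_abs, abs_le]
  constructor
  · have := key y' hy' y
    rw [← neg_sub y y', norm_neg, inner_neg_left] at this
    linarith
  · exact key y hy y'

/-- The opening of the normal cone is chosen to make the displacement κ-Lipschitz, so that
flattening is nearly an isometry. -/
lemma lipschitzOnWith_flatten (hK : IsBody K) (hr : 0 < r) (hrK : closedBall (0 : E n) r ⊆ K)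
    (hRK : K ⊆ closedBall (0 : E n) R) (hR : 0 < R) (hκ : 0 ≤ κ) (hκ1 : κ < 1) (v : S n) :
    LipschitzOnWith (Real.toNNReal (1 - κ)⁻¹) (flatten K v) (normalCone K v (κ / (R / r + 1))) := by
  refine LipschitzOnWith.of_dist_le_mul fun y hy y' hy' => ?_
  have h := hK.norm_flatten_sub_le hr hrK hRK hR hy hy'
  have hC : 0 < R / r + 1 := by positivity
  rw [mul_div_cancel₀ _ hC.ne'] at h
  rw [Real.coe_toNNReal _ (inv_nonneg.2 (by linarith)), dist_eq_norm, dist_eq_norm]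
  have h1 : ‖flatten K v y - flatten K v y'‖ ≤ (1 + κ) * ‖y - y'‖ := by
    have := norm_add_le (flatten K v y - flatten K v y' - (y - y')) (y - y')
    rw [sub_add_cancel] at this
    linarith
  -- The natural constant 1 + κ is relaxed to (1 - κ)⁻¹ to agree with the constant of the inverse
  -- map.
  refine h1.trans (mul_le_mul_of_nonneg_right ?_ (norm_nonneg _))
  rw [← one_div, le_div_iff₀ (by linarith)]
  nlinarith

lemma antilipschitzWith_flatten (hK : IsBody K) (hr : 0 < r) (hrK : closedBall (0 : E n) r ⊆ K)
    (hRK : K ⊆ closedBall (0 : E n) R) (hR : 0 < R) (hκ1 : κ < 1) (v : S n)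
    {A : Set (E n)} (hA : A ⊆ normalCone K v (κ / (R / r + 1))) :
    AntilipschitzWith (Real.toNNReal (1 - κ)⁻¹) (A.domRestrict (flatten K v)) := by
  refine AntilipschitzWith.of_le_mul_dist fun y y' => ?_
  have h := hK.norm_flatten_sub_le hr hrK hRK hR (hA y.2) (hA y'.2)
  have hC : 0 < R / r + 1 := by positivity
  rw [mul_div_cancel₀ _ hC.ne'] at h
  rw [Real.coe_toNNReal _ (inv_nonneg.2 (by linarith)), Subtype.dist_eq, dist_eq_norm, dist_eq_norm,
    ← div_eq_inv_mul, le_div_iff₀ (by linarith)]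
  simp only [Set.domRestrict_apply]
  have := norm_sub_norm_le ((y : E n) - y') (flatten K v y - flatten K v y')
  rw [norm_sub_rev ((y : E n) - y')] at this
  linarith

lemma inner_flatten_boundaryPt (hK : IsBody K) (v u : S n) :
    ⟪flatten K v (boundaryPt K u), (v : E n)⟫ = supportFn K v := by
  simp only [flatten, hK.gauge_boundaryPt, inner_add_left, inner_smul_left, conj_trivial,
    real_inner_self_eq_norm_sq, norm_coe_S]
  ring

/-- Comparison of Hausdorff measure with cone measure on a piece of the boundary with almost
constant normals. -/
lemma hausdorff_image_boundaryPt_compare (hn : 1 ≤ n) (hK : IsBody K) (hr : 0 < r)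
    (hrK : closedBall (0 : E n) r ⊆ K) (hRK : K ⊆ closedBall (0 : E n) R) (hR : 0 < R)
    (hκ : 0 ≤ κ) (hκ1 : κ < 1) {v : S n} {ω : Set (S n)} (hω : MeasurableSet ω)
    (hnormal : ∀ u ∈ ω, ∃ w : S n, ‖(w : E n) - v‖ ≤ κ / (R / r + 1) ∧
      ⟪boundaryPt K u, (w : E n)⟫ = supportFn K w) :
    ENNReal.ofReal (supportFn K v) * Measure.euclideanHausdorffMeasure (n - 1) (boundaryPt K '' ω) ≤
      ENNReal.ofReal (1 - κ)⁻¹ ^ (2 * n - 1) * ∫⁻ u in ω, ENNReal.ofReal (rho K u ^ n) ∂(sph n) ∧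
    ∫⁻ u in ω, ENNReal.ofReal (rho K u ^ n) ∂(sph n) ≤
      ENNReal.ofReal (1 - κ)⁻¹ ^ (2 * n - 1) * (ENNReal.ofReal (supportFn K v) *
        Measure.euclideanHausdorffMeasure (n - 1) (boundaryPt K '' ω)) := by
  set A := boundaryPt K '' ω
  set T := flatten K v
  set N := normalCone K v (κ / (R / r + 1))
  have hA : A ⊆ N := by
    rintro _ ⟨u, hu, rfl⟩
    obtain ⟨w, hw, h⟩ := hnormal u hu
    exact ⟨w, hw, by rw [hK.gauge_boundaryPt, one_mul, h]⟩
  have hC : Ioo (0 : ℝ) 1 • A ⊆ N := by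
    rintro _ ⟨s, hs, x, hx, rfl⟩
    exact smul_mem_normalCone hs.1.le (hA hx)
  have hTC : T '' (Ioo (0 : ℝ) 1 • A) = Ioo (0 : ℝ) 1 • (T '' A) := by
    ext y
    constructor
    · rintro ⟨_, ⟨s, hs, x, hx, rfl⟩, rfl⟩
      exact ⟨s, hs, T x, ⟨x, hx, rfl⟩, (flatten_smul v hs.1.le x).symm⟩
    · rintro ⟨s, hs, _, ⟨x, hx, rfl⟩, rfl⟩
      exact ⟨s • x, ⟨s, hs, x, hx, rfl⟩, flatten_smul v hs.1.le x⟩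
  have hLip := hK.lipschitzOnWith_flatten hr hrK hRK hR hκ hκ1 v
  have hAnti {B : Set (E n)} (hB : B ⊆ N) :=
    hK.antilipschitzWith_flatten hr hrK hRK hR hκ1 v hB
  have hTA : MeasurableSet (T '' A) := by
    refine (hK.measurableSet_image_boundaryPt hω).image_of_continuousOn_injOn
      (hLip.mono hA).continuousOn ?_
    exact Set.injOn_iff_injective.2 (hAnti hA).injective
  have hflat := mul_volume_flat_cone hn v (hK.supportFn_pos v) hTA (by
    rintro _ ⟨_, ⟨u, hu, rfl⟩, rfl⟩
    exact hK.inner_flatten_boundaryPt v u)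
  have hcone := hK.mul_volume_cone hn hω
  rw [← hTC] at hflat
  have e1 := euclideanHausdorffMeasure_image_le (hLip.mono hA) (n - 1)
  have e2 := euclideanHausdorffMeasure_le_image (hAnti hA) (n - 1)
  have e3 := euclideanHausdorffMeasure_image_le (hLip.mono hC) n
  have e4 := euclideanHausdorffMeasure_le_image (hAnti hC) n
  rw [← volume_eq_euclideanHausdorffMeasure] at e3 e4
  have hb : ((Real.toNNReal (1 - κ)⁻¹ : NNReal) : ℝ≥0∞) = ENNReal.ofReal (1 - κ)⁻¹ := rfl
  rw [hb] at e1 e2 e3 e4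
  set b := ENNReal.ofReal (1 - κ)⁻¹
  -- Each comparison passes to the flat picture and back, once in dimension n - 1 for the area and
  -- once in dimension n for the cone.
  have hpow : b ^ (2 * n - 1) = b ^ (n - 1) * b ^ n := by
    rw [← pow_add]; congr 1; omega
  rw [hpow, ← hcone]
  constructor
  · calc _ ≤ ENNReal.ofReal (supportFn K v) * (b ^ (n - 1) *
            Measure.euclideanHausdorffMeasure (n - 1) (T '' A)) := by gcongr
      _ = b ^ (n - 1) * (n * volume (T '' (Ioo (0 : ℝ) 1 • A))) := by rw [hflat]; ring
      _ ≤ b ^ (n - 1) * (n * (b ^ n * volume (Ioo (0 : ℝ) 1 • A))) := by gcongr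
      _ = _ := by ring
  · calc _ ≤ n * (b ^ n * volume (T '' (Ioo (0 : ℝ) 1 • A))) := by gcongr
      _ = b ^ n * (ENNReal.ofReal (supportFn K v) *
            Measure.euclideanHausdorffMeasure (n - 1) (T '' A)) := by rw [← hflat]; ring
      _ ≤ b ^ n * (ENNReal.ofReal (supportFn K v) * (b ^ (n - 1) *
            Measure.euclideanHausdorffMeasure (n - 1) A)) := by gcongr
      _ = _ := by ring

end IsBody

end ChordMinkowski

/-! ### Area formula and surface area measure -/

namespace ChordMinkowski

open Metric Filter Topology
open scoped Pointwise

variable {n : ℕ} {K : Set (E n)}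

/-- The density of the surface measure of `K` with respect to spherical measure, in the radial
parametrization. -/
def surfDensity (K : Set (E n)) (u : S n) : ℝ := rho K u ^ n / supportFn K (gaussMap K u)

/-- The directions of the regular boundary points of `K`. -/
def regularSet (K : Set (E n)) : Set (S n) := {u | DifferentiableAt ℝ (gauge K) (u : E n)}

lemma measurableSet_regularSet (K : Set (E n)) : MeasurableSet (regularSet K) :=
  (measurableSet_of_differentiableAt ℝ (gauge K)).preimage measurable_subtype_coe

lemma exists_small_partition (hn : 2 ≤ n) {δ : ℝ} (hδ : 0 < δ) :
    ∃ (d : ℕ → Set (S n)) (x : ℕ → S n), (∀ i, MeasurableSet (d i)) ∧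
      Pairwise (Function.onFun Disjoint d) ∧ (⋃ i, d i) = univ ∧
      ∀ i, ∀ w ∈ d i, ‖(w : E n) - x i‖ ≤ δ := by
  have := nonempty_S hn
  let x : ℕ → S n := TopologicalSpace.denseSeq (S n)
  refine ⟨disjointed fun i => closedBall (x i) δ, x,
    fun i => MeasurableSet.disjointed (fun i => measurableSet_closedBall) i,
    disjoint_disjointed _, ?_, fun i w hw => ?_⟩
  · rw [iUnion_disjointed, eq_univ_iff_forall]
    intro w
    obtain ⟨i, hi⟩ := (TopologicalSpace.denseRange_denseSeq (S n)).exists_dist_lt w hδ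
    exact mem_iUnion.2 ⟨i, hi.le⟩
  · have := disjointed_subset _ _ hw
    rwa [mem_closedBall, Subtype.dist_eq, dist_eq_norm] at this

namespace IsBody

variable {r R κ : ℝ}

lemma sph_compl_regularSet (hn : 1 ≤ n) (hK : IsBody K) : sph n (regularSet K)ᶜ = 0 := by
  obtain ⟨C, hC⟩ := hK.exists_lipschitz_gauge
  exact ae_differentiableAt_sph hn hC fun c hc x => gauge_smul_nonneg hc.le x

lemma surfDensity_pos (hK : IsBody K) (u : S n) : 0 < surfDensity K u :=
  div_pos (pow_pos (hK.rho_pos u) _) (hK.supportFn_pos _)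

lemma measurable_surfDensity (hK : IsBody K) : Measurable (surfDensity K) :=
  (hK.continuous_rho.measurable.pow_const _).div
    (hK.continuous_supportFn.measurable.comp (measurable_subtype_coe.comp (measurable_gaussMap K)))

lemma exists_surfDensity_le (hK : IsBody K) : ∃ B, ∀ u, surfDensity K u ≤ B := by
  obtain ⟨r, hr, hrK⟩ := hK.exists_closedBall
  obtain ⟨R, hR, hRK⟩ := hK.exists_subset_closedBall
  refine ⟨R ^ n / r, fun u => ?_⟩
  have : r ≤ supportFn K (gaussMap K u) := by
    simpa using hK.mul_norm_le_supportFn hr.le hrK (gaussMap K u : E n)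
  have h2 := hK.rho_le hRK u
  have h3 := hK.rho_pos u
  unfold surfDensity
  gcongr

/-- Within the same opening, the Lipschitz constant R changes h by at most κ r, which is at most κ
h(v). -/
lemma supportFn_le_mul_of_norm_sub_le (hK : IsBody K) (hr : 0 < r)
    (hrK : closedBall (0 : E n) r ⊆ K) (hRK : K ⊆ closedBall (0 : E n) R) (hR : 0 < R)
    (hκ : 0 ≤ κ) (hκ1 : κ < 1) {v w : S n} (h : ‖(w : E n) - v‖ ≤ κ / (R / r + 1)) :
    supportFn K w ≤ (1 - κ)⁻¹ * supportFn K v := by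
  have h1 := (abs_le.1 (hK.abs_supportFn_sub_le hRK (w : E n) v)).2
  have h2 : r ≤ supportFn K v := by
    simpa using hK.mul_norm_le_supportFn hr.le hrK (v : E n)
  have h3 : R * ‖(w : E n) - v‖ ≤ κ * r := by
    calc R * ‖(w : E n) - v‖ ≤ R * (κ / (R / r + 1)) := by gcongr
      _ = κ * (R / (R / r + 1)) := by ring
      _ ≤ κ * r := by
        gcongr
        rw [div_le_iff₀ (by positivity), mul_add, mul_div_cancel₀ _ hr.ne']
        linarith
  have h4 : 1 + κ ≤ (1 - κ)⁻¹ := by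
    rw [← one_div, le_div_iff₀ (by linarith)]
    nlinarith
  calc supportFn K w ≤ (1 + κ) * supportFn K v := by nlinarith
    _ ≤ _ := mul_le_mul_of_nonneg_right h4 (hr.le.trans h2)

/-- The directions are partitioned according to a fine partition of the normals. On each piece,
replacing h(ν(u)) by its value at the centre costs one more factor (1 - κ)⁻¹, so the exponent is 2n;
both sides are countably additive. -/
lemma hausdorff_image_compare (hn : 2 ≤ n) (hK : IsBody K) (hκ : 0 < κ) (hκ1 : κ < 1)
    {ω : Set (S n)} (hω : MeasurableSet ω) (hreg : ω ⊆ regularSet K) :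
    Measure.euclideanHausdorffMeasure (n - 1) (boundaryPt K '' ω) ≤
      ENNReal.ofReal (1 - κ)⁻¹ ^ (2 * n) * ∫⁻ u in ω, ENNReal.ofReal (surfDensity K u) ∂(sph n) ∧
    ∫⁻ u in ω, ENNReal.ofReal (surfDensity K u) ∂(sph n) ≤ ENNReal.ofReal (1 - κ)⁻¹ ^ (2 * n) *
      Measure.euclideanHausdorffMeasure (n - 1) (boundaryPt K '' ω) := by
  have hn1 : 1 ≤ n := by omega
  obtain ⟨r, hr, hrK⟩ := hK.exists_closedBall
  obtain ⟨R, hR, hRK⟩ := hK.exists_subset_closedBall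
  obtain ⟨d, x, hd, hdisj, hcover, hdx⟩ := exists_small_partition hn
    (δ := κ / (R / r + 1)) (by positivity)
  set b := ENNReal.ofReal (1 - κ)⁻¹
  have hb0 : 0 ≤ (1 - κ)⁻¹ := inv_nonneg.2 (by linarith)
  set W : ℕ → Set (S n) := fun i => ω ∩ gaussMap K ⁻¹' d i
  have hW : ∀ i, MeasurableSet (W i) := fun i => hω.inter (measurable_gaussMap K (hd i))
  have hWdisj : Pairwise (Function.onFun Disjoint W) := fun i j hij =>
    ((hdisj hij).preimage (gaussMap K)).mono inter_subset_right inter_subset_right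
  have hWU : (⋃ i, W i) = ω := by
    rw [← inter_iUnion, ← preimage_iUnion, hcover, preimage_univ, inter_univ]
  have hloc : ∀ i, Measure.euclideanHausdorffMeasure (n - 1) (boundaryPt K '' W i) ≤
      b ^ (2 * n) * ∫⁻ u in W i, ENNReal.ofReal (surfDensity K u) ∂(sph n) ∧
      ∫⁻ u in W i, ENNReal.ofReal (surfDensity K u) ∂(sph n) ≤
      b ^ (2 * n) * Measure.euclideanHausdorffMeasure (n - 1) (boundaryPt K '' W i) := by
    intro i
    have hc := hK.hausdorff_image_boundaryPt_compare hn1 hr hrK hRK hR hκ.le hκ1 (v := x i) (hW i)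
      (fun u hu => ⟨gaussMap K u, hdx i _ hu.2, (hK.isUniqueNormal_gaussMap (hreg hu.1)).1⟩)
    have hpow : b ^ (2 * n) = b ^ (2 * n - 1) * b := by
      rw [← pow_succ]; congr 1; omega
    have hx0 := hK.supportFn_pos (x i)
    have hne : ENNReal.ofReal (supportFn K (x i)) ≠ 0 := (ENNReal.ofReal_pos.2 hx0).ne'
    have hmeas : Measurable fun u => ENNReal.ofReal (surfDensity K u) :=
      hK.measurable_surfDensity.ennreal_ofReal
    have e1 : ∫⁻ u in W i, ENNReal.ofReal (rho K u ^ n) ∂(sph n) ≤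
        b * ENNReal.ofReal (supportFn K (x i)) *
          ∫⁻ u in W i, ENNReal.ofReal (surfDensity K u) ∂(sph n) := by
      rw [← lintegral_const_mul _ hmeas]
      refine setLIntegral_mono (hmeas.const_mul _) fun u hu => ?_
      rw [← ENNReal.ofReal_mul hb0, ← ENNReal.ofReal_mul (by positivity)]
      refine ENNReal.ofReal_le_ofReal ?_
      have h1 := hK.supportFn_le_mul_of_norm_sub_le hr hrK hRK hR hκ.le hκ1 (hdx i _ hu.2)
      have h2 := hK.supportFn_pos (gaussMap K u)
      have h3 : rho K u ^ n = supportFn K (gaussMap K u) * surfDensity K u := by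
        unfold surfDensity; field_simp
      rw [h3]
      exact mul_le_mul_of_nonneg_right h1 (hK.surfDensity_pos u).le
    have e2 : ENNReal.ofReal (supportFn K (x i)) *
        ∫⁻ u in W i, ENNReal.ofReal (surfDensity K u) ∂(sph n) ≤
        b * ∫⁻ u in W i, ENNReal.ofReal (rho K u ^ n) ∂(sph n) := by
      have hm2 : Measurable fun u : S n => ENNReal.ofReal (rho K u ^ n) :=
        (hK.continuous_rho.measurable.pow_const _).ennreal_ofReal
      rw [← lintegral_const_mul _ hmeas, ← lintegral_const_mul _ hm2]
      refine setLIntegral_mono (hm2.const_mul _) fun u hu => ?_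
      rw [← ENNReal.ofReal_mul hb0, ← ENNReal.ofReal_mul hx0.le]
      refine ENNReal.ofReal_le_ofReal ?_
      have h1 := hK.supportFn_le_mul_of_norm_sub_le hr hrK hRK hR hκ.le hκ1
        (v := gaussMap K u) (w := x i) (by rw [norm_sub_rev]; exact hdx i _ hu.2)
      have h2 := hK.supportFn_pos (gaussMap K u)
      have h3 : rho K u ^ n = supportFn K (gaussMap K u) * surfDensity K u := by
        unfold surfDensity; field_simp
      rw [h3, ← mul_assoc]
      exact mul_le_mul_of_nonneg_right h1 (hK.surfDensity_pos u).le
    constructor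
    · rw [← ENNReal.mul_le_mul_iff_right hne ENNReal.ofReal_ne_top]
      calc _ ≤ _ := hc.1
        _ ≤ b ^ (2 * n - 1) * (b * ENNReal.ofReal (supportFn K (x i)) *
          ∫⁻ u in W i, ENNReal.ofReal (surfDensity K u) ∂(sph n)) := by gcongr
        _ = _ := by rw [hpow]; ring
    · rw [← ENNReal.mul_le_mul_iff_right hne ENNReal.ofReal_ne_top]
      calc _ ≤ _ := e2
        _ ≤ b * (b ^ (2 * n - 1) * (ENNReal.ofReal (supportFn K (x i)) *
            Measure.euclideanHausdorffMeasure (n - 1) (boundaryPt K '' W i))) := by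
          gcongr
          exact hc.2
        _ = _ := by rw [hpow]; ring
  have hH : Measure.euclideanHausdorffMeasure (n - 1) (boundaryPt K '' ω) =
      ∑' i, Measure.euclideanHausdorffMeasure (n - 1) (boundaryPt K '' W i) := by
    rw [← hWU, image_iUnion, measure_iUnion]
    · exact fun i j hij => (disjoint_image_iff hK.injective_boundaryPt).2 (hWdisj hij)
    · exact fun i => hK.measurableSet_image_boundaryPt (hW i)
  have hI : ∫⁻ u in ω, ENNReal.ofReal (surfDensity K u) ∂(sph n) =
      ∑' i, ∫⁻ u in W i, ENNReal.ofReal (surfDensity K u) ∂(sph n) := by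
    rw [← lintegral_iUnion hW hWdisj, hWU]
  rw [hH, hI, ← ENNReal.tsum_mul_left, ← ENNReal.tsum_mul_left]
  exact ⟨ENNReal.tsum_le_tsum fun i => (hloc i).1, ENNReal.tsum_le_tsum fun i => (hloc i).2⟩

/-- The area formula for the radial parametrization of the boundary. -/
lemma hausdorff_image_boundaryPt (hn : 2 ≤ n) (hK : IsBody K)
    {ω : Set (S n)} (hω : MeasurableSet ω) (hreg : ω ⊆ regularSet K) :
    Measure.euclideanHausdorffMeasure (n - 1) (boundaryPt K '' ω) =
      ∫⁻ u in ω, ENNReal.ofReal (surfDensity K u) ∂(sph n) := by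
  have hlim (c : ℝ≥0∞) : Tendsto (fun κ : ℝ => ENNReal.ofReal (1 - κ)⁻¹ ^ (2 * n) * c) (𝓝[>] 0)
      (𝓝 c) := by
    have h1 : ContinuousAt (fun κ : ℝ => (1 - κ)⁻¹) 0 :=
      (by fun_prop : ContinuousAt (fun κ : ℝ => 1 - κ) 0).inv₀ (by simp)
    have h2 : Tendsto (fun κ : ℝ => ENNReal.ofReal (1 - κ)⁻¹ ^ (2 * n)) (𝓝[>] 0) (𝓝 1) := by
      have h3 := ((ENNReal.continuous_ofReal.continuousAt.comp h1).tendsto).mono_left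
        (nhdsWithin_le_nhds (s := Ioi 0))
      have h4 := ((ENNReal.continuous_pow (2 * n)).tendsto _).comp h3
      simpa [Function.comp_def] using h4
    simpa using ENNReal.Tendsto.mul_const h2 (Or.inl one_ne_zero)
  have hev : ∀ᶠ κ in 𝓝[>] (0 : ℝ), 0 < κ ∧ κ < 1 := by
    filter_upwards [self_mem_nhdsWithin, nhdsWithin_le_nhds (Iio_mem_nhds one_pos)] with κ h1 h2
    exact ⟨h1, h2⟩
  apply le_antisymm
  · refine ge_of_tendsto (hlim _) ?_
    filter_upwards [hev] with κ hκ
    exact (hK.hausdorff_image_compare hn hκ.1 hκ.2 hω hreg).1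
  · refine ge_of_tendsto (hlim _) ?_
    filter_upwards [hev] with κ hκ
    exact (hK.hausdorff_image_compare hn hκ.1 hκ.2 hω hreg).2

/-- Covers the singular boundary points, where no Gauss map is available. There the pieces consist
of directions having some normal near a given centre; they may overlap, and a crude κ = 1/2 suffices
since the cone measure is zero. -/
lemma hausdorff_image_boundaryPt_eq_zero (hn : 2 ≤ n) (hK : IsBody K)
    {ω : Set (S n)} (hω : MeasurableSet ω) (h0 : sph n ω = 0) :
    Measure.euclideanHausdorffMeasure (n - 1) (boundaryPt K '' ω) = 0 := by
  have hn1 : 1 ≤ n := by omega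
  obtain ⟨r, hr, hrK⟩ := hK.exists_closedBall
  obtain ⟨R, hR, hRK⟩ := hK.exists_subset_closedBall
  obtain ⟨d, x, hd, hdisj, hcover, hdx⟩ := exists_small_partition hn
    (δ := (1 / 2) / (R / r + 1)) (by positivity)
  set Z : ℕ → Set (S n) := fun i => {u | ∃ w : S n, ‖(w : E n) - x i‖ ≤ (1 / 2) / (R / r + 1) ∧
      ⟪boundaryPt K u, (w : E n)⟫ = supportFn K w}
  have hZ : ∀ i, MeasurableSet (Z i) := fun i => by
    -- Each piece is the projection of a closed, hence compact, set of pairs (direction, normal),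
    -- and is therefore closed.
    have hcl : IsClosed {p : S n × S n | ‖(p.2 : E n) - x i‖ ≤ (1 / 2) / (R / r + 1) ∧
        ⟪boundaryPt K p.1, (p.2 : E n)⟫ = supportFn K p.2} := by
      have h1 := hK.continuous_boundaryPt
      have h2 := hK.continuous_supportFn
      have h3 : Continuous fun p : S n × S n => ‖(p.2 : E n) - x i‖ := by fun_prop
      have h4 : Continuous fun p : S n × S n => ⟪boundaryPt K p.1, (p.2 : E n)⟫ := by fun_prop
      have h5 : Continuous fun p : S n × S n => supportFn K p.2 := by fun_prop
      exact (isClosed_le h3 continuous_const).inter (isClosed_eq h4 h5)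
    have : Z i = Prod.fst '' {p : S n × S n | ‖(p.2 : E n) - x i‖ ≤ (1 / 2) / (R / r + 1) ∧
        ⟪boundaryPt K p.1, (p.2 : E n)⟫ = supportFn K p.2} := by
      ext u
      constructor
      · rintro ⟨w, hw⟩
        exact ⟨(u, w), hw, rfl⟩
      · rintro ⟨⟨u, w⟩, hw, rfl⟩
        exact ⟨w, hw⟩
    rw [this]
    exact (hcl.isCompact.image continuous_fst).isClosed.measurableSet
  have hcov : ω ⊆ ⋃ i, ω ∩ Z i := by
    intro u hu
    obtain ⟨w, hw⟩ := hK.exists_normal (hK.rho_smul_mem_frontier u)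
    obtain ⟨i, hi⟩ := mem_iUnion.1 (hcover.symm ▸ mem_univ w : w ∈ ⋃ i, d i)
    exact mem_iUnion.2 ⟨i, hu, w, hdx i w hi, hw⟩
  refine measure_mono_null ((image_mono hcov).trans (image_iUnion).subset)
    (measure_iUnion_null fun i => ?_)
  have hc := (hK.hausdorff_image_boundaryPt_compare hn1 hr hrK hRK hR (κ := 1 / 2) (by norm_num)
    (by norm_num) (v := x i) (hω.inter (hZ i)) (fun u hu => hu.2)).1
  have hz : sph n (ω ∩ Z i) = 0 := measure_mono_null inter_subset_left h0
  rw [setLIntegral_measure_zero _ _ hz, mul_zero, nonpos_iff_eq_zero, mul_eq_zero] at hc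
  exact hc.resolve_left (ENNReal.ofReal_pos.2 (hK.supportFn_pos (x i))).ne'

lemma exists_boundaryPt_eq (hK : IsBody K) {z : E n} (hz : z ∈ frontier K) :
    ∃ u : S n, boundaryPt K u = z := by
  have hg := (gauge_eq_one_iff_mem_frontier hK.convex hK.mem_nhds).2 hz
  have hz0 : z ≠ 0 := by
    rintro rfl
    simp at hg
  refine ⟨direction z hz0, ?_⟩
  have hpos : 0 < ‖z‖ := norm_pos_iff.2 hz0
  simp only [boundaryPt, rho, direction]
  rw [gauge_smul_nonneg (inv_nonneg.2 hpos.le), hg, mul_one, inv_inv, smul_smul,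
    mul_inv_cancel₀ hpos.ne', one_smul]

/-- The surface area measure is the image of `surfDensity` under the radial Gauss map. -/
lemma surfaceArea_eq (hn : 2 ≤ n) (hK : IsBody K) {η : Set (S n)} (hη : MeasurableSet η) :
    surfaceArea K η =
      ∫⁻ u in gaussMap K ⁻¹' η, ENNReal.ofReal (surfDensity K u) ∂(sph n) := by
  have hn1 : 1 ≤ n := by omega
  have hreg := measurableSet_regularSet K
  have hpre := measurable_gaussMap K hη
  have hnull := hK.sph_compl_regularSet hn1
  -- The boundary points with a normal in η are sandwiched up to singular points; at a regular point
  -- the unique normal decides membership.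
  have h1 : boundaryPt K '' (regularSet K ∩ gaussMap K ⁻¹' η) ⊆ invGauss K η := by
    rintro _ ⟨u, ⟨hu, hu'⟩, rfl⟩
    exact ⟨hK.rho_smul_mem_frontier u, _, hu', (hK.isUniqueNormal_gaussMap hu).1⟩
  have h2 : invGauss K η ⊆ boundaryPt K '' (regularSet K ∩ gaussMap K ⁻¹' η) ∪
      boundaryPt K '' (regularSet K)ᶜ := by
    rintro z ⟨hz, v, hv, hzv⟩
    obtain ⟨u, rfl⟩ := hK.exists_boundaryPt_eq hz
    by_cases hu : u ∈ regularSet K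
    · refine Or.inl ⟨u, ⟨hu, ?_⟩, rfl⟩
      rw [mem_preimage, ← (hK.isUniqueNormal_gaussMap hu).2 v hzv]
      exact hv
    · exact Or.inr ⟨u, hu, rfl⟩
  have h3 : surfaceArea K η = Measure.euclideanHausdorffMeasure (n - 1)
      (boundaryPt K '' (regularSet K ∩ gaussMap K ⁻¹' η)) := by
    refine le_antisymm ((measure_mono h2).trans ((measure_union_le _ _).trans ?_)) (measure_mono h1)
    rw [hK.hausdorff_image_boundaryPt_eq_zero hn hreg.compl hnull, add_zero]
  rw [h3, hK.hausdorff_image_boundaryPt hn (hreg.inter hpre) inter_subset_left]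
  refine setLIntegral_congr ?_
  filter_upwards [show ∀ᵐ u ∂(sph n), u ∈ regularSet K from hnull] with u hu
  exact propext ⟨fun h => h.2, fun h => ⟨hu, h⟩⟩

end IsBody

end ChordMinkowski

/-! ### Chord density at a boundary point and the dual quermassintegral -/

namespace ChordMinkowski

open Metric Filter Topology
open scoped Pointwise

variable {n : ℕ} {K : Set (E n)} {q : ℝ}

lemma xray_neg (K : Set (E n)) (z : E n) (u : S n) : xray K z (-u) = xray K z u := by
  have : {t : ℝ | z + t • ((-u : S n) : E n) ∈ K} = Neg.neg ⁻¹' {t : ℝ | z + t • (u : E n) ∈ K} := by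
    ext t; simp
  rw [xray, this, Measure.measure_preimage_neg]
  rfl

lemma sph_inner_eq_zero (v : S n) : sph n {u : S n | ⟪(u : E n), (v : E n)⟫ = 0} = 0 := by
  have hm : MeasurableSet {u : S n | ⟪(u : E n), (v : E n)⟫ = 0} :=
    (isClosed_eq (f := fun u : S n => ⟪(u : E n), (v : E n)⟫) (by fun_prop)
      continuous_const).measurableSet
  rw [sph, Measure.toSphere_apply' _ hm, mul_eq_zero]
  right
  have hsub : (Ioo (0 : ℝ) 1 • (Subtype.val '' {u : S n | ⟪(u : E n), (v : E n)⟫ = 0}) : Set (E n)) ⊆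
      ((ℝ ∙ (v : E n))ᗮ : Submodule ℝ (E n)) := by
    rintro _ ⟨s, hs, _, ⟨u, hu, rfl⟩, rfl⟩
    have hu : ⟪(u : E n), (v : E n)⟫ = 0 := hu
    rw [SetLike.mem_coe, Submodule.mem_orthogonal_singleton_iff_inner_left]
    simp only [inner_smul_left, hu, mul_zero]
  refine measure_mono_null hsub (Measure.addHaar_submodule _ _ fun htop => ?_)
  have : (v : E n) ∈ (ℝ ∙ (v : E n))ᗮ := htop ▸ Submodule.mem_top
  rw [Submodule.mem_orthogonal_singleton_iff_inner_left, real_inner_self_eq_norm_sq, norm_coe_S] at this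
  norm_num at this

namespace IsBody

/-- At a boundary point with a unique normal `v`, the rays in the directions of the open half space
opposite to `v` enter `K`. -/
lemma exists_pos_add_smul_mem (hK : IsBody K) {z : E n} (hz : z ∈ K) {v : S n}
    (hv : IsUniqueNormal K z v) {u : S n} (hu : ⟪(u : E n), (v : E n)⟫ < 0) :
    ∃ t : ℝ, 0 < t ∧ z + t • (u : E n) ∈ K := by
  by_contra! hcon
  have hconv : Convex ℝ ((fun t : ℝ => z + t • (u : E n)) '' Ioi 0) := by
    rintro _ ⟨s, hs, rfl⟩ _ ⟨t, ht, rfl⟩ a b ha hb hab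
    refine ⟨a • s + b • t, (convex_Ioi (0 : ℝ)) hs ht ha hb hab, ?_⟩
    simp only [smul_eq_mul]
    rw [show z + (a * s + b * t) • (u : E n) = (a + b) • z + (a * s + b * t) • (u : E n) by
      rw [hab, one_smul]]
    module
  -- If the open ray missed K, a hyperplane would separate it from the interior. Its direction is a
  -- normal at z, hence equals v, yet it is nonnegative on u, contradicting the choice of u.
  obtain ⟨F, c, h1, h2⟩ := geometric_hahn_banach_open hK.convex.interior isOpen_interior hconv (by
    rw [Set.disjoint_left]
    rintro _ hi ⟨t, ht, rfl⟩
    exact hcon t ht (interior_subset hi))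
  set a := (InnerProductSpace.toDual ℝ (E n)).symm F with ha
  have hFa : ∀ y, F y = ⟪y, a⟫ := fun y => by
    rw [real_inner_comm, ha, InnerProductSpace.toDual_symm_apply]
  have hle : ∀ y ∈ K, F y ≤ c := by
    have : closure (interior K) ⊆ {y | F y ≤ c} :=
      closure_minimal (fun y hy => (h1 y hy).le) (isClosed_le F.continuous continuous_const)
    rw [hK.convex.closure_interior_eq_closure_of_nonempty_interior ⟨0, hK.zero_mem⟩] at this
    exact fun y hy => this (subset_closure hy)
  have hray : ∀ t : ℝ, 0 < t → c ≤ F z + t * F u := fun t ht => by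
    have := h2 _ ⟨t, ht, rfl⟩
    rwa [map_add, map_smul, smul_eq_mul] at this
  have hcz : c ≤ F z := by
    have hlim : Tendsto (fun t : ℝ => F z + t * F u) (𝓝[>] 0) (𝓝 (F z + 0 * F u)) :=
      ((by fun_prop : Continuous fun t : ℝ => F z + t * F u).tendsto 0).mono_left nhdsWithin_le_nhds
    rw [zero_mul, add_zero] at hlim
    exact ge_of_tendsto hlim (by filter_upwards [self_mem_nhdsWithin] with t ht using hray t ht)
  have hFz : F z = c := le_antisymm (hle z hz) hcz
  have hFu : 0 ≤ F u := by
    have := hray 1 one_pos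
    linarith
  have ha0 : a ≠ 0 := by
    intro h0
    have h3 := h1 0 hK.zero_mem
    have h4 := hFz
    rw [hFa, h0, inner_zero_right] at h3 h4
    linarith
  have hpos : 0 < ‖a‖⁻¹ := inv_pos.2 (norm_pos_iff.2 ha0)
  have hnormal : ⟪z, (direction a ha0 : E n)⟫ = supportFn K (direction a ha0) := by
    refine le_antisymm (hK.inner_le_supportFn hz _) (hK.supportFn_le fun y hy => ?_)
    simp only [direction, inner_smul_right]
    have := hle y hy
    rw [← hFz, hFa, hFa] at this
    gcongr
  have heq := hv.2 _ hnormal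
  rw [← heq] at hu
  simp only [direction, inner_smul_right] at hu
  rw [hFa] at hFu
  exact absurd hu (not_lt.2 (mul_nonneg hpos.le hFu))

/-- The supporting half space at z excludes the backward ray, so the whole chord lies on the forward
ray and its length is the radial function. -/
lemma radial_pos_and_xray_eq (hK : IsBody K) {z : E n} (hz : z ∈ K) {v : S n}
    (hv : IsUniqueNormal K z v) {u : S n} (hu : ⟪(u : E n), (v : E n)⟫ < 0) :
    0 < radial K z u ∧ xray K z u = ENNReal.ofReal (radial K z u) := by
  set D : Set ℝ := {t : ℝ | 0 ≤ t ∧ z + t • (u : E n) ∈ K}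
  have hset : {t : ℝ | z + t • (u : E n) ∈ K} = D := by
    ext t
    refine ⟨fun ht => ⟨?_, ht⟩, fun ht => ht.2⟩
    have h1 := hK.inner_le_supportFn ht v
    rw [inner_add_left, inner_smul_left, conj_trivial, hv.1] at h1
    by_contra hneg
    nlinarith
  have hclosed : IsClosed D := by
    rw [← hset]
    exact hK.isCompact.isClosed.preimage (by fun_prop)
  have h0 : (0 : ℝ) ∈ D := ⟨le_rfl, by simpa using hz⟩
  have hbdd : BddAbove D := by
    obtain ⟨R, hR, hRK⟩ := hK.exists_subset_closedBall
    refine ⟨R + ‖z‖, fun t ht => ?_⟩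
    have h1 := hRK ht.2
    rw [mem_closedBall_zero_iff] at h1
    have h2 := norm_sub_le (z + t • (u : E n)) z
    rw [add_sub_cancel_left, norm_smul, norm_coe_S, mul_one, Real.norm_eq_abs] at h2
    linarith [le_abs_self t]
  have hmem : sSup D ∈ D := hclosed.csSup_mem ⟨0, h0⟩ hbdd
  have hIcc : D = Icc 0 (sSup D) := by
    ext t
    refine ⟨fun ht => ⟨ht.1, le_csSup hbdd ht⟩, fun ht => ⟨ht.1, ?_⟩⟩
    rcases hmem.1.eq_or_lt with h | h
    · rw [← h] at ht
      have : t = 0 := le_antisymm ht.2 ht.1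
      rw [this]
      exact h0.2
    · have := hK.convex.add_smul_mem hz hmem.2 (t := t / sSup D)
        (show t / sSup D ∈ Icc (0 : ℝ) 1 from ⟨div_nonneg ht.1 h.le, (div_le_one h).2 ht.2⟩)
      rwa [smul_smul, div_mul_cancel₀ _ h.ne'] at this
  obtain ⟨t, ht0, ht⟩ := hK.exists_pos_add_smul_mem hz hv hu
  have hr : radial K z u = sSup D := rfl
  refine ⟨hr ▸ ht0.trans_le (le_csSup hbdd ⟨ht0.le, ht⟩), ?_⟩
  rw [xray, hset, hr]
  conv_lhs => rw [hIcc]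
  rw [Real.volume_Icc, sub_zero]

lemma radial_eq_zero (hK : IsBody K) {z : E n} (hz : z ∈ K) {v : S n}
    (hv : IsUniqueNormal K z v) {u : S n} (hu : 0 < ⟪(u : E n), (v : E n)⟫) :
    radial K z u = 0 := by
  have : {t : ℝ | 0 ≤ t ∧ z + t • (u : E n) ∈ K} = {0} := by
    ext t
    refine ⟨fun ht => ?_, ?_⟩
    · have h1 := hK.inner_le_supportFn ht.2 v
      rw [inner_add_left, inner_smul_left, conj_trivial, hv.1] at h1
      have h2 : t * ⟪(u : E n), (v : E n)⟫ ≤ 0 := by linarith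
      exact le_antisymm (nonpos_of_mul_nonpos_left h2 hu) ht.1
    · rintro rfl
      exact ⟨le_rfl, by simpa using hz⟩
  rw [radial, this, csSup_singleton]

/-- Chord length is even in u, so the hemispheres on the two sides of v contribute equally, which
gives the factor 2; the factor n undoes the normalization of Ṽ. On the inner hemisphere chord length
is the radial function, on the outer one the radial function vanishes, and the equator is a null
set. -/
lemma chordDensity_eq_dualQuermass (hn : 1 ≤ n) (hK : IsBody K) (hq : 1 ≤ q) {z : E n} (hz : z ∈ K)
    {v : S n} (hv : IsUniqueNormal K z v) :
    chordDensity q K z = 2 * n * dualQuermass (q - 1) K z := by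
  set P : Set (S n) := {u | ⟪(u : E n), (v : E n)⟫ < 0}
  set Q : Set (S n) := {u | 0 < ⟪(u : E n), (v : E n)⟫}
  have hin : Continuous fun u : S n => ⟪(u : E n), (v : E n)⟫ := by fun_prop
  have hP : MeasurableSet P := (isOpen_lt hin continuous_const).measurableSet
  have hQ : MeasurableSet Q := (isOpen_lt continuous_const hin).measurableSet
  have hm : Measurable fun u : S n => xray K z u ^ (q - 1) :=
    ((measurable_xray hK.measurableSet).comp measurable_prodMk_left).pow_const _
  have hne : ∀ᵐ u : S n ∂(sph n), ⟪(u : E n), (v : E n)⟫ ≠ 0 :=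
    measure_eq_zero_iff_ae_notMem.1 (sph_inner_eq_zero v)
  have hdisj : Disjoint P Q := Set.disjoint_left.2 fun u h1 h2 =>
    lt_asymm (show ⟪(u : E n), (v : E n)⟫ < 0 from h1) h2
  have hneg : ∫⁻ u in Q, xray K z u ^ (q - 1) ∂(sph n) = ∫⁻ u in P, xray K z u ^ (q - 1) ∂(sph n) := by
    have h1 := measurePreserving_neg_sph.setLIntegral_comp_preimage hQ hm
    simp only [xray_neg] at h1
    rw [← h1]
    congr 2
    ext u
    simp [P, Q]
  have hsplit : chordPotential q K z = 2 * ∫⁻ u in P, xray K z u ^ (q - 1) ∂(sph n) := by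
    rw [two_mul]
    nth_rewrite 2 [← hneg]
    rw [← lintegral_union hQ hdisj, chordPotential, ← setLIntegral_univ]
    refine setLIntegral_congr ?_
    filter_upwards [hne] with u hu
    refine propext ⟨fun _ => ?_, fun _ => trivial⟩
    rcases lt_or_gt_of_ne hu with h | h
    · exact Or.inl h
    · exact Or.inr h
  have hset : {u : S n | 0 < radial K z u} =ᵐ[sph n] P := by
    filter_upwards [hne] with u hu
    refine propext ⟨fun h => ?_, fun h => (hK.radial_pos_and_xray_eq hz hv h).1⟩
    rcases lt_or_gt_of_ne hu with h' | h'
    · exact h'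
    · have h : 0 < radial K z u := h
      rw [hK.radial_eq_zero hz hv h'] at h
      exact absurd h (lt_irrefl _)
  have h_int : ∫ u in {u : S n | 0 < radial K z u}, radial K z u ^ (q - 1) ∂(sph n) =
      (∫⁻ u in P, xray K z u ^ (q - 1) ∂(sph n)).toReal := by
    rw [setIntegral_congr_set hset, ← integral_toReal hm.aemeasurable]
    · refine setIntegral_congr_fun hP fun u hu => ?_
      obtain ⟨h1, h2⟩ := hK.radial_pos_and_xray_eq hz hv hu
      simp only [h2]
      rw [← ENNReal.toReal_rpow, ENNReal.toReal_ofReal h1.le]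
    · exact Eventually.of_forall fun u => ENNReal.rpow_lt_top_of_nonneg (by linarith)
        (xray_ne_top hK.isBounded z u)
  rw [dualQuermass, h_int, chordDensity, hsplit, ENNReal.toReal_mul]
  have : (n : ℝ) ≠ 0 := by positivity
  simp only [ENNReal.toReal_ofNat]
  field_simp

end IsBody

end ChordMinkowski

/-! ### From the Euler–Lagrange equation to the surface area density -/

namespace ChordMinkowski

open Metric Filter Topology
open scoped Pointwise BoundedContinuousFunction

variable {n : ℕ} {K : Set (E n)} {p p' q ε Λ κ : ℝ} {f : S n → ℝ} {φ : ℝ → ℝ}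

/-- The density, in radial coordinates, of the first variation of the chord integral. -/
def chordWeight (q : ℝ) (K : Set (E n)) (u : S n) : ℝ :=
  chordDensity q K (boundaryPt K u) * surfDensity K u

namespace IsBody

lemma chordWeight_pos (hn : 1 ≤ n) (hK : IsBody K) (hq : 1 ≤ q) (u : S n) :
    0 < chordWeight q K u :=
  mul_pos (hK.chordDensity_pos hn hq _) (hK.surfDensity_pos u)

lemma measurable_chordWeight (hn : 1 ≤ n) (hK : IsBody K) (hq : 1 ≤ q) :
    Measurable (chordWeight q K) :=
  ((hK.continuous_chordDensity hn hq).comp hK.continuous_boundaryPt).measurable.mul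
    hK.measurable_surfDensity

lemma integrable_chordWeight (hn : 1 ≤ n) (hK : IsBody K) (hq : 1 ≤ q) :
    Integrable (chordWeight q K) (sph n) := by
  obtain ⟨A, hA⟩ := hK.exists_chordDensity_le hq
  obtain ⟨B, hB⟩ := hK.exists_surfDensity_le
  refine Integrable.of_bound (hK.measurable_chordWeight hn hq).aestronglyMeasurable (A * B)
    (Eventually.of_forall fun u => ?_)
  rw [Real.norm_eq_abs, abs_of_pos (hK.chordWeight_pos hn hq u)]
  exact mul_le_mul (hA _) (hB u) (hK.surfDensity_pos u).le ((chordDensity_nonneg q K _).trans (hA 0))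

lemma integrable_chordWeight_mul (hn : 1 ≤ n) (hK : IsBody K) (hq : 1 ≤ q) {g : S n → ℝ}
    (hg : Continuous g) :
    Integrable (fun u => chordWeight q K u * g (gaussMap K u)) (sph n) := by
  obtain ⟨M, hM⟩ := isCompact_univ.exists_bound_of_continuousOn (f := g) hg.continuousOn
  exact (hK.integrable_chordWeight hn hq).mul_bdd (c := M)
    (hg.measurable.comp (measurable_gaussMap K)).aestronglyMeasurable
    (Eventually.of_forall fun u => hM _ (mem_univ _))

/-- At a regular point ρ ⟪u, ν⟫ = h(ν), which turns ρ^(n-1) / ⟪u, ν⟫ into the surface density ρ^n /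
h(ν). The variation is thus an integral of g against a measure transported by the Gauss map. -/
lemma firstVariation_eq (hn : 1 ≤ n) (hK : IsBody K) (g : S n → ℝ) :
    firstVariation q K g = ∫ u, chordWeight q K u * g (gaussMap K u) ∂(sph n) := by
  refine integral_congr_ae ?_
  filter_upwards [hK.ae_isUniqueNormal hn] with u hu
  have h1 := hu.1
  rw [inner_smul_left, conj_trivial] at h1
  have hρ := hK.rho_pos u
  have hin : ⟪(u : E n), (gaussMap K u : E n)⟫ ≠ 0 := by
    intro h0
    rw [h0, mul_zero] at h1
    exact (hK.supportFn_pos (gaussMap K u)).ne h1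
  have hpow : rho K u ^ n = rho K u ^ (n - 1) * rho K u := by
    rw [← pow_succ, Nat.sub_add_cancel hn]
  simp only [chordWeight, surfDensity, boundaryPt]
  rw [← h1, hpow]
  field_simp

lemma firstVariation_add (hn : 1 ≤ n) (hK : IsBody K) (hq : 1 ≤ q) {g g' : S n → ℝ}
    (hg : Continuous g) (hg' : Continuous g') :
    firstVariation q K (fun v => g v + g' v) = firstVariation q K g + firstVariation q K g' := by
  rw [hK.firstVariation_eq hn, hK.firstVariation_eq hn, hK.firstVariation_eq hn,
    ← integral_add (hK.integrable_chordWeight_mul hn hq hg) (hK.integrable_chordWeight_mul hn hq hg')]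
  simp only [mul_add]

/-- If integration against `μ` is `κ` times the first variation of the chord integral, then the
measure with density `μ` is the image under the radial Gauss map of that with density
`κ * chordWeight q K`. -/
lemma withDensity_eq_map_gaussMap (hn : 1 ≤ n) (hK : IsBody K) (hq : 1 ≤ q) (hκ : 0 < κ)
    {μ : S n → ℝ} (hμi : Integrable μ (sph n)) (hμ : ∀ᵐ v ∂(sph n), 0 < μ v)
    (h_int : ∀ g : S n → ℝ, Continuous g → ∫ v, μ v * g v ∂(sph n) = κ * firstVariation q K g) :
    (sph n).withDensity (fun v => ENNReal.ofReal (μ v)) =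
      ((sph n).withDensity fun u => ENNReal.ofReal (κ * chordWeight q K u)).map (gaussMap K) := by
  have : IsFiniteMeasure ((sph n).withDensity fun v => ENNReal.ofReal (μ v)) :=
    isFiniteMeasure_withDensity_ofReal hμi.2
  have : IsFiniteMeasure ((sph n).withDensity fun u => ENNReal.ofReal (κ * chordWeight q K u)) :=
    isFiniteMeasure_withDensity_ofReal ((hK.integrable_chordWeight hn hq).const_mul κ).2
  have hm : Measurable fun u => ENNReal.ofReal (κ * chordWeight q K u) :=
    ((hK.measurable_chordWeight hn hq).const_mul κ).ennreal_ofReal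
  refine ext_of_forall_integral_eq_of_IsFiniteMeasure fun g => ?_
  rw [integral_map (measurable_gaussMap K).aemeasurable g.continuous.aestronglyMeasurable,
    integral_withDensity_eq_integral_toReal_smul₀ hμi.aemeasurable.ennreal_ofReal
      (Eventually.of_forall fun _ => ENNReal.ofReal_lt_top),
    integral_withDensity_eq_integral_toReal_smul₀ hm.aemeasurable
      (Eventually.of_forall fun _ => ENNReal.ofReal_lt_top)]
  have h1 : ∫ v, (ENNReal.ofReal (μ v)).toReal • g v ∂(sph n) = ∫ v, μ v * g v ∂(sph n) := by
    refine integral_congr_ae ?_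
    filter_upwards [hμ] with v hv
    rw [ENNReal.toReal_ofReal hv.le, smul_eq_mul]
  rw [h1, h_int g g.continuous, hK.firstVariation_eq hn, ← integral_const_mul]
  refine integral_congr_ae (Eventually.of_forall fun u => ?_)
  simp only [smul_eq_mul]
  rw [ENNReal.toReal_ofReal (mul_pos hκ (hK.chordWeight_pos hn hq u)).le, mul_assoc]

/-- The linear function defined by the boundary point touches the support function from below at its
normal, so the gradient of h inverts the Gauss map. -/
lemma gradient_supportFn_gaussMap (hK : IsBody K) {u : S n} (hu : u ∈ regularSet K)
    (hd : DifferentiableAt ℝ (supportFn K) (gaussMap K u : E n)) :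
    gradient (supportFn K) (gaussMap K u : E n) = boundaryPt K u := by
  refine gradient_eq_of_inner_le hd (fun y => ?_) ?_
  · rw [real_inner_comm]
    exact hK.inner_le_supportFn (hK.rho_smul_mem u) y
  · rw [real_inner_comm]
    exact (hK.isUniqueNormal_gaussMap hu).1

lemma differentiableAt_gauge_smul_iff {c : ℝ} (hc : 0 < c) (x : E n) :
    DifferentiableAt ℝ (gauge K) (c • x) ↔ DifferentiableAt ℝ (gauge K) x := by
  have key : ∀ {c : ℝ}, 0 < c → ∀ y : E n,
      DifferentiableAt ℝ (gauge K) (c • y) → DifferentiableAt ℝ (gauge K) y := by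
    intro c hc y hd
    have : gauge K = fun y => c⁻¹ * gauge K (c • y) := by
      ext y
      rw [gauge_smul_nonneg hc.le, inv_mul_cancel_left₀ hc.ne']
    rw [this]
    exact (DifferentiableAt.comp y (g := gauge K) (f := fun y => c • y) hd (by fun_prop)).const_mul _
  refine ⟨key hc x, fun hd => key (inv_pos.2 hc) _ ?_⟩
  rwa [inv_smul_smul₀ hc.ne']

/-- Differentiability of h at v determines the contact point, and differentiability of the gauge
there makes v its only normal. -/
lemma isUniqueNormal_gradient (hK : IsBody K) {v : S n}
    (hd : DifferentiableAt ℝ (supportFn K) (v : E n))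
    (hg : DifferentiableAt ℝ (gauge K) (gradient (supportFn K) (v : E n))) :
    gradient (supportFn K) (v : E n) ∈ K ∧ IsUniqueNormal K (gradient (supportFn K) (v : E n)) v := by
  obtain ⟨x, hx, hxv⟩ := hK.exists_eq_supportFn (v : E n)
  have hgr : gradient (supportFn K) (v : E n) = x :=
    gradient_eq_of_inner_le hd (fun y => by
      rw [real_inner_comm]
      exact hK.inner_le_supportFn hx y) (by rw [real_inner_comm]; exact hxv)
  rw [hgr] at hg ⊢
  obtain ⟨u, rfl⟩ := hK.exists_boundaryPt_eq (hK.mem_frontier_of_inner_eq hx hxv)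
  have h1 := hK.isUniqueNormal_gaussMap ((differentiableAt_gauge_smul_iff (hK.rho_pos u) _).1 hg)
  refine ⟨hx, ?_⟩
  rw [h1.2 v hxv]
  exact h1

section Density

variable {μ : S n → ℝ}

/-- Both transported densities are positive, so the Gauss map respects null sets both ways. This
excludes faces and vertices: no positive amount of directions shares a null set of normals, nor
conversely. -/
lemma sph_preimage_gaussMap_eq_zero_iff (hn : 1 ≤ n) (hK : IsBody K) (hq : 1 ≤ q) (hκ : 0 < κ)
    (hμi : Integrable μ (sph n)) (hμ : ∀ᵐ v ∂(sph n), 0 < μ v)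
    (h_int : ∀ g : S n → ℝ, Continuous g → ∫ v, μ v * g v ∂(sph n) = κ * firstVariation q K g)
    {N : Set (S n)} (hN : MeasurableSet N) :
    sph n (gaussMap K ⁻¹' N) = 0 ↔ sph n N = 0 := by
  have hmeas := hK.withDensity_eq_map_gaussMap hn hq hκ hμi hμ h_int
  have hm : Measurable fun u => ENNReal.ofReal (κ * chordWeight q K u) :=
    ((hK.measurable_chordWeight hn hq).const_mul κ).ennreal_ofReal
  have heq := congrArg (fun ν : Measure (S n) => ν N) hmeas
  simp only [Measure.map_apply (measurable_gaussMap K) hN] at heq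
  have ac1 := withDensity_absolutelyContinuous' hμi.aemeasurable.ennreal_ofReal (by
    filter_upwards [hμ] with v hv using (ENNReal.ofReal_pos.2 hv).ne')
  have ac2 := withDensity_absolutelyContinuous' hm.aemeasurable (μ := sph n)
    (Eventually.of_forall fun u =>
      (ENNReal.ofReal_pos.2 (mul_pos hκ (hK.chordWeight_pos hn hq u))).ne')
  constructor
  · intro h
    exact ac1 (heq.trans (withDensity_absolutelyContinuous _ _ h))
  · intro h
    exact ac2 (heq.symm.trans (withDensity_absolutelyContinuous _ _ h))

/-- Differentiability of h at almost every normal is pulled back to almost every direction.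
Regularity of the boundary point, known for almost every direction, is then pushed forward to almost
every normal. -/
lemma ae_isUniqueNormal_gradient (hn : 1 ≤ n) (hK : IsBody K) (hq : 1 ≤ q) (hκ : 0 < κ)
    (hμi : Integrable μ (sph n)) (hμ : ∀ᵐ v ∂(sph n), 0 < μ v)
    (h_int : ∀ g : S n → ℝ, Continuous g → ∫ v, μ v * g v ∂(sph n) = κ * firstVariation q K g) :
    (∀ᵐ u ∂(sph n), gradient (supportFn K) (gaussMap K u : E n) = boundaryPt K u) ∧
    ∀ᵐ v : S n ∂(sph n), gradient (supportFn K) (v : E n) ∈ K ∧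
      IsUniqueNormal K (gradient (supportFn K) (v : E n)) v := by
  set D : Set (S n) := {v | DifferentiableAt ℝ (supportFn K) (v : E n)}
  have hD : MeasurableSet D :=
    (measurableSet_of_differentiableAt ℝ (supportFn K)).preimage measurable_subtype_coe
  have hgm : Measurable fun v : S n => gradient (supportFn K) (v : E n) :=
    (measurable_gradient _).comp measurable_subtype_coe
  set G : Set (S n) := {v | DifferentiableAt ℝ (gauge K) (gradient (supportFn K) (v : E n))}
  have hG : MeasurableSet G := (measurableSet_of_differentiableAt ℝ (gauge K)).preimage hgm
  have hDae : sph n Dᶜ = 0 := hK.ae_differentiableAt_supportFn hn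
  have hD' : ∀ᵐ u ∂(sph n), gaussMap K u ∈ D :=
    (hK.sph_preimage_gaussMap_eq_zero_iff hn hq hκ hμi hμ h_int hD.compl).2 hDae
  have hreg : ∀ᵐ u ∂(sph n), u ∈ regularSet K := hK.sph_compl_regularSet hn
  have h1 : ∀ᵐ u ∂(sph n), gradient (supportFn K) (gaussMap K u : E n) = boundaryPt K u := by
    filter_upwards [hD', hreg] with u hu hu'
    exact hK.gradient_supportFn_gaussMap hu' hu
  have hG' : ∀ᵐ u ∂(sph n), gaussMap K u ∈ G := by
    filter_upwards [h1, hreg] with u hu hu'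
    show DifferentiableAt ℝ (gauge K) (gradient (supportFn K) (gaussMap K u : E n))
    rw [hu]
    exact (differentiableAt_gauge_smul_iff (hK.rho_pos u) _).2 hu'
  have hGae : ∀ᵐ v ∂(sph n), v ∈ G :=
    (hK.sph_preimage_gaussMap_eq_zero_iff hn hq hκ hμi hμ h_int hG.compl).1 hG'
  refine ⟨h1, ?_⟩
  filter_upwards [hK.ae_differentiableAt_supportFn hn, hGae] with v hv hvG
  exact hK.isUniqueNormal_gradient hv hvG

/-- If integration against `μ` is `κ` times the first variation of the chord integral, then the
surface area measure has a density. -/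
lemma surfaceArea_eq_setLIntegral (hn : 2 ≤ n) (hK : IsBody K) (hq : 1 ≤ q) (hκ : 0 < κ)
    (hμi : Integrable μ (sph n)) (hμ : ∀ᵐ v ∂(sph n), 0 < μ v)
    (h_int : ∀ g : S n → ℝ, Continuous g → ∫ v, μ v * g v ∂(sph n) = κ * firstVariation q K g)
    {η : Set (S n)} (hη : MeasurableSet η) :
    surfaceArea K η = ∫⁻ v in η, ENNReal.ofReal
      (μ v / (κ * chordDensity q K (gradient (supportFn K) (v : E n)))) ∂(sph n) := by
  have hn1 : 1 ≤ n := by omega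
  set w : S n → ℝ := fun v => (κ * chordDensity q K (gradient (supportFn K) (v : E n)))⁻¹ with hw
  have hwm : Measurable w :=
    (((hK.continuous_chordDensity hn1 hq).measurable.comp
      ((measurable_gradient _).comp measurable_subtype_coe)).const_mul κ).inv
  have hm : Measurable fun u => ENNReal.ofReal (κ * chordWeight q K u) :=
    ((hK.measurable_chordWeight hn1 hq).const_mul κ).ennreal_ofReal
  have hGm : Measurable (η.indicator fun v => ENNReal.ofReal (w v)) :=
    hwm.ennreal_ofReal.indicator hη
  -- The identity of measures is tested on 1_η / (κ D(∇h)). At v = ν(u) the gradient is the boundary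
  -- point in direction u, so D cancels and only the surface density remains.
  have key := congrArg (fun ν : Measure (S n) => ∫⁻ v, η.indicator (fun v => ENNReal.ofReal (w v)) v ∂ν)
    (hK.withDensity_eq_map_gaussMap hn1 hq hκ hμi hμ h_int)
  rw [lintegral_map hGm (measurable_gaussMap K),
    lintegral_withDensity_eq_lintegral_mul₀ hμi.aemeasurable.ennreal_ofReal hGm.aemeasurable,
    lintegral_withDensity_eq_lintegral_mul₀ hm.aemeasurable (g := fun u =>
      η.indicator (fun v => ENNReal.ofReal (w v)) (gaussMap K u))
      (hGm.comp (measurable_gaussMap K)).aemeasurable] at key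
  rw [hK.surfaceArea_eq hn hη, ← lintegral_indicator (measurable_gaussMap K hη),
    ← lintegral_indicator hη]
  calc ∫⁻ u, (gaussMap K ⁻¹' η).indicator (fun u => ENNReal.ofReal (surfDensity K u)) u ∂(sph n)
      = _ := lintegral_congr_ae ?_
    _ = _ := key.symm
    _ = _ := lintegral_congr_ae ?_
  · filter_upwards [(hK.ae_isUniqueNormal_gradient hn1 hq hκ hμi hμ h_int).1] with u hu
    by_cases h : gaussMap K u ∈ η
    · rw [indicator_of_mem (show u ∈ gaussMap K ⁻¹' η from h), Pi.mul_apply, indicator_of_mem h,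
        ← ENNReal.ofReal_mul (mul_pos hκ (hK.chordWeight_pos hn1 hq u)).le]
      congr 1
      have := hK.chordDensity_pos hn1 hq (boundaryPt K u)
      simp only [hw, chordWeight, hu]
      field_simp
    · rw [indicator_of_notMem (show u ∉ gaussMap K ⁻¹' η from h), Pi.mul_apply,
        indicator_of_notMem h, mul_zero]
  · filter_upwards [hμ] with v hv
    by_cases h : v ∈ η
    · rw [Pi.mul_apply, indicator_of_mem h, indicator_of_mem h, ← ENNReal.ofReal_mul hv.le,
        div_eq_mul_inv]
    · rw [Pi.mul_apply, indicator_of_notMem h, indicator_of_notMem h, mul_zero]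

lemma surfaceArea_ne_top (hn : 2 ≤ n) (hK : IsBody K) : surfaceArea K univ ≠ ∞ := by
  obtain ⟨B, hB⟩ := hK.exists_surfDensity_le
  rw [hK.surfaceArea_eq hn MeasurableSet.univ, preimage_univ, setLIntegral_univ]
  refine ((lintegral_mono fun u => ENNReal.ofReal_le_ofReal (hB u)).trans_lt ?_).ne
  rw [lintegral_const]
  exact ENNReal.mul_lt_top ENNReal.ofReal_lt_top (measure_lt_top _ _)

end Density

end IsBody

/-- The Euler–Lagrange equation of the maximization problem. -/
lemma integral_deriv_mul_firstVariation (hn : 2 ≤ n) (hq : 1 ≤ q) (hε : 0 < ε)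
    (hφ : IsApproxFn n p p' ε φ)
    (hf : AEMeasurable f (sph n)) (hfΛ : ∀ᵐ v ∂(sph n), 1 / Λ < f v ∧ f v < Λ) (hΛ : 0 < Λ)
    (hK : IsBody K) (hmax : IsMaximizer q f φ fun v => supportFn K v)
    (hξ : IsMinOn (Phi f φ fun v => supportFn K v) K 0)
    (hpos : 0 < firstVariation q K fun v => supportFn K v) {g : S n → ℝ} (hg : Continuous g) :
    firstVariation q K (fun v => supportFn K v) *
        ∫ v : S n, f v * (deriv φ (supportFn K v) * g v) ∂(sph n) =
      firstVariation q K g *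
        ∫ v : S n, f v * (deriv φ (supportFn K v) * supportFn K v) ∂(sph n) := by
  have hn1 : 1 ≤ n := by omega
  have hh : Continuous fun v : S n => supportFn K v :=
    hK.continuous_supportFn.comp continuous_subtype_val
  have hd : Continuous fun v : S n => deriv φ (supportFn K v) :=
    continuous_comp_of_pos hφ.continuousOn_deriv hh fun v => hK.supportFn_pos v
  set a := firstVariation q K fun v => supportFn K v
  set L : (S n → ℝ) → ℝ := fun g => ∫ v : S n, f v * (deriv φ (supportFn K v) * g v) ∂(sph n)
  have hLadd : ∀ {g g' : S n → ℝ}, Continuous g → Continuous g' →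
      L (fun v => g v + g' v) = L g + L g' := fun hg hg' => by
    simp only [L, mul_add]
    exact integral_add (integrable_mul_comp hf hfΛ hΛ (hd.mul hg))
      (integrable_mul_comp hf hfΛ hΛ (hd.mul hg'))
  have hLmul : ∀ (c : ℝ) (g : S n → ℝ), L (fun v => c * g v) = c * L g := fun c g => by
    simp only [L]
    rw [← integral_const_mul]
    congr 1
    ext v
    ring
  have hch : ∀ c : ℝ, Continuous fun v : S n => c * supportFn K v := fun c => by fun_prop
  have hL : ∀ {g : S n → ℝ}, Continuous g → 0 ≤ firstVariation q K g → L g ≤ 0 := by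
    intro g hg h0
    -- Adding δ h makes the first variation strictly positive; δ then tends to 0.
    have h1 : ∀ δ : ℝ, 0 < δ → L g + δ * L (fun v => supportFn K v) ≤ 0 := fun δ hδ => by
      rw [← hLmul, ← hLadd hg (hch δ)]
      refine integral_deriv_mul_nonpos hn hq hε hφ hf hfΛ hΛ hK hmax hξ
        (hg.add (hch δ)) ?_
      rw [hK.firstVariation_add hn1 hq hg (hch δ), IsBody.firstVariation_const_mul]
      exact add_pos_of_nonneg_of_pos h0 (mul_pos hδ hpos)
    have hlim : Tendsto (fun δ : ℝ => L g + δ * L (fun v => supportFn K v)) (𝓝[>] 0)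
        (𝓝 (L g + 0 * L (fun v => supportFn K v))) :=
      ((by fun_prop : Continuous fun δ : ℝ => L g + δ * L (fun v => supportFn K v)).tendsto
        0).mono_left nhdsWithin_le_nhds
    rw [zero_mul, add_zero] at hlim
    exact le_of_tendsto hlim (by filter_upwards [self_mem_nhdsWithin] with δ hδ using h1 δ hδ)
  have hcg : ∀ c : ℝ, Continuous fun v : S n => c * g v := fun c => by fun_prop
  -- The combination a g - V(g) h has zero first variation, so both signs s = 1 and s = -1 are
  -- admissible and the inequality becomes an equality.
  have hzero : ∀ s : ℝ, L (fun v => s * a * g v + -(s * firstVariation q K g) * supportFn K v) ≤ 0 :=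
    fun s => by
      refine hL ((hcg _).add (hch _)) (le_of_eq ?_)
      rw [hK.firstVariation_add hn1 hq (hcg _) (hch _),
        IsBody.firstVariation_const_mul, IsBody.firstVariation_const_mul]
      ring
  have h1 := hzero 1
  have h2 := hzero (-1)
  rw [hLadd (hcg _) (hch _), hLmul, hLmul] at h1 h2
  show a * L g = firstVariation q K g * L (fun v => supportFn K v)
  linarith

end ChordMinkowski

end

/-! ### Assembly: the constant C_ε and the generalized solution -/

theorem theorem4 (n : ℕ) (hn : 2 ≤ n)
    (p q p' ε Λ : ℝ) (hp : -(n : ℝ) < p) (hp0 : p < 0) (hq : 1 ≤ q) (hqn : q < (n : ℝ) + 1)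
    (hp' : -(n : ℝ) < p') (hp'1 : p' ≤ -(n : ℝ) + 1) (hε : 0 < ε) (hε4 : ε < 1 / 4)
    (hΛ : 0 < Λ)
    (f : ChordMinkowski.S n → ℝ) (hf : AEMeasurable f (ChordMinkowski.sph n))
    (hfΛ : ∀ᵐ v ∂(ChordMinkowski.sph n), 1 / Λ < f v ∧ f v < Λ)
    (φ : ℝ → ℝ) (hφ : ChordMinkowski.IsApproxFn n p p' ε φ)
    (h : ChordMinkowski.S n → ℝ) (hmax : ChordMinkowski.IsMaximizer q f φ h)
    (hξ : IsMinOn (ChordMinkowski.Phi f φ h) (ChordMinkowski.wulffShape h) 0) :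
    0 < ChordMinkowski.normConst q f φ h ∧
    ChordMinkowski.IsGeneralizedSolution h (fun v =>
      -(f v * deriv φ (h v)) /
        (ChordMinkowski.normConst q f φ h *
          ChordMinkowski.dualQuermass (q - 1) (ChordMinkowski.wulffShape h)
            (ChordMinkowski.euclGrad h v))) := by
  open ChordMinkowski in
  have hn1 : 1 ≤ n := by omega
  have hn0 : (0 : ℝ) < n := by exact_mod_cast hn1
  obtain ⟨K, hKc, hKv, hK0, hhK⟩ := hmax.1
  have hK : IsBody K := ⟨hKc, hKv, hK0⟩
  obtain rfl : h = fun v : S n => supportFn K v := funext hhK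
  have hmem := hmax.1
  have hI := hmax.2.1
  simp only [hK.wulffShape_supportFn, euclGrad, hK.homExt_supportFn] at hξ hI ⊢
  have hω : 0 < omega n := omega_pos
  have hnω : 0 < n * omega n := mul_pos hn0 hω
  have hh : Continuous fun v : S n => supportFn K v :=
    hK.continuous_supportFn.comp continuous_subtype_val
  have hd : Continuous fun v : S n => deriv φ (supportFn K v) :=
    continuous_comp_of_pos hφ.continuousOn_deriv hh fun v => hK.supportFn_pos v
  have hmass : chordMass q K = n * omega n := by
    rw [hK.chordIntegral_eq_ofReal hn1 hq, ENNReal.ofReal_eq_one, div_eq_one_iff_eq hnω.ne'] at hI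
    exact hI
  have hF := hK.mul_firstVariation_supportFn hn1 hq
  rw [hmass] at hF
  set a := firstVariation q K fun v => supportFn K v
  have hs : 0 < (n : ℝ) + q - 1 := by linarith
  have ha : 0 < a := by
    have : 0 < q * a := hF ▸ mul_pos hs hnω
    exact pos_of_mul_pos_right this (by linarith)
  set μ : S n → ℝ := fun v => -(f v * deriv φ (supportFn K v)) with hμdef
  have hμi : MeasureTheory.Integrable μ (sph n) := (integrable_mul_comp hf hfΛ hΛ hd).neg
  have hμ : ∀ᵐ v ∂(sph n), 0 < μ v := by
    filter_upwards [hfΛ] with v hv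
    have hfv : 0 < f v := (by positivity : 0 < 1 / Λ).trans hv.1
    exact neg_pos.2 (mul_neg_of_pos_of_neg hfv (hφ.deriv_neg (hK.supportFn_pos v)))
  have hJ : ∀ g : S n → ℝ, ∫ v, μ v * g v ∂(sph n) =
      -∫ v : S n, f v * (deriv φ (supportFn K v) * g v) ∂(sph n) := fun g => by
    rw [← MeasureTheory.integral_neg]
    congr 1
    ext v
    simp only [hμdef]
    ring
  have hJi : MeasureTheory.Integrable (fun v => μ v * supportFn K v) (sph n) := by
    refine (integrable_mul_comp hf hfΛ hΛ (hd.mul hh)).neg.congr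
      (Filter.Eventually.of_forall fun v => ?_)
    simp only [hμdef, Pi.neg_apply, Pi.mul_apply]
    ring
  have hJpos : 0 < ∫ v, μ v * supportFn K v ∂(sph n) := by
    have hpos : ∀ᵐ v ∂(sph n), 0 < μ v * supportFn K v := by
      filter_upwards [hμ] with v hv using mul_pos hv (hK.supportFn_pos v)
    rw [MeasureTheory.integral_pos_iff_support_of_nonneg_ae (hpos.mono fun v hv => hv.le) hJi]
    have hsupp : Function.support (fun v => μ v * supportFn K v) =ᵐ[sph n] Set.univ := by
      filter_upwards [hpos] with v hv
      exact propext ⟨fun _ => trivial, fun _ => hv.ne'⟩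
    rw [MeasureTheory.measure_congr hsupp]
    have := nontrivial_E hn1
    exact MeasureTheory.Measure.measure_univ_pos.2 (MeasureTheory.Measure.toSphere_ne_zero _)
  have hC : normConst q f φ (fun v => supportFn K v) =
      2 * q / (((n : ℝ) + q - 1) * omega n) * ∫ v, μ v * supportFn K v ∂(sph n) := by
    rw [hJ, normConst]
    simp only [mul_assoc]
    ring
  set C := normConst q f φ fun v => supportFn K v
  have hCpos : 0 < C := by
    rw [hC]
    exact mul_pos (div_pos (by linarith) (mul_pos hs hω)) hJpos
  -- The factor 2n is the ratio of the chord density to Ṽ_{q-1}, so that κ D = C Ṽ at the contact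
  -- points.
  set κ := C / (2 * n) with hκdef
  have hκ : 0 < κ := by positivity
  -- From q a = (n+q-1) n ω_n, which is the constraint I_q = 1 combined with homogeneity; this is
  -- where the prefactor of C_ε comes from.
  have hκa : κ * a = ∫ v, μ v * supportFn K v ∂(sph n) := by
    rw [hκdef, hC]
    have ha' : a = (n + q - 1) * (n * omega n) / q := by
      rw [eq_div_iff (by linarith), mul_comm]
      exact hF
    rw [ha']
    field_simp
  have h_int : ∀ g : S n → ℝ, Continuous g →
      ∫ v, μ v * g v ∂(sph n) = κ * firstVariation q K g := fun g hg => by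
    have h1 := integral_deriv_mul_firstVariation hn hq hε hφ hf hfΛ hΛ hK hmax hξ ha hg
    have h2 := hJ g
    have h3 := hJ fun v => supportFn K v
    refine mul_left_cancel₀ ha.ne' ?_
    rw [h2, mul_neg, h1, ← mul_neg, ← h3, ← hκa]
    ring
  refine ⟨hCpos, hmem, ?_⟩
  have hae := (hK.ae_isUniqueNormal_gradient hn1 hq hκ hμi hμ h_int).2
  set w : S n → ℝ := fun v => chordDensity q K (gradient (supportFn K) (v : E n)) with hw
  have hw0 : ∀ v, 0 < w v := fun v => hK.chordDensity_pos hn1 hq _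
  -- Only almost everywhere: the passage to Ṽ requires that ∇h(v) have v as its unique normal.
  have hR : (fun v : S n => μ v / (κ * w v)) =ᵐ[sph n] fun v : S n =>
      μ v / (C * dualQuermass (q - 1) K (gradient (supportFn K) (v : E n))) := by
    filter_upwards [hae] with v hv
    simp only [hw]
    rw [hK.chordDensity_eq_dualQuermass hn1 hq hv.1 hv.2, hκdef]
    congr 1
    field_simp
  have hR0 : ∀ᵐ v ∂(sph n), 0 ≤ μ v / (κ * w v) := by
    filter_upwards [hμ] with v hv using (div_pos hv (mul_pos hκ (hw0 v))).le
  have hwm : Measurable w := (hK.continuous_chordDensity hn1 hq).measurable.comp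
    ((measurable_gradient _).comp measurable_subtype_coe)
  -- The integral of this nonnegative density is the total surface area of K, which is finite.
  have hRi : MeasureTheory.Integrable (fun v : S n => μ v / (κ * w v)) (sph n) := by
    refine ⟨(hμi.aemeasurable.div (hwm.const_mul κ).aemeasurable).aestronglyMeasurable, ?_⟩
    rw [MeasureTheory.hasFiniteIntegral_iff_ofReal hR0, lt_top_iff_ne_top,
      ← MeasureTheory.setLIntegral_univ,
      ← hK.surfaceArea_eq_setLIntegral hn hq hκ hμi hμ h_int MeasurableSet.univ]
    exact hK.surfaceArea_ne_top hn
  refine ⟨?_, hRi.congr hR, fun η hη => ?_⟩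
  · filter_upwards [hR0, hR] with v hv hv'
    rw [← hv']
    exact hv
  · rw [hK.wulffShape_supportFn, hK.surfaceArea_eq_setLIntegral hn hq hκ hμi hμ h_int hη]
    refine MeasureTheory.lintegral_congr_ae (MeasureTheory.ae_restrict_of_ae ?_)
    filter_upwards [hR] with v hv
    rw [← hv]
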